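/- Let $n\in\{1,2,3\}$, and let $\Omega=\mathbb R^n$ or $\Omega=B_R=\{x\in\mathbb R^n:|x|<R\}$ for some $R>0$. Let $\lambda,\gamma\in\mathbb R$ and let $p=2q+3$ satisfy $1<p<p_S$, where $p_S=\frac{n+2}{n-2}$ if $n\ge 3$ and $p_S=\infty$ if $n\in\{1,2\}$. For $\beta\in\mathbb R$ consider the system $$ \left.\begin{aligned} -\Delta u+\lambda u+\gamma v&=|u|^{2q+2}u+\beta|v|^{q+2}|u|^{q}u,\\ -\Delta v+\lambda v+\gamma u&=|v|^{2q+2}v+\beta|u|^{q+2}|v|^{q}v \end{aligned}\right\}\ \text{in }\Omega,\qquad u=v=0\ \text{on }\partial\Omega\ \text{ if }\partial\Omega\neq\emptyset, \tag{1} $$ where $|s|^q s:=0$ for $s=0$. Classical solutions are pairs $u,v\in C^2(\Omega)\cap C(\overline\Omega)$ satisfying (1) pointwise. For an interval $J\subset\mathbb R$ and a continuous $f:J\to\mathbb R$ let $z_J(f)\in\{0,1,2,\dots\}\cup\{\infty\}$ be the number of sign changes of $f$: the supremum of all $j$ for which there are $x_1<x_2<\dots<x_{j+1}$ in $J$ with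 $f(x_i)f(x_{i+1})<0$ for $i=1,\dots,j$ (and $0$ if there is no such $j\ge1$). For a continuous radial function $w(x)=\tilde w(|x|)$ on $\Omega$ set $z(w):=z_J(\tilde w)$, where $J=\{|x|:x\in\Omega\}$. Given $C_1,C_2,C_3,C_4\ge0$, let $\mathcal K$ be the set of pairs $(u,v)$ of radial functions on $\Omega$ with $z(u)\le C_1$, $z(v)\le C_2$, $z(u-v)\le C_3$, $z(u+v)\le C_4$, and let $\mathcal K^*$ be the set of all $(u,v)\in\mathcal K$ with $u\not\equiv v$ and $u\not\equiv -v$. Fix $C_1,C_2,C_3,C_4\ge0$, a compact set $B\subset\mathbb R\setminus\{-1\}$ and a compact set $B^*\subset\mathbb R$. Then there exists a constant $C$ such that every classical radial solution $(u,v)\in\mathcal K$ of (1) with $\beta\in B$, and every classical radial solution $(u,v)\in\mathcal K^*$ of (1) with $\beta\in B^*$, satisfies $\|(u,v)\|_\infty\le C$, where $\|(u,v)\|_\infty=\sup_{x\in\Omega}\max\{|u(x)|,|v(x)|\}$. -/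

import Mathlib

open scoped ENNReal NNReal

noncomputable section

/-- The critical Sobolev exponent in dimension `n`: `(n+2)/(n-2)` if `n ≥ 3`, and `∞` otherwise. -/
def sobolevExponent (n : ℕ) : EReal :=
  if 3 ≤ n then (((n + 2 : ℝ) / (n - 2 : ℝ) : ℝ) : EReal) else ⊤

/-- The zero number `z_J(f)`, that is, the number of sign changes of `f` in `J`: the supremum of all
`j` for which there are `x₀ < x₁ < ⋯ < x_j` in `J` with `f x_i * f x_{i+1} < 0` for all `i < j`. -/
def zeroNumber (J : Set ℝ) (f : ℝ → ℝ) : ℕ∞ :=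
  ⨆ (j : ℕ) (_ : ∃ x : Fin (j + 1) → ℝ, StrictMono x ∧ (∀ i, x i ∈ J) ∧
    ∀ i : Fin j, f (x i.castSucc) * f (x i.succ) < 0), (j : ℕ∞)

/-- `U` is the radial profile of `u` on `Ω`: it is continuous on the set `{|x| : x ∈ Ω}` of radii,
and `u x = U |x|` for all `x ∈ Ω`. -/
def IsRadialProfile {n : ℕ} (Ω : Set (EuclideanSpace ℝ (Fin n)))
    (u : EuclideanSpace ℝ (Fin n) → ℝ) (U : ℝ → ℝ) : Prop :=
  ContinuousOn U (norm '' Ω) ∧ ∀ x ∈ Ω, u x = U ‖x‖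

/-- The class `𝒦(C₁, C₂, C₃, C₄)` of pairs of radial functions `(u, v)` on `Ω` such that
`z(u) ≤ C₁`, `z(v) ≤ C₂`, `z(u - v) ≤ C₃`, `z(u + v) ≤ C₄`. The zero number of a radial function is
the zero number of its profile on the set of radii. -/
def classK {n : ℕ} (Ω : Set (EuclideanSpace ℝ (Fin n))) (C₁ C₂ C₃ C₄ : ℝ≥0) :
    Set ((EuclideanSpace ℝ (Fin n) → ℝ) × (EuclideanSpace ℝ (Fin n) → ℝ)) :=
  {w | ∃ U V : ℝ → ℝ, IsRadialProfile Ω w.1 U ∧ IsRadialProfile Ω w.2 V ∧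
    (zeroNumber (norm '' Ω) U : ℝ≥0∞) ≤ C₁ ∧
    (zeroNumber (norm '' Ω) V : ℝ≥0∞) ≤ C₂ ∧
    (zeroNumber (norm '' Ω) (fun r => U r - V r) : ℝ≥0∞) ≤ C₃ ∧
    (zeroNumber (norm '' Ω) (fun r => U r + V r) : ℝ≥0∞) ≤ C₄}

/-- The class `𝒦*` of all `(u, v) ∈ 𝒦` with neither `u ≡ v` nor `u ≡ -v` on `Ω`. -/
def classKStar {n : ℕ} (Ω : Set (EuclideanSpace ℝ (Fin n))) (C₁ C₂ C₃ C₄ : ℝ≥0) :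
    Set ((EuclideanSpace ℝ (Fin n) → ℝ) × (EuclideanSpace ℝ (Fin n) → ℝ)) :=
  {w | w ∈ classK Ω C₁ C₂ C₃ C₄ ∧ ¬ (∀ x ∈ Ω, w.1 x = w.2 x) ∧ ¬ (∀ x ∈ Ω, w.1 x = -w.2 x)}

/-- `(u, v)` is a classical solution (`C²` in the open set `Ω`, continuous up to the boundary) of
`-Δu + λu + γv = |u|^(2q+2) u + β |v|^(q+2) |u|^q u`,
`-Δv + λv + γu = |v|^(2q+2) v + β |u|^(q+2) |v|^q v` in `Ω`, with `u = v = 0` on `∂Ω`. -/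
structure IsClassicalSolution {n : ℕ} (Ω : Set (EuclideanSpace ℝ (Fin n))) (q lam γ β : ℝ)
    (u v : EuclideanSpace ℝ (Fin n) → ℝ) : Prop where
  contDiffOn_fst : ContDiffOn ℝ 2 u Ω
  contDiffOn_snd : ContDiffOn ℝ 2 v Ω
  continuousOn_fst : ContinuousOn u (closure Ω)
  continuousOn_snd : ContinuousOn v (closure Ω)
  eqn_fst : ∀ x ∈ Ω, -(Laplacian.laplacian u x) + lam * u x + γ * v x =
    |u x| ^ (2 * q + 2) * u x + β * |v x| ^ (q + 2) * |u x| ^ q * u x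
  eqn_snd : ∀ x ∈ Ω, -(Laplacian.laplacian v x) + lam * v x + γ * u x =
    |v x| ^ (2 * q + 2) * v x + β * |u x| ^ (q + 2) * |v x| ^ q * v x
  boundary_fst : ∀ x ∈ frontier Ω, u x = 0
  boundary_snd : ∀ x ∈ frontier Ω, v x = 0

end

/-! The proof is a blow-up argument ending in Liouville theorems for ordinary differential
equations. Read along a ray, a classical radial solution becomes a pair of profiles on the set of
radii with friction `m / r`, `m = n - 1`. The zero number bounds become the absence of `N`
alternations for `U`, `V`, `U - V` and `U + V`. If no a priori bound held, the selection argument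
`exists_dominating` would give radii `r k` and scales `μ k`, `ℓ k` with `ℓ k ^ 2 * μ k ^ (2q+2) = 1`
and `ℓ k → 0`, for which the rescaled profiles are bounded on growing neighbourhoods and have
maximum norm one at the centre. The linear terms disappear under rescaling, and `Sol.exists_limit`
produces a nontrivial bounded limit `(X, Y)`. If `r k = O(ℓ k)`, the limit lives on `(0, ∞)` and
keeps the friction `m / t`; otherwise the friction vanishes and the limit lives on a line, or on a
half-line with zero boundary value.

A bounded number of alternations survives the limit, so `X`, `Y`, `X - Y`, `X + Y` are eventually of
one sign, and by symmetry one may assume `0 ≤ Y ≤ X` near infinity. Then the sum (for `β₀ > -1`, by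
`nl_add_ge`) or the difference (for `β₀ ≤ 0`, by `nl_sub_ge`) is a nonnegative supersolution of a
superlinear equation. In dimensions one and two, and in dimension three for `q ≤ 0`, such a function
cannot be positive on a half-line (`no_positive_supersolution`). In dimension three with `0 ≤ q < 1`
the same inequality still gives the decay `t ^ (-1/(q+1))`. The Emden–Fowler variables then turn the
system into an autonomous one whose energy is monotone because `p < 5`, and this forces the solution
to vanish (`eq_zero_of_decay`).

Hence `β₀ > -1` gives a zero limit, a contradiction, while `β₀ ≤ -1` gives `X = ±Y`, and `X` solves
a scalar equation with coefficient `-(1 + β₀)`. For `β₀ < -1` this is an absorption equation, whose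
bounded solutions of the types that occur are zero. For `β₀ = -1` the limit is a nonzero constant,
and only here is `u ≢ ±v` needed: the rescaled difference (or sum) is nontrivial and obeys a Sturm
inequality with potential bounded below, so it oscillates more than `N` times on a long interval
(`false_of_limit_const`). -/

namespace RadialSystem
open Filter Topology Set

/-! ### The nonlinearity and its one-sided inequalities -/

/-- The signed power `|x|^q x`. -/
noncomputable def spow (q x : ℝ) : ℝ := |x| ^ q * x

/-- The nonlinearity `|x|^(2q+2) x + β |y|^(q+2) |x|^q x`. -/
noncomputable def nl (q β x y : ℝ) : ℝ :=
  |x| ^ (2 * q + 2) * x + β * |y| ^ (q + 2) * |x| ^ q * x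

lemma spow_eq_max {q : ℝ} (hq : -1 < q) (x : ℝ) :
    spow q x = (max x 0) ^ (q + 1) - (max (-x) 0) ^ (q + 1) := by
  have h0 : (0 : ℝ) ^ (q + 1) = 0 := Real.zero_rpow (by linarith)
  rcases lt_trichotomy x 0 with h | h | h
  · rw [spow, max_eq_right h.le, max_eq_left (by linarith), h0, abs_of_neg h,
      Real.rpow_add_one (by linarith)]
    ring
  · subst h; simp [spow]
  · rw [spow, max_eq_left h.le, max_eq_right (by linarith), h0, abs_of_pos h,
      Real.rpow_add_one (by linarith)]
    ring

lemma continuous_spow {q : ℝ} (hq : -1 < q) : Continuous (spow q) := by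
  have : spow q = fun x => (max x 0) ^ (q + 1) - (max (-x) 0) ^ (q + 1) :=
    funext (spow_eq_max hq)
  rw [this]
  have h1 : (0 : ℝ) ≤ q + 1 := by linarith
  exact ((continuous_id.max continuous_const).rpow_const fun _ => Or.inr h1).sub
    ((continuous_neg.max continuous_const).rpow_const fun _ => Or.inr h1)

lemma spow_neg (q x : ℝ) : spow q (-x) = -spow q x := by simp [spow]

lemma spow_nonneg {q x : ℝ} (hx : 0 ≤ x) : 0 ≤ spow q x := by unfold spow; positivity

lemma spow_mul_self_nonneg (q x : ℝ) : 0 ≤ spow q x * x := by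
  rw [spow, mul_assoc]; exact mul_nonneg (by positivity) (mul_self_nonneg x)

lemma spow_of_nonneg {q x : ℝ} (hq : -1 < q) (hx : 0 ≤ x) : spow q x = x ^ (q + 1) := by
  rw [spow_eq_max hq, max_eq_left hx, max_eq_right (by linarith),
    Real.zero_rpow (by linarith), sub_zero]

lemma spow_mono {q x y : ℝ} (hq : -1 < q) (hxy : x ≤ y) : spow q x ≤ spow q y := by
  rw [spow_eq_max hq, spow_eq_max hq]
  have h1 : (max x 0) ^ (q + 1) ≤ (max y 0) ^ (q + 1) :=
    Real.rpow_le_rpow (le_max_right _ _) (max_le_max_right _ hxy) (by linarith)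
  have h2 : (max (-y) 0) ^ (q + 1) ≤ (max (-x) 0) ^ (q + 1) :=
    Real.rpow_le_rpow (le_max_right _ _) (max_le_max_right _ (by linarith)) (by linarith)
  linarith

lemma abs_spow {q : ℝ} (hq : -1 < q) (x : ℝ) : |spow q x| = |x| ^ (q + 1) := by
  rw [spow, abs_mul, abs_of_nonneg (Real.rpow_nonneg (abs_nonneg x) q),
    Real.rpow_add_one' (abs_nonneg x) (by linarith)]

lemma spow_mul {q c : ℝ} (hc : 0 < c) (x : ℝ) : spow q (c * x) = c ^ (q + 1) * spow q x := by
  rw [spow, spow, abs_mul, abs_of_pos hc, Real.mul_rpow hc.le (abs_nonneg x),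
    Real.rpow_add_one hc.ne']
  ring

lemma spow_sq {q : ℝ} (hq : -1 < q) (x : ℝ) : spow q x ^ 2 = |x| ^ (2 * q + 2) := by
  rw [← sq_abs, abs_spow hq, ← Real.rpow_natCast, ← Real.rpow_mul (abs_nonneg x)]
  norm_num; ring_nf

lemma spow_mul_self {q : ℝ} (hq : -1 < q) (x : ℝ) : spow q x * x = |x| ^ (q + 2) := by
  have : q + 2 = q + 1 + 1 := by ring
  rw [this, Real.rpow_add_one' (abs_nonneg x) (by linarith), ← abs_spow hq, ← abs_mul,
    abs_of_nonneg (spow_mul_self_nonneg q x)]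

lemma nl_eq {q : ℝ} (hq : -1 < q) (β x y : ℝ) :
    nl q β x y = spow q x * (spow q x * x + β * (spow q y * y)) := by
  rw [nl, ← spow_sq hq, ← spow_mul_self hq y, mul_assoc _ _ x, ← spow]; ring

lemma nl_neg_left (q β x y : ℝ) : nl q β (-x) y = -nl q β x y := by
  simp only [nl, abs_neg]; ring

lemma nl_neg_right (q β x y : ℝ) : nl q β x (-y) = nl q β x y := by simp only [nl, abs_neg]

lemma nl_mul {q c : ℝ} (hq : -1 < q) (hc : 0 < c) (β x y : ℝ) :
    nl q β (c * x) (c * y) = c ^ (2 * q + 3) * nl q β x y := by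
  have h : c ^ (2 * q + 3) = c ^ (q + 1) * c ^ (q + 1) * c := by
    rw [← Real.rpow_add hc, ← Real.rpow_add_one hc.ne']; ring_nf
  rw [nl_eq hq, nl_eq hq, spow_mul hc, spow_mul hc, h]; ring

lemma continuous_nl {q : ℝ} (hq : -1 < q) :
    Continuous fun z : ℝ × ℝ × ℝ => nl q z.1 z.2.1 z.2.2 := by
  simp only [nl_eq hq]
  have h := continuous_spow hq
  have h1 : Continuous fun z : ℝ × ℝ × ℝ => spow q z.2.1 := h.comp (by fun_prop)
  have h2 : Continuous fun z : ℝ × ℝ × ℝ => spow q z.2.2 := h.comp (by fun_prop)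
  fun_prop

lemma abs_nl_le {q M b : ℝ} (hq : -1 < q) (hM : 0 ≤ M) {β x y : ℝ} (hβ : |β| ≤ b)
    (hx : |x| ≤ M) (hy : |y| ≤ M) : |nl q β x y| ≤ (1 + b) * M ^ (2 * q + 3) := by
  have h1 : |x| ^ (2 * q + 2) * |x| ≤ M ^ (2 * q + 3) := by
    rw [← Real.rpow_add_one' (abs_nonneg x) (by linarith)]
    have : 2 * q + 2 + 1 = 2 * q + 3 := by ring
    rw [this]; exact Real.rpow_le_rpow (abs_nonneg _) hx (by linarith)
  have h2 : |y| ^ (q + 2) * (|x| ^ q * |x|) ≤ M ^ (2 * q + 3) := by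
    rw [← Real.rpow_add_one' (abs_nonneg x) (by linarith)]
    calc |y| ^ (q + 2) * |x| ^ (q + 1) ≤ M ^ (q + 2) * M ^ (q + 1) := by
          apply mul_le_mul (Real.rpow_le_rpow (abs_nonneg _) hy (by linarith))
            (Real.rpow_le_rpow (abs_nonneg _) hx (by linarith)) <;> positivity
      _ = M ^ (2 * q + 3) := by
          rw [← Real.rpow_add' hM (by linarith)]; ring_nf
  have h3 : 0 ≤ M ^ (2 * q + 3) := Real.rpow_nonneg hM _
  calc |nl q β x y| ≤ |x| ^ (2 * q + 2) * |x| + |β| * (|y| ^ (q + 2) * (|x| ^ q * |x|)) := by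
        rw [nl]
        refine (abs_add_le _ _).trans (le_of_eq ?_)
        simp only [abs_mul, abs_of_nonneg (Real.rpow_nonneg (abs_nonneg _) _)]; ring
    _ ≤ M ^ (2 * q + 3) + b * M ^ (2 * q + 3) :=
        add_le_add h1 (mul_le_mul hβ h2 (by positivity) ((abs_nonneg _).trans hβ))
    _ = _ := by ring

lemma rpow_sub_rpow_le {p M a b : ℝ} (hp : 1 ≤ p) (hb : 0 ≤ b) (hab : b ≤ a) (haM : a ≤ M) :
    a ^ p - b ^ p ≤ p * M ^ (p - 1) * (a - b) := by
  have ha : 0 ≤ a := hb.trans hab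
  have hd : ∀ x ∈ interior (Icc b a), deriv (fun x : ℝ => x ^ p) x ≤ p * M ^ (p - 1) := by
    intro x hx
    rw [interior_Icc] at hx
    rw [Real.deriv_rpow_const]
    have : x ^ (p - 1) ≤ M ^ (p - 1) :=
      Real.rpow_le_rpow (hb.trans hx.1.le) (hx.2.le.trans haM) (by linarith)
    nlinarith
  refine (convex_Icc b a).image_sub_le_mul_sub_of_deriv_le ?_ ?_ hd b
    (left_mem_Icc.2 hab) a (right_mem_Icc.2 hab) hab
  · exact continuousOn_id.rpow_const fun _ _ => Or.inr (by linarith)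
  · exact (Real.differentiable_rpow_const hp).differentiableOn

lemma abs_spow_sub_le {r M x y : ℝ} (hr : 0 ≤ r) (hx : |x| ≤ M) (hy : |y| ≤ M) :
    |spow r x - spow r y| ≤ (r + 1) * M ^ r * |x - y| := by
  wlog h : y ≤ x generalizing x y
  · rw [abs_sub_comm, abs_sub_comm x]; exact this hy hx (le_of_not_ge h)
  have hM : 0 ≤ M := (abs_nonneg x).trans hx
  have hr' : -1 < r := by linarith
  rw [abs_of_nonneg (sub_nonneg.2 (spow_mono hr' h)), abs_of_nonneg (sub_nonneg.2 h)]
  have hpos : ∀ a b : ℝ, 0 ≤ b → b ≤ a → a ≤ M →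
      spow r a - spow r b ≤ (r + 1) * M ^ r * (a - b) := by
    intro a b hb hab ha
    rw [spow_of_nonneg hr' hb, spow_of_nonneg hr' (hb.trans hab)]
    simpa using rpow_sub_rpow_le (p := r + 1) (by linarith) hb hab ha
  rcases le_total 0 y with hy0 | hy0
  · exact hpos x y hy0 h ((le_abs_self _).trans hx)
  rcases le_total x 0 with hx0 | hx0
  · have := hpos (-y) (-x) (by linarith) (by linarith) ((neg_le_abs _).trans hy)
    rw [spow_neg, spow_neg] at this
    linarith
  · have h1 := hpos x 0 le_rfl hx0 ((le_abs_self _).trans hx)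
    have h2 := hpos (-y) 0 le_rfl (by linarith) ((neg_le_abs _).trans hy)
    rw [spow_neg] at h2
    simp only [sub_zero] at h1 h2
    have h3 : spow r 0 = 0 := by simp [spow]
    linarith

/-- The linear bound that makes `x - y` solve a linear equation with bounded potential. -/
lemma abs_nl_sub_le {q M b β x y : ℝ} (hq : -1 < q) (hβ : |β| ≤ b) (hx : |x| ≤ M)
    (hy : |y| ≤ M) :
    |nl q β x y - nl q β y x| ≤ (2 * q + 3 + b) * M ^ (2 * q + 2) * |x - y| := by
  have hM : 0 ≤ M := (abs_nonneg x).trans hx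
  have e : nl q β x y - nl q β y x =
      (spow (2 * q + 2) x - spow (2 * q + 2) y) + β * (spow q x * spow q y) * (y - x) := by
    rw [nl_eq hq, nl_eq hq, spow.eq_def (2 * q + 2), spow.eq_def (2 * q + 2), ← spow_sq hq,
      ← spow_sq hq]
    ring
  have h1 := abs_spow_sub_le (r := 2 * q + 2) (by linarith) hx hy
  have h2 : |spow q x * spow q y| ≤ M ^ (2 * q + 2) := by
    rw [abs_mul, abs_spow hq, abs_spow hq]
    calc |x| ^ (q + 1) * |y| ^ (q + 1) ≤ M ^ (q + 1) * M ^ (q + 1) := by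
          apply mul_le_mul (Real.rpow_le_rpow (abs_nonneg _) hx (by linarith))
            (Real.rpow_le_rpow (abs_nonneg _) hy (by linarith)) <;> positivity
      _ = M ^ (2 * q + 2) := by
          rw [← Real.rpow_add' hM (by linarith)]; ring_nf
  have h3 : |β * (spow q x * spow q y) * (y - x)| ≤ b * M ^ (2 * q + 2) * |x - y| := by
    rw [abs_mul, abs_mul, abs_sub_comm y x]
    exact mul_le_mul_of_nonneg_right
      (mul_le_mul hβ h2 (abs_nonneg _) ((abs_nonneg _).trans hβ)) (abs_nonneg _)
  rw [e]
  refine (abs_add_le _ _).trans ((add_le_add h1 h3).trans (le_of_eq ?_))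
  ring

/-- Writing `X`, `Y` for the signed powers, the right side equals `X²(x - y) + (X² - Y²)y - βXY(x -
y)`, and for `β ≤ 0` the last two terms are nonnegative. This makes `x - y` a supersolution. -/
lemma nl_sub_ge {q β x y : ℝ} (hq : -1 < q) (hβ : β ≤ 0) (hy : 0 ≤ y) (hxy : y ≤ x) :
    |x| ^ (2 * q + 2) * (x - y) ≤ nl q β x y - nl q β y x := by
  rw [nl_eq hq, nl_eq hq, ← spow_sq hq]
  have h1 := spow_nonneg (q := q) hy
  have h2 := spow_mono hq hxy
  have h3 : 0 ≤ spow q x * spow q y * (x - y) :=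
    mul_nonneg (mul_nonneg (h1.trans h2) h1) (by linarith)
  have h4 : 0 ≤ (spow q x ^ 2 - spow q y ^ 2) * y := mul_nonneg (by nlinarith) hy
  nlinarith

/-- The sum is `X²x + Y²y + βXY(x + y)`. With `c = min 1 (1 + β)`, so `β ≥ c - 1`, the identity `X²x
+ Y²y - XY(x + y) = (X - Y)(Xx - Yy)` bounds it below by `c(X²x + Y²y)`; the half comes from `x + y
≤ 2x`. -/
lemma nl_add_ge {q β x y : ℝ} (hq : -1 < q) (hy : 0 ≤ y) (hxy : y ≤ x) :
    min 1 (1 + β) / 2 * |x| ^ (2 * q + 2) * (x + y) ≤ nl q β x y + nl q β y x ∨ β ≤ -1 := by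
  by_cases hβ : β ≤ -1
  · exact Or.inr hβ
  left
  rw [nl_eq hq, nl_eq hq, ← spow_sq hq]
  have h1 := spow_nonneg (q := q) hy
  have h2 := spow_mono hq hxy
  set X := spow q x
  set Y := spow q y
  set c := min 1 (1 + β) with hc
  have hc1 : c ≤ 1 := min_le_left _ _
  have hc2 : c ≤ 1 + β := min_le_right _ _
  have hc0 : 0 < c := lt_min one_pos (by linarith)
  have h3 : 0 ≤ (X - Y) * (X * x - Y * y) :=
    mul_nonneg (by linarith) (by nlinarith)
  have h4 : 0 ≤ X * Y * (x + y) := mul_nonneg (mul_nonneg (h1.trans h2) h1) (by linarith)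
  have h5 : 0 ≤ Y ^ 2 * y := mul_nonneg (sq_nonneg _) hy
  have h6 : 0 ≤ X ^ 2 * (x - y) := mul_nonneg (sq_nonneg _) (by linarith)
  have h7 : (c - 1) * (X * Y * (x + y)) ≤ β * (X * Y * (x + y)) :=
    mul_le_mul_of_nonneg_right (by linarith) h4
  have h8 : 0 ≤ (1 - c) * ((X - Y) * (X * x - Y * y)) := mul_nonneg (by linarith) h3
  have h9 : 0 ≤ c * (Y ^ 2 * y) := mul_nonneg hc0.le h5
  have h10 : 0 ≤ c * (X ^ 2 * (x - y)) := mul_nonneg hc0.le h6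
  nlinarith

lemma min_one_add_pos {β : ℝ} (h : -1 < β) : 0 < min 1 (1 + β) / 2 :=
  half_pos (lt_min one_pos (by linarith))

/-- The potential whose gradient is `(nl x y, nl y x)`. -/
noncomputable def potential (q β x y : ℝ) : ℝ :=
  ((spow q x * x) ^ 2 + (spow q y * y) ^ 2 + 2 * β * (spow q x * x) * (spow q y * y)) /
    (2 * (q + 2))

lemma potential_euler {q : ℝ} (hq : -1 < q) (β x y : ℝ) :
    x * nl q β x y + y * nl q β y x = 2 * (q + 2) * potential q β x y := by
  have : q + 2 ≠ 0 := by linarith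
  rw [nl_eq hq, nl_eq hq, potential]
  field_simp
  ring

lemma continuous_potential {q : ℝ} (hq : -1 < q) (β : ℝ) :
    Continuous fun z : ℝ × ℝ => potential q β z.1 z.2 := by
  have h := continuous_spow hq
  have h1 : Continuous fun z : ℝ × ℝ => spow q z.1 := h.comp (by fun_prop)
  have h2 : Continuous fun z : ℝ × ℝ => spow q z.2 := h.comp (by fun_prop)
  unfold potential
  fun_prop

lemma hasDerivAt_spow_mul_self {q : ℝ} (hq : -1 < q) (x : ℝ) :
    HasDerivAt (fun x => spow q x * x) ((q + 2) * spow q x) x := by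
  have : (fun x => spow q x * x) = fun x => |x| ^ (q + 2) := funext fun x => spow_mul_self hq x
  rw [this]
  have h := hasDerivAt_abs_rpow x (p := q + 2) (by linarith)
  convert h using 1
  rw [spow]; ring_nf

lemma hasDerivAt_potential {q : ℝ} (hq : -1 < q) (β : ℝ) {x y : ℝ → ℝ} {x' y' t : ℝ}
    (hx : HasDerivAt x x' t) (hy : HasDerivAt y y' t) :
    HasDerivAt (fun t => potential q β (x t) (y t))
      (nl q β (x t) (y t) * x' + nl q β (y t) (x t) * y') t := by
  have hX : HasDerivAt (fun t => spow q (x t) * x t) _ t :=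
    (hasDerivAt_spow_mul_self hq (x t)).comp t hx
  have hY : HasDerivAt (fun t => spow q (y t) * y t) _ t :=
    (hasDerivAt_spow_mul_self hq (y t)).comp t hy
  have h := (((hX.pow 2).add (hY.pow 2)).add ((hX.const_mul (2 * β)).mul hY)).div_const
    (2 * (q + 2))
  have h2 : q + 2 ≠ 0 := by linarith
  refine HasDerivAt.congr_deriv (f := fun t => potential q β (x t) (y t)) h ?_
  rw [nl_eq hq, nl_eq hq]
  norm_num
  field_simp
  ring

/-! ### Linear uniqueness and derivative interpolation -/

lemma eq_zero_of_linear_right {w w₁ w₂ : ℝ → ℝ} {K c b : ℝ} (hK : 0 ≤ K)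
    (hw : ∀ t ∈ Icc c b, HasDerivAt w (w₁ t) t) (hw₁ : ∀ t ∈ Icc c b, HasDerivAt w₁ (w₂ t) t)
    (h : ∀ t ∈ Icc c b, |w₂ t| ≤ K * (|w t| + |w₁ t|)) (h0 : w c = 0) (h1 : w₁ c = 0) :
    ∀ t ∈ Icc c b, w t = 0 := by
  intro t ht
  have hd : ∀ s ∈ Icc c b, HasDerivAt (fun s => (w s, w₁ s)) (w₁ s, w₂ s) s :=
    fun s hs => (hw s hs).prodMk (hw₁ s hs)
  have := norm_le_gronwallBound_of_norm_deriv_right_le (f := fun s => (w s, w₁ s))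
    (f' := fun s => (w₁ s, w₂ s)) (δ := 0) (K := 2 * K + 1) (ε := 0) (a := c) (b := b)
    (fun s hs => (hd s hs).continuousAt.continuousWithinAt)
    (fun s hs => (hd s ⟨hs.1, hs.2.le⟩).hasDerivWithinAt) (by simp [h0, h1])
    (fun s hs => by
      have h2 := h s ⟨hs.1, hs.2.le⟩
      simp only [Prod.norm_def, Real.norm_eq_abs, add_zero]
      have h3 := le_max_left |w s| |w₁ s|
      have h4 := le_max_right |w s| |w₁ s|
      have h5 := abs_nonneg (w s)
      apply max_le <;> nlinarith [mul_le_mul_of_nonneg_left h3 hK,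
        mul_le_mul_of_nonneg_left h4 hK, mul_nonneg hK (h5.trans h3)]) t ht
  rw [gronwallBound_ε0_δ0] at this
  have h2 := norm_le_zero_iff.1 this
  exact congrArg Prod.fst h2

lemma hasDerivAt_comp_neg {w : ℝ → ℝ} {w' t : ℝ} (h : HasDerivAt w w' (-t)) :
    HasDerivAt (fun s => w (-s)) (-w') t := by
  exact (h.comp t (hasDerivAt_neg t)).congr_deriv (by ring)

lemma eq_zero_of_linear {w w₁ w₂ : ℝ → ℝ} {K a b c : ℝ} (hK : 0 ≤ K) (hc : c ∈ Icc a b)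
    (hw : ∀ t ∈ Icc a b, HasDerivAt w (w₁ t) t) (hw₁ : ∀ t ∈ Icc a b, HasDerivAt w₁ (w₂ t) t)
    (h : ∀ t ∈ Icc a b, |w₂ t| ≤ K * (|w t| + |w₁ t|)) (h0 : w c = 0) (h1 : w₁ c = 0) :
    ∀ t ∈ Icc a b, w t = 0 := by
  intro t ht
  rcases le_total c t with hct | hct
  · have hs : ∀ s ∈ Icc c b, s ∈ Icc a b := fun s hs => ⟨hc.1.trans hs.1, hs.2⟩
    exact eq_zero_of_linear_right hK (fun s h => hw s (hs s h)) (fun s h => hw₁ s (hs s h))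
      (fun s h' => h s (hs s h')) h0 h1 t ⟨hct, ht.2⟩
  · have hs : ∀ s ∈ Icc (-c) (-a), -s ∈ Icc a b :=
      fun s hs => ⟨by linarith [hs.2], by linarith [hs.1, hc.2]⟩
    have := eq_zero_of_linear_right (w := fun s => w (-s)) (w₁ := fun s => -w₁ (-s))
      (w₂ := fun s => w₂ (-s)) (c := -c) (b := -a) hK
      (fun s h => hasDerivAt_comp_neg (hw _ (hs s h)))
      (fun s h => (hasDerivAt_comp_neg (hw₁ _ (hs s h))).neg.congr_deriv (neg_neg _))
      (fun s h' => by simpa using h _ (hs s h')) (by simpa using h0) (by simpa using h1)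
      (-t) ⟨by linarith, by linarith [ht.1]⟩
    simpa using this

/-- Interpolation: bounds for `y` and `y''` control `y'`. -/
lemma abs_deriv_le_of_interval {y y₁ y₂ : ℝ → ℝ} {M L C t : ℝ} (hL : 0 ≤ L) (hC : 0 ≤ C)
    (hy : ∀ s ∈ Icc t (t + 1), HasDerivAt y (y₁ s) s)
    (hy₁ : ∀ s ∈ Icc t (t + 1), HasDerivAt y₁ (y₂ s) s)
    (hM : ∀ s ∈ Icc t (t + 1), |y s| ≤ M)
    (h : ∀ s ∈ Icc t (t + 1), |y₂ s| ≤ L * |y₁ s| + C) :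
    |y₁ t| ≤ gronwallBound (2 * M) L C 1 := by
  -- The mean value theorem supplies one point `ξ` with slope at most `2M`; Gronwall, run backwards
  -- from `ξ` to `t`, carries the bound to `t`.
  obtain ⟨ξ, hξ, hξe⟩ := exists_hasDerivAt_eq_slope y y₁ (show t < t + 1 by linarith)
    (fun s hs => (hy s hs).continuousAt.continuousWithinAt)
    (fun s hs => hy s (Ioo_subset_Icc_self hs))
  have hM0 : 0 ≤ M := (abs_nonneg _).trans (hM t ⟨le_rfl, by linarith⟩)
  have h1 : |y₁ ξ| ≤ 2 * M := by
    rw [hξe]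
    have e : t + 1 - t = 1 := by ring
    rw [e, div_one]
    have := abs_sub (y (t + 1)) (y t)
    linarith [hM t ⟨le_rfl, by linarith⟩, hM (t + 1) ⟨by linarith, le_rfl⟩]
  have hs : ∀ s ∈ Icc (-ξ) (-t), -s ∈ Icc t (t + 1) :=
    fun s hs => ⟨by linarith [hs.2], by linarith [hs.1, hξ.2]⟩
  have := norm_le_gronwallBound_of_norm_deriv_right_le (f := fun s => y₁ (-s))
    (f' := fun s => -y₂ (-s)) (δ := 2 * M) (K := L) (ε := C) (a := -ξ) (b := -t)
    (fun s h => (hasDerivAt_comp_neg (hy₁ _ (hs s h))).continuousAt.continuousWithinAt)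
    (fun s h => (hasDerivAt_comp_neg (hy₁ _ (hs s ⟨h.1, h.2.le⟩))).hasDerivWithinAt)
    (by simpa using h1)
    (fun s h' => by simpa using h _ (hs s ⟨h'.1, h'.2.le⟩)) (-t) ⟨by linarith [hξ.1], le_rfl⟩
  have h2 : |y₁ t| ≤ gronwallBound (2 * M) L C (-t - -ξ) := by simpa using this
  exact h2.trans (gronwallBound_mono (by linarith) hC hL (by linarith [hξ.2]))

/-! ### Monotonicity and positive supersolutions on half-lines -/

lemma antitoneOn_of_hasDerivAt {f f' : ℝ → ℝ} {s : Set ℝ} (hs : Convex ℝ s)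
    (h : ∀ t ∈ s, HasDerivAt f (f' t) t) (h' : ∀ t ∈ s, f' t ≤ 0) : AntitoneOn f s :=
  antitoneOn_of_deriv_nonpos hs (fun t ht => (h t ht).continuousAt.continuousWithinAt)
    (fun t ht => (h t (interior_subset ht)).differentiableAt.differentiableWithinAt)
    (fun t ht => by rw [(h t (interior_subset ht)).deriv]; exact h' t (interior_subset ht))

lemma monotoneOn_of_hasDerivAt {f f' : ℝ → ℝ} {s : Set ℝ} (hs : Convex ℝ s)
    (h : ∀ t ∈ s, HasDerivAt f (f' t) t) (h' : ∀ t ∈ s, 0 ≤ f' t) : MonotoneOn f s :=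
  monotoneOn_of_deriv_nonneg hs (fun t ht => (h t ht).continuousAt.continuousWithinAt)
    (fun t ht => (h t (interior_subset ht)).differentiableAt.differentiableWithinAt)
    (fun t ht => by rw [(h t (interior_subset ht)).deriv]; exact h' t (interior_subset ht))

lemma le_of_deriv_le {f f' : ℝ → ℝ} {s : Set ℝ} {k a b : ℝ} (hs : Convex ℝ s)
    (h : ∀ t ∈ s, HasDerivAt f (f' t) t) (h' : ∀ t ∈ s, f' t ≤ k) (ha : a ∈ s) (hb : b ∈ s)
    (hab : a ≤ b) : f b ≤ f a + k * (b - a) := by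
  have := antitoneOn_of_hasDerivAt (f := fun t => f t - k * t) (f' := fun t => f' t - k * 1) hs
    (fun t ht => (h t ht).sub ((hasDerivAt_id t).const_mul k))
    (fun t ht => by linarith [h' t ht]) ha hb hab
  simp only at this
  linarith

lemma ge_of_le_deriv {f f' : ℝ → ℝ} {s : Set ℝ} {k a b : ℝ} (hs : Convex ℝ s)
    (h : ∀ t ∈ s, HasDerivAt f (f' t) t) (h' : ∀ t ∈ s, k ≤ f' t) (ha : a ∈ s) (hb : b ∈ s)
    (hab : a ≤ b) : f a + k * (b - a) ≤ f b := by
  have := le_of_deriv_le (f := fun t => -f t) (f' := fun t => -f' t) (k := -k) hs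
    (fun t ht => (h t ht).neg) (fun t ht => by linarith [h' t ht]) ha hb hab
  linarith

/-- Decrease at a fixed rate exhausts any starting value; the point `T + f T / k + 1` is already too
far. Most half-line contradictions below reduce to this. -/
lemma not_nonneg_of_deriv_le_neg {f f' : ℝ → ℝ} {T k : ℝ} (hk : 0 < k)
    (h : ∀ t ∈ Ici T, HasDerivAt f (f' t) t) (h' : ∀ t ∈ Ici T, f' t ≤ -k)
    (hf : ∀ t ∈ Ici T, 0 ≤ f t) : False := by
  have h0 := hf T self_mem_Ici
  have ht : T + (f T / k + 1) ∈ Ici T := by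
    have : 0 ≤ f T / k := by positivity
    simp only [mem_Ici]; linarith
  have := le_of_deriv_le (convex_Ici T) h h' self_mem_Ici ht ht
  have h1 := hf _ ht
  have h2 : k * (f T / k) = f T := by field_simp
  nlinarith

/-- A positive concave function on a half-line is nondecreasing. Hence `x` stays above `w T / 2`, so
`w₂` is bounded above by a negative constant and `w₁` could not remain nonnegative. -/
lemma no_positive_supersolution_zero {q c T : ℝ} (hq : -1 < q) (hc : 0 < c)
    {w w₁ w₂ x : ℝ → ℝ} (hw : ∀ t ∈ Ici T, HasDerivAt w (w₁ t) t)
    (hw₁ : ∀ t ∈ Ici T, HasDerivAt w₁ (w₂ t) t) (hpos : ∀ t ∈ Ici T, 0 < w t)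
    (hx : ∀ t ∈ Ici T, w t ≤ 2 * x t)
    (h : ∀ t ∈ Ici T, w₂ t ≤ -(c * |x t| ^ (2 * q + 2) * w t)) : False := by
  have hle : ∀ t ∈ Ici T, w₂ t ≤ 0 := fun t ht => (h t ht).trans (by
    have := hpos t ht
    have : 0 ≤ c * |x t| ^ (2 * q + 2) * w t := by positivity
    linarith)
  have hanti := antitoneOn_of_hasDerivAt (convex_Ici T) hw₁ hle
  have h1 : ∀ t ∈ Ici T, 0 ≤ w₁ t := by
    intro t ht
    by_contra! hlt
    have hsub : ∀ s ∈ Ici t, s ∈ Ici T := fun s hs => le_trans (mem_Ici.1 ht) hs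
    exact not_nonneg_of_deriv_le_neg (k := -w₁ t) (by linarith)
      (fun s hs => hw s (hsub s hs))
      (fun s hs => by simpa using hanti ht (hsub s hs) hs) (fun s hs => (hpos s (hsub s hs)).le)
  have hmono := monotoneOn_of_hasDerivAt (convex_Ici T) hw h1
  have h0 := hpos T self_mem_Ici
  refine not_nonneg_of_deriv_le_neg (k := c * (w T / 2) ^ (2 * q + 2) * w T) (by positivity)
    hw₁ (fun t ht => (h t ht).trans ?_) h1
  have h2 : w T ≤ w t := hmono self_mem_Ici ht ht
  have h3 : w T / 2 ≤ |x t| := le_trans (by linarith [hx t ht]) (le_abs_self _)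
  have h4 : (w T / 2) ^ (2 * q + 2) ≤ |x t| ^ (2 * q + 2) :=
    Real.rpow_le_rpow (by positivity) h3 (by linarith)
  have h5 : c * (w T / 2) ^ (2 * q + 2) * w T ≤ c * |x t| ^ (2 * q + 2) * w t :=
    mul_le_mul (mul_le_mul_of_nonneg_left h4 hc.le) h2 h0.le (by positivity)
  linarith

/-- Planar version: `t w₁` is nonincreasing, and a negative value of it would push `w` down
logarithmically to a negative value. So `w` is nondecreasing, and then `t w₁` falls at a fixed rate.
-/
lemma no_positive_supersolution_one {q c T : ℝ} (hq : -1 < q) (hc : 0 < c) (hT : 0 < T)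
    {w w₁ w₂ x : ℝ → ℝ} (hw : ∀ t ∈ Ici T, HasDerivAt w (w₁ t) t)
    (hw₁ : ∀ t ∈ Ici T, HasDerivAt w₁ (w₂ t) t) (hpos : ∀ t ∈ Ici T, 0 < w t)
    (hx : ∀ t ∈ Ici T, w t ≤ 2 * x t)
    (h : ∀ t ∈ Ici T, w₂ t + 1 / t * w₁ t ≤ -(c * |x t| ^ (2 * q + 2) * w t)) : False := by
  have hg : ∀ t ∈ Ici T, HasDerivAt (fun t => t * w₁ t) (t * (w₂ t + 1 / t * w₁ t)) t := by
    intro t ht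
    have ht0 : t ≠ 0 := (hT.trans_le ht).ne'
    refine ((hasDerivAt_id t).mul (hw₁ t ht)).congr_deriv ?_
    simp only [id]; field_simp; ring
  have hle : ∀ t ∈ Ici T, t * (w₂ t + 1 / t * w₁ t) ≤ 0 := fun t ht =>
    mul_nonpos_of_nonneg_of_nonpos (hT.le.trans ht) ((h t ht).trans (by
      have := hpos t ht
      have : 0 ≤ c * |x t| ^ (2 * q + 2) * w t := by positivity
      linarith))
  have hanti := antitoneOn_of_hasDerivAt (convex_Ici T) hg hle
  have h1 : ∀ t ∈ Ici T, 0 ≤ t * w₁ t := by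
    intro t ht
    by_contra! hlt
    have hsub : ∀ s ∈ Ici t, s ∈ Ici T := fun s hs => le_trans (mem_Ici.1 ht) hs
    set k := -(t * w₁ t) with hk
    have hk0 : 0 < k := by linarith
    have ha := antitoneOn_of_hasDerivAt (f := fun s => w s + k * Real.log s)
      (f' := fun s => w₁ s + k * s⁻¹) (convex_Ici t)
      (fun s hs => (hw s (hsub s hs)).add
        ((Real.hasDerivAt_log (hT.trans_le (hsub s hs)).ne').const_mul k))
      (fun s hs => by
        have hs0 : 0 < s := hT.trans_le (hsub s hs)
        have h2 : s * w₁ s ≤ t * w₁ t := hanti ht (hsub s hs) hs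
        have h3 : w₁ s + k * s⁻¹ = (s * w₁ s + k) / s := by field_simp
        rw [h3]
        exact div_nonpos_of_nonpos_of_nonneg (by linarith) hs0.le)
    have ht0 : 0 < t := hT.trans_le ht
    have hwt := hpos t ht
    have hs : t ≤ t * Real.exp (w t / k) :=
      le_mul_of_one_le_right ht0.le (Real.one_le_exp (by positivity))
    have h4 := ha self_mem_Ici (mem_Ici.2 hs) hs
    simp only at h4
    rw [Real.log_mul ht0.ne' (Real.exp_pos _).ne', Real.log_exp, mul_add] at h4
    have h5 : k * (w t / k) = w t := by field_simp
    have := hpos _ (hsub _ (mem_Ici.2 hs))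
    linarith
  have h1' : ∀ t ∈ Ici T, 0 ≤ w₁ t := fun t ht =>
    nonneg_of_mul_nonneg_right (h1 t ht) (hT.trans_le ht)
  have hmono := monotoneOn_of_hasDerivAt (convex_Ici T) hw h1'
  have h0 := hpos T self_mem_Ici
  refine not_nonneg_of_deriv_le_neg (k := T * (c * (w T / 2) ^ (2 * q + 2) * w T))
    (by positivity) hg (fun t ht => ?_) h1
  have h2 : w T ≤ w t := hmono self_mem_Ici ht ht
  have h3 : w T / 2 ≤ |x t| := le_trans (by linarith [hx t ht]) (le_abs_self _)
  have h4 : (w T / 2) ^ (2 * q + 2) ≤ |x t| ^ (2 * q + 2) :=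
    Real.rpow_le_rpow (by positivity) h3 (by linarith)
  have h5 : c * (w T / 2) ^ (2 * q + 2) * w T ≤ c * |x t| ^ (2 * q + 2) * w t :=
    mul_le_mul (mul_le_mul_of_nonneg_left h4 hc.le) h2 h0.le (by positivity)
  have h6 : T * (c * (w T / 2) ^ (2 * q + 2) * w T) ≤ t * (c * |x t| ^ (2 * q + 2) * w t) :=
    mul_le_mul ht h5 (by positivity) (hT.le.trans ht)
  have h7 := mul_le_mul_of_nonneg_left (h t ht) (hT.le.trans ht)
  linarith

/-- A positive concave function on a half-line. -/
structure ConcavePos (T : ℝ) (W W₁ W₂ : ℝ → ℝ) : Prop where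
  deriv : ∀ t ∈ Ici T, HasDerivAt W (W₁ t) t
  deriv₁ : ∀ t ∈ Ici T, HasDerivAt W₁ (W₂ t) t
  pos : ∀ t ∈ Ici T, 0 < W t
  nonpos : ∀ t ∈ Ici T, W₂ t ≤ 0

namespace ConcavePos
variable {T : ℝ} {W W₁ W₂ : ℝ → ℝ}

lemma antitone (h : ConcavePos T W W₁ W₂) : AntitoneOn W₁ (Ici T) :=
  antitoneOn_of_hasDerivAt (convex_Ici T) h.deriv₁ h.nonpos

lemma nonneg (h : ConcavePos T W W₁ W₂) : ∀ t ∈ Ici T, 0 ≤ W₁ t := by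
  intro t ht
  by_contra! hlt
  have hsub : ∀ s ∈ Ici t, s ∈ Ici T := fun s hs => le_trans (mem_Ici.1 ht) hs
  exact not_nonneg_of_deriv_le_neg (k := -W₁ t) (by linarith)
    (fun s hs => h.deriv s (hsub s hs))
    (fun s hs => by simpa using h.antitone ht (hsub s hs) hs)
    (fun s hs => (h.pos s (hsub s hs)).le)

lemma monotone (h : ConcavePos T W W₁ W₂) : MonotoneOn W (Ici T) :=
  monotoneOn_of_hasDerivAt (convex_Ici T) h.deriv h.nonneg

lemma le_tangent (h : ConcavePos T W W₁ W₂) {s t : ℝ} (hs : T ≤ s) (hst : s ≤ t) :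
    W t ≤ W s + W₁ s * (t - s) :=
  le_of_deriv_le (convex_Ici s) (fun r hr => h.deriv r (hs.trans hr))
    (fun _ hr => h.antitone hs (hs.trans hr) hr) self_mem_Ici hst hst

lemma deriv_mul_le (h : ConcavePos T W W₁ W₂) {s t : ℝ} (hs : T ≤ s) (hst : s ≤ t) :
    W s + W₁ t * (t - s) ≤ W t :=
  ge_of_le_deriv (convex_Icc s t) (fun r hr => h.deriv r (hs.trans hr.1))
    (fun _ hr => h.antitone (hs.trans hr.1) (hs.trans hst) hr.2) (left_mem_Icc.2 hst)
    (right_mem_Icc.2 hst) hst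

/-- A positive concave function cannot satisfy `W'' ≤ -κ W` on long intervals. -/
lemma mul_le_one (h : ConcavePos T W W₁ W₂) {s r κ : ℝ} (hs : T ≤ s) (hr : 0 ≤ r) (hκ : 0 ≤ κ)
    (hW : ∀ t ∈ Icc s (s + r), W₂ t ≤ -(κ * W t)) : κ * r * (s - T) ≤ 1 := by
  -- The slope loses at least `κ W(s) r` across the interval and ends nonnegative, so `W₁ s ≥ κ r
  -- W(s)`; concavity from `T` gives `W₁ s (s - T) ≤ W s`.
  have h1 : W₁ (s + r) ≤ W₁ s + -(κ * W s) * (s + r - s) :=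
    le_of_deriv_le (convex_Icc s (s + r)) (fun t ht => h.deriv₁ t (hs.trans ht.1))
      (fun t ht => (hW t ht).trans (by
        have := mul_le_mul_of_nonneg_left (h.monotone (show s ∈ Ici T from hs)
          (hs.trans ht.1) ht.1) hκ
        linarith))
      (left_mem_Icc.2 (by linarith)) (right_mem_Icc.2 (by linarith)) (by linarith)
  have h2 := h.nonneg (s + r) (hs.trans (by linarith))
  have h3 : κ * W s * r ≤ W₁ s := by linarith
  have h4 := h.deriv_mul_le le_rfl hs
  have h5 := h.pos T self_mem_Ici
  have h6 := h.pos s hs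
  have h7 := mul_le_mul_of_nonneg_right h3 (sub_nonneg.2 hs)
  have h8 : κ * r * (s - T) * W s ≤ 1 * W s := by nlinarith
  exact le_of_mul_le_mul_right h8 h6

/-- Integrate the bound on `W₂` from `s` to infinity, using that `W₁` stays nonnegative. -/
lemma div_le_deriv (h : ConcavePos T W W₁ W₂) {s κ : ℝ} (hT : 0 < T) (hs : T ≤ s)
    (hW : ∀ t ∈ Ici s, W₂ t ≤ -(κ / t ^ 2)) : κ / s ≤ W₁ s := by
  have hs0 : 0 < s := hT.trans_le hs
  have ha := antitoneOn_of_hasDerivAt (f := fun t => W₁ t - κ * t⁻¹)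
    (f' := fun t => W₂ t - κ * (-(t ^ 2)⁻¹)) (convex_Ici s)
    (fun t ht => (h.deriv₁ t (hs.trans ht)).sub
      ((hasDerivAt_inv (hs0.trans_le ht).ne').const_mul κ))
    (fun t ht => by have := hW t ht; rw [div_eq_mul_inv] at this; linarith)
  have h1 : ∀ᶠ t in atTop, -(κ * t⁻¹) ≤ W₁ s - κ * s⁻¹ := by
    filter_upwards [eventually_ge_atTop s] with t ht
    have := ha self_mem_Ici ht ht
    have h2 := h.nonneg t (hs.trans ht)
    simp only at this
    linarith
  have h2 : Tendsto (fun t : ℝ => -(κ * t⁻¹)) atTop (𝓝 (-(κ * 0))) :=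
    (tendsto_inv_atTop_zero.const_mul κ).neg
  have := le_of_tendsto h2 h1
  rw [div_eq_mul_inv]
  linarith

end ConcavePos

/-- In dimension three, `t w` is concave whenever `w` is superharmonic. -/
lemma concavePos_of_superharmonic {T : ℝ} (hT : 0 < T) {w w₁ w₂ : ℝ → ℝ}
    (hw : ∀ t ∈ Ici T, HasDerivAt w (w₁ t) t)
    (hw₁ : ∀ t ∈ Ici T, HasDerivAt w₁ (w₂ t) t) (hpos : ∀ t ∈ Ici T, 0 < w t)
    (h : ∀ t ∈ Ici T, w₂ t + 2 / t * w₁ t ≤ 0) :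
    ConcavePos T (fun t => t * w t) (fun t => w t + t * w₁ t)
      (fun t => t * (w₂ t + 2 / t * w₁ t)) where
  deriv t ht := ((hasDerivAt_id t).mul (hw t ht)).congr_deriv (by simp)
  deriv₁ t ht := by
    have ht0 : t ≠ 0 := (hT.trans_le ht).ne'
    refine ((hw t ht).add ((hasDerivAt_id t).mul (hw₁ t ht))).congr_deriv ?_
    simp only [id]; field_simp; ring
  pos t ht := mul_pos (hT.trans_le ht) (hpos t ht)
  nonpos t ht := mul_nonpos_of_nonneg_of_nonpos (hT.le.trans ht) (h t ht)

/-- For `W = t w`, which is concave, the nonlinear term is at least a multiple of `W / t²`, a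
borderline Hardy potential. Its coefficient grows with `W`; a first pass shows that `W` grows at
least logarithmically, after which the coefficient is too large for a positive concave function. -/
lemma no_positive_supersolution_two {q c T : ℝ} (hq : -1 < q) (hq0 : q ≤ 0) (hc : 0 < c)
    (hT : 1 ≤ T)
    {w w₁ w₂ x : ℝ → ℝ} (hw : ∀ t ∈ Ici T, HasDerivAt w (w₁ t) t)
    (hw₁ : ∀ t ∈ Ici T, HasDerivAt w₁ (w₂ t) t) (hpos : ∀ t ∈ Ici T, 0 < w t)
    (hx : ∀ t ∈ Ici T, w t ≤ 2 * x t)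
    (h : ∀ t ∈ Ici T, w₂ t + 2 / t * w₁ t ≤ -(c * |x t| ^ (2 * q + 2) * w t)) : False := by
  have hT0 : 0 < T := by linarith
  have hC := concavePos_of_superharmonic hT0 hw hw₁ hpos (fun t ht => (h t ht).trans (by
      have := hpos t ht
      have : 0 ≤ c * |x t| ^ (2 * q + 2) * w t := by positivity
      linarith))
  set W := fun t => t * w t with hW
  have key : ∀ s ∈ Ici T, ∀ t ∈ Ici s, t * (w₂ t + 2 / t * w₁ t) ≤
      -(c * (W s / 2) ^ (2 * q + 2) * W s / t ^ 2) := by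
    intro s hs t ht
    have htT : t ∈ Ici T := le_trans (mem_Ici.1 hs) ht
    have ht1 : 1 ≤ t := hT.trans htT
    have ht0 : 0 < t := by linarith
    have hWs : 0 < W s := hC.pos s hs
    have h1 : W s ≤ W t := hC.monotone hs htT ht
    have h2 : W s / 2 / t ≤ |x t| := by
      refine le_trans ?_ (le_abs_self _)
      rw [div_le_iff₀ ht0]
      have := mul_le_mul_of_nonneg_left (hx t htT) ht0.le
      simp only [hW] at h1 ⊢
      linarith
    have h3 : (W s / 2) ^ (2 * q + 2) / t ^ 2 ≤ |x t| ^ (2 * q + 2) := by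
      refine le_trans ?_ (Real.rpow_le_rpow (by positivity) h2 (by linarith))
      rw [Real.div_rpow (by positivity) ht0.le]
      apply div_le_div_of_nonneg_left (by positivity) (by positivity)
      rw [← Real.rpow_natCast]
      -- This is where `q ≤ 0` enters: `t ^ (2q+2) ≤ t ^ 2` for `t ≥ 1`.
      exact Real.rpow_le_rpow_of_exponent_le ht1 (by push_cast; linarith)
    have h4 : c * ((W s / 2) ^ (2 * q + 2) / t ^ 2) * W s ≤ c * |x t| ^ (2 * q + 2) * W t :=
      mul_le_mul (mul_le_mul_of_nonneg_left h3 hc.le) h1 hWs.le (by positivity)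
    have h5 := mul_le_mul_of_nonneg_left (h t htT) ht0.le
    have h6 : t * -(c * |x t| ^ (2 * q + 2) * w t) = -(c * |x t| ^ (2 * q + 2) * W t) := by
      simp only [hW]; ring
    have h7 : c * (W s / 2) ^ (2 * q + 2) * W s / t ^ 2 =
      c * ((W s / 2) ^ (2 * q + 2) / t ^ 2) * W s := by ring
    rw [h7]; linarith
  have key1 : ∀ s ∈ Ici T, c * (W s / 2) ^ (2 * q + 2) * W s / s ≤ w s + s * w₁ s :=
    fun s hs => hC.div_le_deriv hT0 hs (key s hs)
  have hWT : 0 < W T := hC.pos T self_mem_Ici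
  set κ := c * (W T / 2) ^ (2 * q + 2) * W T with hκ
  have hκ0 : 0 < κ := by positivity
  have hlog : ∀ t ∈ Ici T, κ * Real.log t ≤ W t + κ * Real.log T := by
    intro t ht
    have := monotoneOn_of_hasDerivAt (f := fun t => W t - κ * Real.log t)
      (f' := fun t => w t + t * w₁ t - κ * t⁻¹) (convex_Ici T)
      (fun s hs => (hC.deriv s hs).sub
        ((Real.hasDerivAt_log (hT0.trans_le hs).ne').const_mul κ))
      (fun s hs => by
        have h1 := hC.div_le_deriv hT0 hs
          (fun r hr => key T self_mem_Ici r (le_trans (mem_Ici.1 hs) hr))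
        rw [div_eq_mul_inv] at h1
        linarith) self_mem_Ici ht ht
    simp only at this
    linarith
  have hlim : Tendsto (fun t => (W t / 2) ^ (2 * q + 2)) atTop atTop := by
    refine (tendsto_rpow_atTop (by linarith)).comp ?_
    have h1 : Tendsto (fun t => (κ * Real.log t - κ * Real.log T) / 2) atTop atTop :=
      (tendsto_atTop_add_const_right _ _ (Real.tendsto_log_atTop.const_mul_atTop
        hκ0)).atTop_div_const two_pos
    refine tendsto_atTop_mono' _ ?_ h1
    filter_upwards [eventually_ge_atTop T] with t ht
    linarith [hlog t ht]
  -- With coefficient at least 2, `key1` at `2s` makes the slope there at least `W (2s) / s`.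
  -- Concavity on `[s, 2s]` would then give `W s + W (2s) ≤ W (2s)`.
  obtain ⟨s, hs, hsT⟩ := ((hlim.eventually_ge_atTop (2 / c)).and (eventually_ge_atTop T)).exists
  have hs0 : 0 < s := hT0.trans_le hsT
  have h2s : 2 * s ∈ Ici T := by simp only [mem_Ici]; linarith
  have h1 := key1 (2 * s) h2s
  have hW2 : 0 < W (2 * s) := hC.pos _ h2s
  have hWs : 0 < W s := hC.pos s hsT
  have h3 : W s ≤ W (2 * s) := hC.monotone hsT h2s (by linarith)
  have h4 : 2 / c ≤ (W (2 * s) / 2) ^ (2 * q + 2) :=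
    hs.trans (Real.rpow_le_rpow (by positivity) (by linarith) (by linarith))
  rw [div_le_iff₀ hc] at h4
  have h5 : W s + (w (2 * s) + 2 * s * w₁ (2 * s)) * (2 * s - s) ≤ W (2 * s) :=
    hC.deriv_mul_le hsT (by linarith)
  rw [div_le_iff₀ (by linarith)] at h1
  nlinarith [mul_le_mul_of_nonneg_right h4 hW2.le]

/-! ### The radial system, and decay of ordered solutions in dimension three -/

/-- `(x, y)` solves `x'' + e x' = lam x + γ y - nl x y`, `y'' + e y' = lam y + γ x - nl y x`
on `S`, with first derivatives `x₁`, `y₁`. -/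
structure Sol (q : ℝ) (e : ℝ → ℝ) (lam γ β : ℝ) (S : Set ℝ) (x y x₁ y₁ : ℝ → ℝ) : Prop where
  fst : ∀ t ∈ S, HasDerivAt x (x₁ t) t
  snd : ∀ t ∈ S, HasDerivAt y (y₁ t) t
  fst₁ : ∀ t ∈ S,
    HasDerivAt x₁ (-(e t * x₁ t) + lam * x t + γ * y t - nl q β (x t) (y t)) t
  snd₁ : ∀ t ∈ S,
    HasDerivAt y₁ (-(e t * y₁ t) + lam * y t + γ * x t - nl q β (y t) (x t)) t

namespace Sol
variable {q lam γ β : ℝ} {e : ℝ → ℝ} {S : Set ℝ} {x y x₁ y₁ : ℝ → ℝ}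

lemma mono (h : Sol q e lam γ β S x y x₁ y₁) {S' : Set ℝ} (hS : S' ⊆ S) :
    Sol q e lam γ β S' x y x₁ y₁ :=
  ⟨fun t ht => h.fst t (hS ht), fun t ht => h.snd t (hS ht), fun t ht => h.fst₁ t (hS ht),
    fun t ht => h.snd₁ t (hS ht)⟩

lemma swap (h : Sol q e lam γ β S x y x₁ y₁) : Sol q e lam γ β S y x y₁ x₁ :=
  ⟨h.snd, h.fst, h.snd₁, h.fst₁⟩

lemma neg_right (h : Sol q e lam γ β S x y x₁ y₁) :
    Sol q e lam (-γ) β S x (fun t => -y t) x₁ (fun t => -y₁ t) where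
  fst := h.fst
  snd t ht := (h.snd t ht).neg
  fst₁ t ht := (h.fst₁ t ht).congr_deriv (by rw [nl_neg_right]; ring)
  snd₁ t ht := (h.snd₁ t ht).neg.congr_deriv (by rw [nl_neg_left]; ring)

lemma neg_left (h : Sol q e lam γ β S x y x₁ y₁) :
    Sol q e lam (-γ) β S (fun t => -x t) y (fun t => -x₁ t) y₁ := h.swap.neg_right.swap

lemma sub₀ (h : Sol q e lam γ β S x y x₁ y₁) :
    ∀ t ∈ S, HasDerivAt (fun t => x t - y t) (x₁ t - y₁ t) t :=
  fun t ht => (h.fst t ht).sub (h.snd t ht)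

lemma add₀ (h : Sol q e lam γ β S x y x₁ y₁) :
    ∀ t ∈ S, HasDerivAt (fun t => x t + y t) (x₁ t + y₁ t) t :=
  fun t ht => (h.fst t ht).add (h.snd t ht)

lemma sub₁ (h : Sol q e lam γ β S x y x₁ y₁) : ∀ t ∈ S,
    HasDerivAt (fun t => x₁ t - y₁ t) (-(e t * (x₁ t - y₁ t)) + (lam - γ) * (x t - y t) -
      (nl q β (x t) (y t) - nl q β (y t) (x t))) t :=
  fun t ht => ((h.fst₁ t ht).sub (h.snd₁ t ht)).congr_deriv (by ring)

lemma add₁ (h : Sol q e lam γ β S x y x₁ y₁) : ∀ t ∈ S,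
    HasDerivAt (fun t => x₁ t + y₁ t) (-(e t * (x₁ t + y₁ t)) + (lam + γ) * (x t + y t) -
      (nl q β (x t) (y t) + nl q β (y t) (x t))) t :=
  fun t ht => ((h.fst₁ t ht).add (h.snd₁ t ht)).congr_deriv (by ring)

/-- Unique continuation for the difference of the two components. -/
lemma eq_of_eq_at (hq : -1 < q) (h : Sol q e lam γ β S x y x₁ y₁) [hS : S.OrdConnected]
    (he : ContinuousOn e S) {c : ℝ} (hc : c ∈ S) (h0 : x c = y c) (h1 : x₁ c = y₁ c) :
    ∀ t ∈ S, x t = y t := by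
  intro t ht
  have hsub : uIcc c t ⊆ S := hS.uIcc_subset hc ht
  have hcx : ContinuousOn x (uIcc c t) :=
    fun s hs => (h.fst s (hsub hs)).continuousAt.continuousWithinAt
  have hcy : ContinuousOn y (uIcc c t) :=
    fun s hs => (h.snd s (hsub hs)).continuousAt.continuousWithinAt
  obtain ⟨M₁, hM₁⟩ := isCompact_uIcc.exists_bound_of_continuousOn hcx
  obtain ⟨M₂, hM₂⟩ := isCompact_uIcc.exists_bound_of_continuousOn hcy
  obtain ⟨E, hE⟩ := isCompact_uIcc.exists_bound_of_continuousOn (he.mono hsub)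
  set M := max M₁ M₂
  have hM0 : 0 ≤ M := (norm_nonneg _).trans ((hM₁ c left_mem_uIcc).trans (le_max_left _ _))
  have hE0 : 0 ≤ E := (norm_nonneg _).trans (hE c left_mem_uIcc)
  set N := (2 * q + 3 + |β|) * M ^ (2 * q + 2)
  have hN : 0 ≤ N := mul_nonneg (by linarith [abs_nonneg β]) (by positivity)
  have := eq_zero_of_linear (w := fun t => x t - y t) (K := E + |lam - γ| + N) (c := c)
    (by positivity) left_mem_uIcc
    (fun s hs => (h.fst s (hsub hs)).sub (h.snd s (hsub hs)))
    (fun s hs => h.sub₁ s (hsub hs))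
    (fun s hs => by
      have b1 : |e s| ≤ E := hE s hs
      have b2 := abs_nl_sub_le (β := β) hq le_rfl ((hM₁ s hs).trans (le_max_left _ M₂))
        ((hM₂ s hs).trans (le_max_right M₁ _))
      have b3 : |-(e s * (x₁ s - y₁ s)) + (lam - γ) * (x s - y s) -
          (nl q β (x s) (y s) - nl q β (y s) (x s))| ≤
          |e s| * |x₁ s - y₁ s| + |lam - γ| * |x s - y s| +
          |nl q β (x s) (y s) - nl q β (y s) (x s)| := by
        refine (abs_sub _ _).trans (add_le_add_left ((abs_add_le _ _).trans ?_) _)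
        rw [abs_neg, abs_mul, abs_mul]
      have b4 := mul_le_mul_of_nonneg_right b1 (abs_nonneg (x₁ s - y₁ s))
      have b5 : 0 ≤ (|lam - γ| + N) * |x₁ s - y₁ s| := by positivity
      have b6 : 0 ≤ E * |x s - y s| := by positivity
      refine b3.trans ?_
      simp only [mul_add, add_mul] at *
      linarith) (by simp [h0]) (by simp [h1]) t right_mem_uIcc
  simpa [sub_eq_zero] using this

lemma eq_neg_of_eq_neg_at (hq : -1 < q) (h : Sol q e lam γ β S x y x₁ y₁) [S.OrdConnected]
    (he : ContinuousOn e S) {c : ℝ} (hc : c ∈ S) (h0 : x c = -y c) (h1 : x₁ c = -y₁ c) :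
    ∀ t ∈ S, x t = -y t := h.neg_right.eq_of_eq_at hq he hc h0 h1

end Sol

/-- Since `t (x + y)` is positive and concave, it is nondecreasing, so on `[t, 2t]` the larger
component stays above `x t / 4`. The potential is then at least a multiple of `x t ^ (2q+2)` on an
interval of length `t`, and `ConcavePos.mul_le_one` bounds the product. -/
lemma decay_of_add {q β T : ℝ} (hq : -1 < q) (hβ : -1 < β) (hT : 0 < T)
    {x y x₁ y₁ : ℝ → ℝ} (h : Sol q (fun t => 2 / t) 0 0 β (Ici T) x y x₁ y₁)
    (hy : ∀ t ∈ Ici T, 0 ≤ y t) (hxy : ∀ t ∈ Ici T, y t ≤ x t)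
    (hpos : ∀ t ∈ Ici T, 0 < x t + y t) :
    ∃ C, ∀ t ∈ Ici (4 * T), t ^ 2 * |x t| ^ (2 * q + 2) ≤ C := by
  set c := min 1 (1 + β) / 2 with hc
  have hc0 : 0 < c := min_one_add_pos hβ
  have key : ∀ t ∈ Ici T, c * |x t| ^ (2 * q + 2) * (x t + y t) ≤
      nl q β (x t) (y t) + nl q β (y t) (x t) := fun t ht =>
    (nl_add_ge hq (hy t ht) (hxy t ht)).resolve_right (by linarith)
  have hle : ∀ t ∈ Ici T, 0 ≤ c * |x t| ^ (2 * q + 2) * (x t + y t) := fun t ht => by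
    have := hpos t ht
    positivity
  have hC := concavePos_of_superharmonic hT h.add₀ h.add₁ hpos (fun t ht => by linarith [key t ht, hle t ht])
  refine ⟨2 * (4 ^ (2 * q + 2) / c), fun t ht => ?_⟩
  have ht' : 4 * T ≤ t := ht
  have ht0 : 0 < t := by linarith
  have hx0 : 0 ≤ x t := (hy t (by simp only [mem_Ici]; linarith)).trans
    (hxy t (by simp only [mem_Ici]; linarith))
  have hy0 := hy t (by simp only [mem_Ici]; linarith)
  have hsub : ∀ s ∈ Icc t (t + t), s ∈ Ici T := fun s hs => by
    simp only [mem_Ici]; linarith [hs.1]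
  have h1 := hC.mul_le_one (s := t) (r := t) (κ := c * (x t / 4) ^ (2 * q + 2)) (by linarith)
    ht0.le (by positivity) (fun s hs => by
      have hsT := hsub s hs
      have hs0 : 0 < s := hT.trans_le hsT
      have h2 : t * (x t + y t) ≤ s * (x s + y s) :=
        hC.monotone (by simp only [mem_Ici]; linarith) hsT hs.1
      have h3 : x t / 4 ≤ |x s| := by
        refine le_trans ?_ (le_abs_self _)
        have h4 := hxy s hsT
        have h5 : s * (x s + y s) ≤ (2 * t) * (2 * x s) :=
          mul_le_mul (by linarith [hs.2]) (by linarith) (hpos s hsT).le (by linarith)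
        have h6 : t * (x t / 4) ≤ t * x s := by nlinarith
        exact le_of_mul_le_mul_left h6 ht0
      have h4 : (x t / 4) ^ (2 * q + 2) ≤ |x s| ^ (2 * q + 2) :=
        Real.rpow_le_rpow (by positivity) h3 (by linarith)
      have h5 := key s hsT
      have h6 : c * (x t / 4) ^ (2 * q + 2) * (x s + y s) ≤
          c * |x s| ^ (2 * q + 2) * (x s + y s) :=
        mul_le_mul_of_nonneg_right (mul_le_mul_of_nonneg_left h4 hc0.le) (hpos s hsT).le
      have h7 := mul_le_mul_of_nonneg_left (h6.trans h5) hs0.le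
      linarith)
  rw [Real.div_rpow hx0 (by norm_num)] at h1
  rw [abs_of_nonneg hx0]
  set A := x t ^ (2 * q + 2)
  have hA : 0 ≤ A := Real.rpow_nonneg hx0 _
  set Q : ℝ := 4 ^ (2 * q + 2)
  have hQ : 0 < Q := by positivity
  have h8 : c * (A / Q) * t * (t - T) = (A * (t * (t - T))) / (Q / c) := by
    field_simp
  rw [h8, div_le_one (by positivity)] at h1
  have h9 : t ^ 2 * A ≤ 2 * (A * (t * (t - T))) := by
    have : t ^ 2 ≤ 2 * (t * (t - T)) := by nlinarith
    nlinarith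
  linarith

/-- Here only `D = t (x - y)` is known to be concave, and it need not control `x` from below. The
quotient `S / D` with `S = t (x + y)` does: its derivative has the sign of a nondecreasing
Wronskian, so from any `t` it is at least its value at `t` on one whole side. On that side `x` stays
comparable to `x t`. -/
lemma decay_of_sub {q β T : ℝ} (hq : -1 < q) (hβ : β ≤ 0) (hT : 0 < T)
    {x y x₁ y₁ : ℝ → ℝ} (h : Sol q (fun t => 2 / t) 0 0 β (Ici T) x y x₁ y₁)
    (hy : ∀ t ∈ Ici T, 0 ≤ y t) (hpos : ∀ t ∈ Ici T, 0 < x t - y t) :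
    ∃ C, ∀ t ∈ Ici (4 * T), t ^ 2 * |x t| ^ (2 * q + 2) ≤ C := by
  have hxy : ∀ t ∈ Ici T, y t ≤ x t := fun t ht => by linarith [hpos t ht]
  have key : ∀ t ∈ Ici T, |x t| ^ (2 * q + 2) * (x t - y t) ≤
      nl q β (x t) (y t) - nl q β (y t) (x t) := fun t ht =>
    nl_sub_ge hq hβ (hy t ht) (hxy t ht)
  have hle : ∀ t ∈ Ici T, 0 ≤ |x t| ^ (2 * q + 2) * (x t - y t) := fun t ht => by
    have := hpos t ht
    positivity
  have hC := concavePos_of_superharmonic hT h.sub₀ h.sub₁ hpos (fun t ht => by linarith [key t ht, hle t ht])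
  -- the Wronskian of `t (x + y)` and `t (x - y)` is monotone
  set D := fun t => t * (x t - y t) with hD
  set D₁ := fun t => x t - y t + t * (x₁ t - y₁ t) with hD₁
  set S := fun t => t * (x t + y t) with hS
  set S₁ := fun t => x t + y t + t * (x₁ t + y₁ t) with hS₁
  have hSd : ∀ t ∈ Ici T, HasDerivAt S (S₁ t) t := fun t ht =>
    ((hasDerivAt_id t).mul ((h.fst t ht).add (h.snd t ht))).congr_deriv (by simp [S₁])
  have hS₁d : ∀ t ∈ Ici T,
      HasDerivAt S₁ (-(t * (nl q β (x t) (y t) + nl q β (y t) (x t)))) t := fun t ht => by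
    have ht0 : t ≠ 0 := (hT.trans_le ht).ne'
    refine (((h.fst t ht).add (h.snd t ht)).add
      ((hasDerivAt_id t).mul (h.add₁ t ht))).congr_deriv ?_
    simp only [id]; field_simp; ring
  have hWr := monotoneOn_of_hasDerivAt (f := fun t => S₁ t * D t - S t * D₁ t) (convex_Ici T)
    (fun t ht => ((hS₁d t ht).mul (hC.deriv t ht)).sub ((hSd t ht).mul (hC.deriv₁ t ht)))
    (fun t ht => by
      have ht0 : t ≠ 0 := (hT.trans_le ht).ne'
      have e1 : -(t * (nl q β (x t) (y t) + nl q β (y t) (x t))) * D t + S₁ t * D₁ t -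
          (S₁ t * D₁ t + S t * (t * (-(2 / t * (x₁ t - y₁ t)) + (0 - 0) * (x t - y t) -
          (nl q β (x t) (y t) - nl q β (y t) (x t)) + 2 / t * (x₁ t - y₁ t)))) =
          2 * t ^ 2 * (y t * nl q β (x t) (y t) - x t * nl q β (y t) (x t)) := by
        simp only [hD, hS]; field_simp; ring
      refine le_of_le_of_eq ?_ e1.symm
      apply mul_nonneg (by positivity)
      rw [nl_eq hq, nl_eq hq]
      have a1 := hy t ht
      have a2 := hxy t ht
      have a3 := spow_nonneg (q := q) a1
      have a4 := spow_mono hq a2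
      have a5 : 0 ≤ x t * y t * (spow q (x t) ^ 2 - spow q (y t) ^ 2) :=
        mul_nonneg (mul_nonneg (a1.trans a2) a1) (by nlinarith)
      have a6 : 0 ≤ (-β) * (spow q (x t) * spow q (y t)) * (x t ^ 2 - y t ^ 2) :=
        mul_nonneg (mul_nonneg (by linarith) (mul_nonneg (a3.trans a4) a3)) (by nlinarith)
      nlinarith)
  have hgd : ∀ t ∈ Ici T, HasDerivAt (fun t => S t / D t)
      ((S₁ t * D t - S t * D₁ t) / D t ^ 2) t :=
    fun t ht => (hSd t ht).div (hC.deriv t ht) (hC.pos t ht).ne'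
  have hside : ∀ t ∈ Ici (4 * T), ∃ s, t / 2 ≤ s ∧ ∀ r ∈ Icc s (s + t / 2),
      x t / 12 ≤ x r := by
    intro t ht
    have ht' : 4 * T ≤ t := ht
    have htT : t ∈ Ici T := by simp only [mem_Ici]; linarith
    have ht0 : 0 < t := by linarith
    have hDt := hC.pos t htT
    -- The 12 is a factor 3 from comparing `D`, a factor 2 from `r ≤ 2t`, and a factor 2 from `x + y
    -- ≤ 2x`.
    have conc : ∀ r ∈ Ici T, r ≤ 2 * t → D t ≤ 3 * D r → S t / D t ≤ S r / D r →
        x t / 12 ≤ x r := by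
      intro r hr hrt hDr hg
      have hDr0 := hC.pos r hr
      have hr0 : 0 < r := hT.trans_le hr
      rw [div_le_div_iff₀ hDt hDr0] at hg
      have b1 : 0 ≤ S r := mul_nonneg hr0.le (by linarith [hy r hr, hxy r hr])
      have b2 : S t * D r ≤ (3 * S r) * D r :=
        hg.trans (by nlinarith [mul_le_mul_of_nonneg_left hDr b1])
      have b3 : S t ≤ 3 * S r := le_of_mul_le_mul_right b2 hDr0
      have b4 : S r ≤ 2 * t * (2 * x r) :=
        mul_le_mul hrt (by linarith [hxy r hr]) (by linarith [hy r hr, hxy r hr]) (by linarith)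
      have b5 : t * x t ≤ S t := by
        simp only [hS]; exact mul_le_mul_of_nonneg_left (by linarith [hy t htT]) ht0.le
      have b6 : t * (x t / 12) ≤ t * x r := by linarith
      exact le_of_mul_le_mul_left b6 ht0
    -- A nonnegative Wronskian at `t` selects the interval `[t, 3t/2]`, a nonpositive one `[t/2,
    -- t]`. In the second case `t ≥ 4T` gives `t - r ≤ 2 (r - T)`, which yields `D t ≤ 3 D r`.
    rcases le_total 0 (S₁ t * D t - S t * D₁ t) with hs | hs
    · refine ⟨t, by linarith, fun r hr => ?_⟩
      have hrT : r ∈ Ici T := le_trans (mem_Ici.1 htT) hr.1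
      refine conc r hrT (by linarith [hr.2]) ?_ ?_
      · have : D t ≤ D r := hC.monotone htT hrT hr.1
        linarith [hC.pos r hrT]
      · refine monotoneOn_of_hasDerivAt (convex_Ici t)
          (fun r hr => hgd r (le_trans (mem_Ici.1 htT) hr)) (fun r hr => ?_) self_mem_Ici hr.1 hr.1
        exact div_nonneg (hs.trans (hWr htT (le_trans (mem_Ici.1 htT) hr) hr)) (sq_nonneg _)
    · refine ⟨t / 2, le_rfl, fun r hr => ?_⟩
      have hrT : r ∈ Ici T := by simp only [mem_Ici]; linarith [hr.1]
      have hrt : r ≤ t := by linarith [hr.2]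
      refine conc r hrT (by linarith [hr.2]) ?_ ?_
      · have c1 : D t ≤ D r + D₁ r * (t - r) := hC.le_tangent hrT hrt
        have c2 : D T + D₁ r * (r - T) ≤ D r := hC.deriv_mul_le le_rfl hrT
        have c3 := hC.pos T self_mem_Ici
        have c4 : 0 ≤ D₁ r := hC.nonneg r hrT
        have c5 : D₁ r * (t - r) ≤ D₁ r * (2 * (r - T)) :=
          mul_le_mul_of_nonneg_left (by linarith [hr.1]) c4
        linarith
      · refine antitoneOn_of_hasDerivAt (convex_Icc T t)
          (fun r hr => hgd r hr.1) (fun r hr => ?_) ⟨hrT, hrt⟩ ⟨htT, le_rfl⟩ hrt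
        exact div_nonpos_of_nonpos_of_nonneg ((hWr hr.1 htT hr.2).trans hs) (sq_nonneg _)
  refine ⟨8 * 12 ^ (2 * q + 2), fun t ht => ?_⟩
  have ht' : 4 * T ≤ t := ht
  have ht0 : 0 < t := by linarith
  obtain ⟨s, hs, hsr⟩ := hside t ht
  have hx0 : 0 ≤ x t := (hy t (by simp only [mem_Ici]; linarith)).trans
    (hxy t (by simp only [mem_Ici]; linarith))
  have h1 := hC.mul_le_one (s := s) (r := t / 2) (κ := (x t / 12) ^ (2 * q + 2)) (by linarith)
    (by linarith) (by positivity) (fun r hr => by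
      have hrT : r ∈ Ici T := by simp only [mem_Ici]; linarith [hr.1]
      have hr0 : 0 < r := hT.trans_le hrT
      have h4 : (x t / 12) ^ (2 * q + 2) ≤ |x r| ^ (2 * q + 2) :=
        Real.rpow_le_rpow (by positivity) ((hsr r hr).trans (le_abs_self _)) (by linarith)
      have h6 := mul_le_mul_of_nonneg_right h4 (hpos r hrT).le
      have h7 := mul_le_mul_of_nonneg_left (h6.trans (key r hrT)) hr0.le
      linarith)
  rw [Real.div_rpow hx0 (by norm_num)] at h1
  rw [abs_of_nonneg hx0]
  set A := x t ^ (2 * q + 2)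
  have hA : 0 ≤ A := Real.rpow_nonneg hx0 _
  set Q : ℝ := 12 ^ (2 * q + 2)
  have hQ : 0 < Q := by positivity
  have h8 : A / Q * (t / 2) * (s - T) = (A * (t / 2 * (s - T))) / Q := by
    field_simp
  rw [h8, div_le_one (by positivity)] at h1
  have h9 : t ^ 2 / 8 ≤ t / 2 * (s - T) := by nlinarith
  nlinarith [mul_le_mul_of_nonneg_left h9 hA]

/-! ### Emden–Fowler variables and the energy argument -/

/-- The autonomous system obtained by the Emden–Fowler change of variables. -/
structure EFSol (q β b κ : ℝ) (φ ψ φ₁ ψ₁ : ℝ → ℝ) : Prop where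
  fst : ∀ t, HasDerivAt φ (φ₁ t) t
  snd : ∀ t, HasDerivAt ψ (ψ₁ t) t
  fst₁ : ∀ t, HasDerivAt φ₁ (b * φ₁ t + κ * φ t - nl q β (φ t) (ψ t)) t
  snd₁ : ∀ t, HasDerivAt ψ₁ (b * ψ₁ t + κ * ψ t - nl q β (ψ t) (φ t)) t

namespace EFSol
variable {q β b κ : ℝ} {φ ψ φ₁ ψ₁ : ℝ → ℝ}

lemma swap (h : EFSol q β b κ φ ψ φ₁ ψ₁) : EFSol q β b κ ψ φ ψ₁ φ₁ :=
  ⟨h.snd, h.fst, h.snd₁, h.fst₁⟩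

lemma abs_deriv_le (h : EFSol q β b κ φ ψ φ₁ ψ₁) (hq : -1 < q) (hb : 0 ≤ b) (hκ : 0 ≤ κ)
    {M T : ℝ} (hφ : ∀ t ∈ Ici T, |φ t| ≤ M) (hψ : ∀ t ∈ Ici T, |ψ t| ≤ M) :
    ∀ t ∈ Ici T, |φ₁ t| ≤
      gronwallBound (2 * M) b (κ * M + (1 + |β|) * M ^ (2 * q + 3)) 1 := by
  have hM : 0 ≤ M := (abs_nonneg _).trans (hφ T self_mem_Ici)
  intro t ht
  refine abs_deriv_le_of_interval hb (by positivity) (fun s _ => h.fst s) (fun s _ => h.fst₁ s)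
    (fun s hs => hφ s (le_trans (mem_Ici.1 ht) hs.1)) (fun s hs => ?_)
  have hs' : s ∈ Ici T := le_trans (mem_Ici.1 ht) hs.1
  have h1 := abs_nl_le (β := β) hq hM le_rfl (hφ s hs') (hψ s hs')
  have h2 := mul_le_mul_of_nonneg_left (hφ s hs') hκ
  refine (abs_sub _ _).trans ?_
  refine (add_le_add_left (abs_add_le _ _) _).trans ?_
  rw [abs_mul, abs_mul, abs_of_nonneg hb, abs_of_nonneg hκ]
  linarith

lemma hasDerivAt_energy (h : EFSol q β b κ φ ψ φ₁ ψ₁) (hq : -1 < q) (t : ℝ) :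
    HasDerivAt (fun t => (φ₁ t ^ 2 + ψ₁ t ^ 2) / 2 - κ / 2 * (φ t ^ 2 + ψ t ^ 2) +
      potential q β (φ t) (ψ t)) (b * (φ₁ t ^ 2 + ψ₁ t ^ 2)) t := by
  have h1 := ((((h.fst₁ t).pow 2).add ((h.snd₁ t).pow 2)).div_const 2).sub
    ((((h.fst t).pow 2).add ((h.snd t).pow 2)).const_mul (κ / 2))
  refine (h1.add (hasDerivAt_potential hq β (h.fst t) (h.snd t))).congr_deriv ?_
  norm_num
  ring

/-- The energy is nondecreasing, so a positive value would persist. A Pohozaev-type combination of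
`φφ' + ψψ'`, the energy and `φ² + ψ²` would then decrease at a fixed rate although boundedness of
the solution keeps it bounded. -/
lemma energy_nonpos (h : EFSol q β b κ φ ψ φ₁ ψ₁) (hq : -1 < q) (hb : 0 < b) (hκ : 0 ≤ κ)
    {M T₀ : ℝ} (hφ : ∀ t ∈ Ici T₀, |φ t| ≤ M) (hψ : ∀ t ∈ Ici T₀, |ψ t| ≤ M) (t₀ : ℝ) :
    (φ₁ t₀ ^ 2 + ψ₁ t₀ ^ 2) / 2 - κ / 2 * (φ t₀ ^ 2 + ψ t₀ ^ 2) +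
      potential q β (φ t₀) (ψ t₀) ≤ 0 := by
  by_contra! hE
  set E := fun t => (φ₁ t ^ 2 + ψ₁ t ^ 2) / 2 - κ / 2 * (φ t ^ 2 + ψ t ^ 2) +
      potential q β (φ t) (ψ t) with hEdef
  have hmono : Monotone E := by
    have := monotoneOn_of_hasDerivAt convex_univ
      (fun t _ => h.hasDerivAt_energy hq t) (fun t _ => by positivity)
    exact monotoneOn_univ.1 this
  set T := max T₀ t₀
  have hsub : ∀ t ∈ Ici T, t ∈ Ici T₀ := fun t ht => (le_max_left T₀ t₀).trans (mem_Ici.1 ht)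
  set M₁ := gronwallBound (2 * M) b (κ * M + (1 + |β|) * M ^ (2 * q + 3)) 1
  have hφ₁ : ∀ t ∈ Ici T₀, |φ₁ t| ≤ M₁ := h.abs_deriv_le hq hb.le hκ hφ hψ
  have hψ₁ : ∀ t ∈ Ici T₀, |ψ₁ t| ≤ M₁ := h.swap.abs_deriv_le hq hb.le hκ hψ hφ
  set P := 2 * (q + 2) with hP
  have hP2 : 2 ≤ P := by linarith
  -- This value cancels the `φ₁² + ψ₁²` terms in the derivative of `Zf`, while the coefficient `b /
  -- 2` cancels the cross terms. What remains is `-P E + κ (1 - P/2) (φ² + ψ²)`, and `P ≥ 2`.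
  set c := (1 + P / 2) / b with hc
  have hcb : c * b = 1 + P / 2 := by rw [hc]; field_simp
  let Zf : (ℝ × ℝ) × (ℝ × ℝ) → ℝ := fun z => (z.1.1 * z.2.1 + z.1.2 * z.2.2) -
    c * ((z.2.1 ^ 2 + z.2.2 ^ 2) / 2 - κ / 2 * (z.1.1 ^ 2 + z.1.2 ^ 2) +
      potential q β z.1.1 z.1.2) - b / 2 * (z.1.1 ^ 2 + z.1.2 ^ 2)
  have hZc : Continuous Zf := by
    have h1 : Continuous fun z : (ℝ × ℝ) × (ℝ × ℝ) => potential q β z.1.1 z.1.2 :=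
      (continuous_potential hq β).comp (by fun_prop)
    fun_prop
  have hK : IsCompact ((Icc (-M) M ×ˢ Icc (-M) M) ×ˢ (Icc (-M₁) M₁ ×ˢ Icc (-M₁) M₁)) :=
    (isCompact_Icc.prod isCompact_Icc).prod (isCompact_Icc.prod isCompact_Icc)
  obtain ⟨B, hB⟩ := hK.exists_bound_of_continuousOn hZc.continuousOn
  refine not_nonneg_of_deriv_le_neg (T := T) (k := P * E t₀)
    (f := fun t => Zf ((φ t, ψ t), (φ₁ t, ψ₁ t)) + B)
    (f' := fun t => -(P * E t) + κ * (1 - P / 2) * (φ t ^ 2 + ψ t ^ 2))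
    (mul_pos (by linarith) hE) (fun t _ => ?_) (fun t ht => ?_) (fun t ht => ?_)
  · have hG := ((h.fst t).mul (h.fst₁ t)).add ((h.snd t).mul (h.snd₁ t))
    have h2 := ((hG.sub ((h.hasDerivAt_energy hq t).const_mul c)).sub
      ((((h.fst t).pow 2).add ((h.snd t).pow 2)).const_mul (b / 2))).add_const B
    refine HasDerivAt.congr_deriv
      (f := fun t => Zf ((φ t, ψ t), (φ₁ t, ψ₁ t)) + B) h2 ?_
    have h3 := potential_euler hq β (φ t) (ψ t)
    rw [← hP] at h3
    simp only [hEdef]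
    norm_num
    linear_combination (-(φ₁ t ^ 2 + ψ₁ t ^ 2)) * hcb - h3
  · have h1 : E t₀ ≤ E t := hmono ((le_max_right T₀ t₀).trans ht)
    have h2 := mul_le_mul_of_nonneg_left h1 (show 0 ≤ P by linarith)
    have h3 : 0 ≤ κ * (P / 2 - 1) * (φ t ^ 2 + ψ t ^ 2) :=
      mul_nonneg (mul_nonneg hκ (by linarith)) (by positivity)
    linarith
  · have h1 := hB ((φ t, ψ t), (φ₁ t, ψ₁ t))
      ⟨⟨abs_le.1 (hφ t (hsub t ht)), abs_le.1 (hψ t (hsub t ht))⟩,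
        ⟨abs_le.1 (hφ₁ t (hsub t ht)), abs_le.1 (hψ₁ t (hsub t ht))⟩⟩
    have h2 := neg_le_of_abs_le h1
    linarith

/-- The energy increases from the limit 0 and is nonpositive, hence vanishes identically. Its
derivative then kills both velocities, and the constants are fixed by their limit at `-∞`. -/
lemma eq_zero (h : EFSol q β b κ φ ψ φ₁ ψ₁) (hq : -1 < q) (hb : 0 < b) (hκ : 0 ≤ κ)
    {M T₀ : ℝ} (hφ : ∀ t ∈ Ici T₀, |φ t| ≤ M) (hψ : ∀ t ∈ Ici T₀, |ψ t| ≤ M)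
    (l1 : Tendsto φ atBot (𝓝 0)) (l2 : Tendsto ψ atBot (𝓝 0))
    (l3 : Tendsto φ₁ atBot (𝓝 0)) (l4 : Tendsto ψ₁ atBot (𝓝 0)) :
    ∀ t, φ t = 0 ∧ ψ t = 0 := by
  set E := fun t => (φ₁ t ^ 2 + ψ₁ t ^ 2) / 2 - κ / 2 * (φ t ^ 2 + ψ t ^ 2) +
      potential q β (φ t) (ψ t) with hEdef
  have hmono : Monotone E := by
    have := monotoneOn_of_hasDerivAt convex_univ
      (fun t _ => h.hasDerivAt_energy hq t) (fun t _ => by positivity)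
    exact monotoneOn_univ.1 this
  have hlim : Tendsto E atBot (𝓝 0) := by
    have h0 : potential q β 0 0 = 0 := by simp [potential]
    have hc : Tendsto (fun z : ℝ × ℝ => potential q β z.1 z.2) (𝓝 (0, 0)) (𝓝 0) := by
      have := (continuous_potential hq β).tendsto (0, 0)
      simp only [h0] at this
      exact this
    have hp := hc.comp (l1.prodMk_nhds l2)
    simp only [Function.comp_def] at hp
    have h1 : Tendsto (fun t => (φ₁ t ^ 2 + ψ₁ t ^ 2) / 2) atBot (𝓝 ((0 ^ 2 + 0 ^ 2) / 2)) :=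
      ((l3.pow 2).add (l4.pow 2)).div_const 2
    have h2 : Tendsto (fun t => κ / 2 * (φ t ^ 2 + ψ t ^ 2)) atBot
        (𝓝 (κ / 2 * (0 ^ 2 + 0 ^ 2))) := ((l1.pow 2).add (l2.pow 2)).const_mul (κ / 2)
    have h3 := (h1.sub h2).add hp
    norm_num at h3
    exact h3
  have hE0 : ∀ t, E t = 0 := fun t => le_antisymm
    (h.energy_nonpos hq hb hκ hφ hψ t) (hmono.le_of_tendsto hlim t)
  have hd : ∀ t, b * (φ₁ t ^ 2 + ψ₁ t ^ 2) = 0 := by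
    intro t
    have h1 := h.hasDerivAt_energy hq t
    have h2 : HasDerivAt E 0 t := by
      rw [show E = fun _ => (0 : ℝ) from funext hE0]; exact hasDerivAt_const _ _
    exact h1.unique h2
  have hd' : ∀ t, φ₁ t = 0 ∧ ψ₁ t = 0 := by
    intro t
    have h1 := (mul_eq_zero.1 (hd t)).resolve_left hb.ne'
    constructor <;> nlinarith [sq_nonneg (φ₁ t), sq_nonneg (ψ₁ t)]
  have hconst : ∀ {f f₁ : ℝ → ℝ}, (∀ t, HasDerivAt f (f₁ t) t) → (∀ t, f₁ t = 0) →
      Tendsto f atBot (𝓝 0) → ∀ t, f t = 0 := by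
    intro f f₁ hf hf₁ hl t
    have hc : ∀ s, f s = f t := fun s => is_const_of_deriv_eq_zero
      (fun s => (hf s).differentiableAt) (fun s => by rw [(hf s).deriv, hf₁ s]) s t
    have : Tendsto f atBot (𝓝 (f t)) := by
      rw [show f = fun _ => f t from funext hc]; exact tendsto_const_nhds
    exact tendsto_nhds_unique this hl
  exact fun t => ⟨hconst h.fst (fun t => (hd' t).1) l1 t, hconst h.snd (fun t => (hd' t).2) l2 t⟩

end EFSol

/-- With `a (2q + 2) = 2` the homogeneity of the nonlinearity matches the factor `exp (a t) * exp t
^ 2` of the second derivative, so the explicit `t` disappears. -/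
lemma Sol.efSol {q β : ℝ} (hq : -1 < q) {x y x₁ y₁ : ℝ → ℝ}
    (h : Sol q (fun t => 2 / t) 0 0 β (Ioi 0) x y x₁ y₁) {a : ℝ} (ha : a * (q + 1) = 1) :
    EFSol q β (2 * a - 1) (a * (1 - a)) (fun t => Real.exp (a * t) * x (Real.exp t))
      (fun t => Real.exp (a * t) * y (Real.exp t))
      (fun t => Real.exp (a * t) * (a * x (Real.exp t) + Real.exp t * x₁ (Real.exp t)))
      (fun t => Real.exp (a * t) * (a * y (Real.exp t) + Real.exp t * y₁ (Real.exp t))) := by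
  have hexp : ∀ t, HasDerivAt (fun t => Real.exp (a * t)) (Real.exp (a * t) * a) t := fun t => by
    simpa using ((hasDerivAt_id t).const_mul a).exp
  have hmul : ∀ t u v : ℝ, nl q β (Real.exp (a * t) * u) (Real.exp (a * t) * v) =
      Real.exp (a * t) * Real.exp t ^ 2 * nl q β u v := by
    intro t u v
    rw [nl_mul hq (Real.exp_pos _), ← Real.exp_mul, ← Real.exp_nat_mul, ← Real.exp_add]
    congr 2
    push_cast
    linear_combination 2 * t * ha
  have key : ∀ {x x₁ x₂ : ℝ → ℝ}, (∀ t ∈ Ioi (0 : ℝ), HasDerivAt x (x₁ t) t) →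
      (∀ t ∈ Ioi (0 : ℝ), HasDerivAt x₁ (x₂ t) t) → ∀ t,
      HasDerivAt (fun t => Real.exp (a * t) * x (Real.exp t))
        (Real.exp (a * t) * (a * x (Real.exp t) + Real.exp t * x₁ (Real.exp t))) t ∧
      HasDerivAt
        (fun t => Real.exp (a * t) * (a * x (Real.exp t) + Real.exp t * x₁ (Real.exp t)))
        (Real.exp (a * t) * (a ^ 2 * x (Real.exp t) + (2 * a + 1) * Real.exp t * x₁ (Real.exp t)
          + Real.exp t ^ 2 * x₂ (Real.exp t))) t := by
    intro x x₁ x₂ hx hx₁ t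
    have d0 : HasDerivAt (fun t => x (Real.exp t)) (x₁ (Real.exp t) * Real.exp t) t :=
      (hx _ (Real.exp_pos t)).comp t (Real.hasDerivAt_exp t)
    have d1 : HasDerivAt (fun t => x₁ (Real.exp t)) (x₂ (Real.exp t) * Real.exp t) t :=
      (hx₁ _ (Real.exp_pos t)).comp t (Real.hasDerivAt_exp t)
    exact ⟨((hexp t).mul d0).congr_deriv (by ring),
      ((hexp t).mul ((d0.const_mul a).add ((Real.hasDerivAt_exp t).mul d1))).congr_deriv
        (by simp only [Pi.add_apply, Pi.mul_apply]; ring)⟩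
  have h1 := key h.fst h.fst₁
  have h2 := key h.snd h.snd₁
  refine ⟨fun t => (h1 t).1, fun t => (h2 t).1, fun t => (h1 t).2.congr_deriv ?_,
    fun t => (h2 t).2.congr_deriv ?_⟩
  · have := (Real.exp_pos t).ne'
    rw [hmul]; field_simp; ring
  · have := (Real.exp_pos t).ne'
    rw [hmul]; field_simp; ring

/-- The decay hypothesis says exactly that the Emden–Fowler variables are bounded at `+∞`. The
bounds near the origin make them and their derivatives tend to 0 at `-∞`. -/
lemma eq_zero_of_decay {q β : ℝ} (hq : 0 ≤ q) (hq1 : q < 1) {x y x₁ y₁ : ℝ → ℝ}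
    (h : Sol q (fun t => 2 / t) 0 0 β (Ioi 0) x y x₁ y₁) {M C : ℝ}
    (hM : ∀ t ∈ Ioc (0 : ℝ) 1, |x t| ≤ M ∧ |y t| ≤ M ∧ |x₁ t| ≤ M ∧ |y₁ t| ≤ M)
    (hx : ∀ᶠ t in atTop, t ^ 2 * |x t| ^ (2 * q + 2) ≤ C)
    (hy : ∀ᶠ t in atTop, t ^ 2 * |y t| ^ (2 * q + 2) ≤ C) :
    ∀ t ∈ Ioi (0 : ℝ), x t = 0 ∧ y t = 0 := by
  have hq' : -1 < q := by linarith
  set a := (q + 1)⁻¹ with ha_def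
  have ha : a * (q + 1) = 1 := inv_mul_cancel₀ (by linarith)
  have ha0 : 0 < a := by positivity
  -- The signs needed by the energy argument: `q ≥ 0` makes `a (1 - a)` nonnegative and `q < 1`, the
  -- subcritical range, makes `2 a - 1` positive.
  have ha1 : a ≤ 1 := by nlinarith
  have ha2 : 1 / 2 < a := by nlinarith
  have hE := h.efSol hq' ha
  have hbd : ∀ {z : ℝ → ℝ}, (∀ᶠ t in atTop, t ^ 2 * |z t| ^ (2 * q + 2) ≤ C) →
      ∀ᶠ t in atTop, |Real.exp (a * t) * z (Real.exp t)| ≤ C ^ (a / 2) := by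
    intro z hz
    filter_upwards [Real.tendsto_exp_atTop.eventually hz] with t ht
    have e1 : |Real.exp (a * t) * z (Real.exp t)| =
        (Real.exp t ^ 2 * |z (Real.exp t)| ^ (2 * q + 2)) ^ (a / 2) := by
      rw [Real.mul_rpow (by positivity) (by positivity), ← Real.rpow_mul (abs_nonneg _),
        ← Real.exp_nat_mul, ← Real.exp_mul, abs_mul, abs_of_pos (Real.exp_pos _)]
      have e2 : (2 * q + 2) * (a / 2) = 1 := by linear_combination ha
      rw [e2, Real.rpow_one]
      congr 2
      push_cast; ring
    rw [e1]
    exact Real.rpow_le_rpow (by positivity) ht (by positivity)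
  obtain ⟨T, hT⟩ := eventually_atTop.1 ((hbd hx).and (hbd hy))
  have hzero : ∀ {z : ℝ → ℝ}, (∃ N, ∀ᶠ t in atBot, |z t| ≤ N) →
      Tendsto (fun t => Real.exp (a * t) * z t) atBot (𝓝 0) := by
    rintro z ⟨N, hN⟩
    have h1 : Tendsto (fun t => Real.exp (a * t) * N) atBot (𝓝 (0 * N)) :=
      (Real.tendsto_exp_atBot.comp (tendsto_id.const_mul_atBot ha0)).mul_const N
    rw [zero_mul] at h1
    refine squeeze_zero_norm' ?_ h1
    filter_upwards [hN] with t ht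
    rw [norm_mul, Real.norm_eq_abs, Real.norm_eq_abs, abs_of_pos (Real.exp_pos _)]
    exact mul_le_mul_of_nonneg_left ht (Real.exp_pos _).le
  have hin : ∀ᶠ t in atBot, Real.exp t ∈ Ioc (0 : ℝ) 1 := by
    filter_upwards [eventually_le_atBot 0] with t ht
    exact ⟨Real.exp_pos t, Real.exp_le_one_iff.2 ht⟩
  have hder : ∀ {u v : ℝ → ℝ}, (∀ t ∈ Ioc (0 : ℝ) 1, |u t| ≤ M) →
      (∀ t ∈ Ioc (0 : ℝ) 1, |v t| ≤ M) →
      ∀ᶠ t in atBot, |a * u (Real.exp t) + Real.exp t * v (Real.exp t)| ≤ a * M + 1 * M := by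
    intro u v hu hv
    filter_upwards [hin] with t ht
    refine (abs_add_le _ _).trans ?_
    rw [abs_mul, abs_mul, abs_of_pos ha0, abs_of_pos (Real.exp_pos _)]
    exact add_le_add (mul_le_mul_of_nonneg_left (hu _ ht) ha0.le)
      (mul_le_mul ht.2 (hv _ ht) (abs_nonneg _) one_pos.le)
  have hz := hE.eq_zero hq' (by linarith) (mul_nonneg ha0.le (by linarith))
    (fun t ht => (hT t ht).1) (fun t ht => (hT t ht).2)
    (hzero ⟨M, hin.mono fun t ht => (hM _ ht).1⟩) (hzero ⟨M, hin.mono fun t ht => (hM _ ht).2.1⟩)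
    (hzero ⟨_, hder (fun t ht => (hM t ht).1) (fun t ht => (hM t ht).2.2.1)⟩)
    (hzero ⟨_, hder (fun t ht => (hM t ht).2.1) (fun t ht => (hM t ht).2.2.2)⟩)
  intro t ht
  have := hz (Real.log t)
  rw [Real.exp_log ht] at this
  exact ⟨(mul_eq_zero.1 this.1).resolve_left (Real.exp_pos _).ne',
    (mul_eq_zero.1 this.2).resolve_left (Real.exp_pos _).ne'⟩

/-! ### Liouville theorems for eventually signed solutions -/

lemma no_positive_supersolution {m q c T : ℝ} (hm : m = 0 ∨ m = 1 ∨ (m = 2 ∧ q ≤ 0))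
    (hq : -1 < q) (hc : 0 < c) (hT : 1 ≤ T)
    {w w₁ w₂ x : ℝ → ℝ} (hw : ∀ t ∈ Ici T, HasDerivAt w (w₁ t) t)
    (hw₁ : ∀ t ∈ Ici T, HasDerivAt w₁ (w₂ t) t) (hpos : ∀ t ∈ Ici T, 0 < w t)
    (hx : ∀ t ∈ Ici T, w t ≤ 2 * x t)
    (h : ∀ t ∈ Ici T, w₂ t + m / t * w₁ t ≤ -(c * |x t| ^ (2 * q + 2) * w t)) : False := by
  rcases hm with rfl | rfl | ⟨rfl, hq0⟩
  · exact no_positive_supersolution_zero hq hc hw hw₁ hpos hx (fun t ht => by simpa using h t ht)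
  · exact no_positive_supersolution_one hq hc (by linarith) hw hw₁ hpos hx h
  · exact no_positive_supersolution_two hq hq0 hc hT hw hw₁ hpos hx h

lemma deriv_eq_zero_of_nonneg {w : ℝ → ℝ} {T t w' : ℝ} (ht : T < t) (hw : ∀ s ∈ Ici T, 0 ≤ w s)
    (hd : HasDerivAt w w' t) (h0 : w t = 0) : w' = 0 := by
  refine IsLocalMin.hasDerivAt_eq_zero (f := w) ?_ hd
  filter_upwards [lt_mem_nhds ht] with s hs
  rw [h0]; exact hw s (le_of_lt hs)

/-- The conditions on domain and damping in the Liouville theorems: either a half-line without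
damping, or the full half-line `(0, ∞)` with damping `m / t` and regularity at the origin. -/
def Admissible (m q : ℝ) (S : Set ℝ) (x y x₁ y₁ : ℝ → ℝ) : Prop :=
  m = 0 ∨ m = 1 ∨ (m = 2 ∧ q < 1 ∧ S = Ioi 0 ∧
    ∃ M, ∀ t ∈ Ioc (0 : ℝ) 1, |x t| ≤ M ∧ |y t| ≤ M ∧ |x₁ t| ≤ M ∧ |y₁ t| ≤ M)

section
variable {m q β : ℝ} {S : Set ℝ} {x y x₁ y₁ : ℝ → ℝ}

lemma Admissible.swap (h : Admissible m q S x y x₁ y₁) : Admissible m q S y x y₁ x₁ := by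
  rcases h with h | h | ⟨h1, h2, h3, M, hM⟩
  · exact Or.inl h
  · exact Or.inr (Or.inl h)
  · refine Or.inr (Or.inr ⟨h1, h2, h3, M, fun t ht => ?_⟩)
    obtain ⟨a, b, c, d⟩ := hM t ht
    exact ⟨b, a, d, c⟩

lemma Admissible.neg_right (h : Admissible m q S x y x₁ y₁) :
    Admissible m q S x (fun t => -y t) x₁ (fun t => -y₁ t) := by
  simpa only [Admissible, abs_neg] using h

lemma Admissible.neg_left (h : Admissible m q S x y x₁ y₁) :
    Admissible m q S (fun t => -x t) y (fun t => -x₁ t) y₁ := h.swap.neg_right.swap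

lemma Admissible.cases (h : Admissible m q S x y x₁ y₁) :
    (m = 0 ∨ m = 1 ∨ (m = 2 ∧ q ≤ 0)) ∨ (m = 2 ∧ 0 ≤ q ∧ q < 1 ∧ S = Ioi 0 ∧
    ∃ M, ∀ t ∈ Ioc (0 : ℝ) 1, |x t| ≤ M ∧ |y t| ≤ M ∧ |x₁ t| ≤ M ∧ |y₁ t| ≤ M) := by
  rcases h with h | h | ⟨h1, h2, h3⟩
  · exact Or.inl (Or.inl h)
  · exact Or.inl (Or.inr (Or.inl h))
  · rcases le_total q 0 with h | h
    · exact Or.inl (Or.inr (Or.inr ⟨h1, h⟩))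
    · exact Or.inr ⟨h1, h, h2, h3⟩

lemma exists_Ici_of_ordered (hS : ∀ᶠ t in atTop, t ∈ S) (hy : ∀ᶠ t in atTop, 0 ≤ y t)
    (hxy : ∀ᶠ t in atTop, y t ≤ x t) :
    ∃ T, 1 ≤ T ∧ ∀ t ∈ Ici T, t ∈ S ∧ 0 ≤ y t ∧ y t ≤ x t := by
  obtain ⟨T, hT⟩ := eventually_atTop.1 (hS.and (hy.and hxy))
  exact ⟨max T 1, le_max_right _ _, fun t ht => hT t ((le_max_left T 1).trans ht)⟩

/-- If the components differ, `x - y` is eventually strictly positive: a zero would be a minimum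
with vanishing derivative, and unique continuation applies. It is then a forbidden supersolution, or
in the remaining three-dimensional range forces decay and hence the zero solution. -/
lemma eq_of_ordered [hSc : S.OrdConnected] (hq : -1 < q) (hβ : β ≤ 0)
    (h : Sol q (fun t => m / t) 0 0 β S x y x₁ y₁) (he : ContinuousOn (fun t => m / t) S)
    (hm : Admissible m q S x y x₁ y₁) (hS : ∀ᶠ t in atTop, t ∈ S)
    (hy : ∀ᶠ t in atTop, 0 ≤ y t) (hxy : ∀ᶠ t in atTop, y t ≤ x t) :
    ∀ t ∈ S, x t = y t := by
  by_contra hne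
  obtain ⟨T, hT1, hT⟩ := exists_Ici_of_ordered hS hy hxy
  have hpos : ∀ t ∈ Ici (T + 1), 0 < x t - y t := by
    intro t ht
    have htT : T < t := by simp only [mem_Ici] at ht; linarith
    obtain ⟨a1, a2, a3⟩ := hT t htT.le
    refine lt_of_le_of_ne (by linarith) fun h0 => hne ?_
    have := deriv_eq_zero_of_nonneg (w := fun t => x t - y t) htT
      (fun s hs => by linarith [(hT s hs).2.2]) (h.sub₀ t a1) h0.symm
    exact h.eq_of_eq_at hq he a1 (by linarith) (by linarith)
  have hsub : ∀ t ∈ Ici (T + 1), t ∈ Ici T := fun t ht => by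
    simp only [mem_Ici] at *; linarith
  have h' : Sol q (fun t => m / t) 0 0 β (Ici (T + 1)) x y x₁ y₁ :=
    h.mono fun t ht => (hT t (hsub t ht)).1
  rcases hm.cases with hm | ⟨rfl, hq0, hq1, hSe, M, hM⟩
  · refine no_positive_supersolution hm hq one_pos (by linarith : 1 ≤ T + 1) h'.sub₀ h'.sub₁ hpos
      (x := x) (fun t ht => ?_) (fun t ht => ?_)
    · obtain ⟨-, a2, a3⟩ := hT t (hsub t ht); linarith
    · obtain ⟨-, a2, a3⟩ := hT t (hsub t ht)
      linarith [nl_sub_ge hq hβ a2 a3]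
  · obtain ⟨C, hC⟩ := decay_of_sub hq hβ (by linarith) h' (fun t ht => (hT t (hsub t ht)).2.1) hpos
    subst hSe
    have hz := eq_zero_of_decay hq0 hq1 h hM
      (eventually_atTop.2 ⟨_, fun t ht => hC t ht⟩)
      (C := C) (eventually_atTop.2 ⟨4 * (T + 1), fun t ht => ?_⟩)
    · have h1 := hz (T + 1) (by simp only [mem_Ioi]; linarith)
      have := hpos (T + 1) self_mem_Ici
      rw [h1.1, h1.2] at this
      simp at this
    · refine le_trans ?_ (hC t ht)
      obtain ⟨-, a2, a3⟩ := hT t (by simp only [mem_Ici]; linarith)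
      exact mul_le_mul_of_nonneg_left (Real.rpow_le_rpow (abs_nonneg _)
        (abs_le_abs_of_nonneg a2 a3) (by linarith)) (sq_nonneg _)

/-- The same scheme for `x + y`. A zero of the sum forces both components and both derivatives to
vanish there, and unique continuation for sum and difference gives the zero solution. -/
lemma eq_zero_of_ordered [hSc : S.OrdConnected] (hq : -1 < q) (hβ : -1 < β)
    (h : Sol q (fun t => m / t) 0 0 β S x y x₁ y₁) (he : ContinuousOn (fun t => m / t) S)
    (hm : Admissible m q S x y x₁ y₁) (hS : ∀ᶠ t in atTop, t ∈ S)
    (hy : ∀ᶠ t in atTop, 0 ≤ y t) (hxy : ∀ᶠ t in atTop, y t ≤ x t) :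
    ∀ t ∈ S, x t = 0 ∧ y t = 0 := by
  by_contra hne
  obtain ⟨T, hT1, hT⟩ := exists_Ici_of_ordered hS hy hxy
  have hpos : ∀ t ∈ Ici (T + 1), 0 < x t + y t := by
    intro t ht
    have htT : T < t := by simp only [mem_Ici] at ht; linarith
    obtain ⟨a1, a2, a3⟩ := hT t htT.le
    refine lt_of_le_of_ne (by linarith) fun h0 => hne ?_
    have h1 := deriv_eq_zero_of_nonneg (w := fun t => x t + y t) htT
      (fun s hs => by linarith [(hT s hs).2]) (h.add₀ t a1) h0.symm
    have hneg := h.eq_neg_of_eq_neg_at hq he a1 (by linarith) (by linarith)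
    have h2 := deriv_eq_zero_of_nonneg (w := y) htT (fun s hs => (hT s hs).2.1) (h.snd t a1)
      (by linarith)
    have heq := h.eq_of_eq_at hq he a1 (by linarith) (by linarith)
    exact fun s hs => by constructor <;> linarith [hneg s hs, heq s hs]
  have hsub : ∀ t ∈ Ici (T + 1), t ∈ Ici T := fun t ht => by
    simp only [mem_Ici] at *; linarith
  have h' : Sol q (fun t => m / t) 0 0 β (Ici (T + 1)) x y x₁ y₁ :=
    h.mono fun t ht => (hT t (hsub t ht)).1
  rcases hm.cases with hm | ⟨rfl, hq0, hq1, hSe, M, hM⟩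
  · refine no_positive_supersolution hm hq (min_one_add_pos hβ) (by linarith : 1 ≤ T + 1)
      h'.add₀ h'.add₁ hpos (x := x) (fun t ht => ?_) (fun t ht => ?_)
    · obtain ⟨-, a2, a3⟩ := hT t (hsub t ht); linarith
    · obtain ⟨-, a2, a3⟩ := hT t (hsub t ht)
      linarith [(nl_add_ge (β := β) hq a2 a3).resolve_right (by linarith)]
  · obtain ⟨C, hC⟩ := decay_of_add hq hβ (by linarith) h' (fun t ht => (hT t (hsub t ht)).2.1)
      (fun t ht => (hT t (hsub t ht)).2.2) hpos
    subst hSe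
    refine hne (eq_zero_of_decay hq0 hq1 h hM (eventually_atTop.2 ⟨_, fun t ht => hC t ht⟩)
      (C := C) (eventually_atTop.2 ⟨4 * (T + 1), fun t ht => ?_⟩))
    refine le_trans ?_ (hC t ht)
    obtain ⟨-, a2, a3⟩ := hT t (by simp only [mem_Ici]; linarith)
    exact mul_le_mul_of_nonneg_left (Real.rpow_le_rpow (abs_nonneg _)
      (abs_le_abs_of_nonneg a2 a3) (by linarith)) (sq_nonneg _)

/-- `f` is eventually of one sign at `+∞`. -/
def EventuallySigned (f : ℝ → ℝ) : Prop := (∀ᶠ t in atTop, 0 ≤ f t) ∨ (∀ᶠ t in atTop, f t ≤ 0)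

/-- Reduction to ordered nonnegative components. -/
lemma liouville_induction {P : (ℝ → ℝ) → (ℝ → ℝ) → (ℝ → ℝ) → (ℝ → ℝ) → Prop}
    (h : Sol q (fun t => m / t) 0 0 β S x y x₁ y₁) (hm : Admissible m q S x y x₁ y₁)
    (hx : EventuallySigned x) (hy : EventuallySigned y)
    (hsub : EventuallySigned fun t => x t - y t) (hadd : EventuallySigned fun t => x t + y t)
    (hord : ∀ x y x₁ y₁, Sol q (fun t => m / t) 0 0 β S x y x₁ y₁ →
      Admissible m q S x y x₁ y₁ → (∀ᶠ t in atTop, 0 ≤ y t) → (∀ᶠ t in atTop, y t ≤ x t) →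
      P x y x₁ y₁)
    (hswap : ∀ x y x₁ y₁, P y x y₁ x₁ → P x y x₁ y₁)
    (hneg : ∀ x y x₁ y₁, P (fun t => -x t) y (fun t => -x₁ t) y₁ → P x y x₁ y₁) :
    P x y x₁ y₁ := by
  have hpos : ∀ x y x₁ y₁, Sol q (fun t => m / t) 0 0 β S x y x₁ y₁ →
      Admissible m q S x y x₁ y₁ → (∀ᶠ t in atTop, 0 ≤ x t) → (∀ᶠ t in atTop, 0 ≤ y t) →
      EventuallySigned (fun t => x t - y t) → P x y x₁ y₁ := by
    rintro x y x₁ y₁ h hm hx hy (hs | hs)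
    · exact hord x y x₁ y₁ h hm hy (hs.mono fun t ht => by linarith)
    · exact hswap _ _ _ _ (hord y x y₁ x₁ h.swap hm.swap hx (hs.mono fun t ht => by linarith))
  have hneg' : ∀ x y x₁ y₁, P x (fun t => -y t) x₁ (fun t => -y₁ t) → P x y x₁ y₁ :=
    fun x y x₁ y₁ hp => hswap _ _ _ _ (hneg _ _ _ _ (hswap _ _ _ _ hp))
  -- Changing the sign of one component flips the sign of the coupling `γ`, which is zero here; the
  -- literal `-0` has to be normalised.
  have h0 : (-0 : ℝ) = 0 := neg_zero
  have hl : Sol q (fun t => m / t) 0 0 β S (fun t => -x t) y (fun t => -x₁ t) y₁ := by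
    simpa only [h0] using h.neg_left
  have hr : Sol q (fun t => m / t) 0 0 β S x (fun t => -y t) x₁ (fun t => -y₁ t) := by
    simpa only [h0] using h.neg_right
  have hlr : Sol q (fun t => m / t) 0 0 β S (fun t => -x t) (fun t => -y t) (fun t => -x₁ t)
      (fun t => -y₁ t) := by
    simpa only [h0] using hl.neg_right
  have hflip : ∀ {f g : ℝ → ℝ}, EventuallySigned f → (∀ t, g t = -f t) → EventuallySigned g := by
    rintro f g (hf | hf) hg
    · exact Or.inr (hf.mono fun t ht => by rw [hg]; linarith)
    · exact Or.inl (hf.mono fun t ht => by rw [hg]; linarith)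
  have hn : ∀ {f : ℝ → ℝ}, (∀ᶠ t in atTop, f t ≤ 0) → ∀ᶠ t in atTop, 0 ≤ -f t :=
    fun hf => hf.mono fun t ht => by linarith
  rcases hx with hx | hx <;> rcases hy with hy | hy
  · exact hpos _ _ _ _ h hm hx hy hsub
  · exact hneg' _ _ _ _ (hpos _ _ _ _ hr hm.neg_right hx (hn hy) (by simpa using hadd))
  · exact hneg _ _ _ _ (hpos _ _ _ _ hl hm.neg_left (hn hx) hy
      (hflip hadd fun t => by ring))
  · exact hneg _ _ _ _ (hneg' _ _ _ _ (hpos _ _ _ _ hlr hm.neg_left.neg_right (hn hx) (hn hy)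
      (hflip hsub fun t => by ring)))

theorem eq_or_eq_neg_of_signed [S.OrdConnected] (hq : -1 < q) (hβ : β ≤ 0)
    (h : Sol q (fun t => m / t) 0 0 β S x y x₁ y₁) (he : ContinuousOn (fun t => m / t) S)
    (hm : Admissible m q S x y x₁ y₁) (hS : ∀ᶠ t in atTop, t ∈ S)
    (hx : EventuallySigned x) (hy : EventuallySigned y)
    (hsub : EventuallySigned fun t => x t - y t) (hadd : EventuallySigned fun t => x t + y t) :
    (∀ t ∈ S, x t = y t) ∨ ∀ t ∈ S, x t = -y t := by
  refine liouville_induction (P := fun x y _ _ => (∀ t ∈ S, x t = y t) ∨ ∀ t ∈ S, x t = -y t)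
    h hm hx hy hsub hadd
    (fun x y x₁ y₁ h hm hy hxy => Or.inl (eq_of_ordered hq hβ h he hm hS hy hxy)) ?_ ?_
  · rintro x y x₁ y₁ (h | h)
    · exact Or.inl fun t ht => (h t ht).symm
    · exact Or.inr fun t ht => by linarith [h t ht]
  · rintro x y x₁ y₁ (h | h)
    · exact Or.inr fun t ht => by linarith [h t ht]
    · exact Or.inl fun t ht => by linarith [h t ht]

theorem eq_zero_of_signed [S.OrdConnected] (hq : -1 < q) (hβ : -1 < β)
    (h : Sol q (fun t => m / t) 0 0 β S x y x₁ y₁) (he : ContinuousOn (fun t => m / t) S)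
    (hm : Admissible m q S x y x₁ y₁) (hS : ∀ᶠ t in atTop, t ∈ S)
    (hx : EventuallySigned x) (hy : EventuallySigned y)
    (hsub : EventuallySigned fun t => x t - y t) (hadd : EventuallySigned fun t => x t + y t) :
    ∀ t ∈ S, x t = 0 ∧ y t = 0 := by
  refine liouville_induction (P := fun x y _ _ => ∀ t ∈ S, x t = 0 ∧ y t = 0)
    h hm hx hy hsub hadd
    (fun x y x₁ y₁ h hm hy hxy => eq_zero_of_ordered hq hβ h he hm hS hy hxy) ?_ ?_
  · exact fun x y x₁ y₁ h t ht => (h t ht).symm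
  · exact fun x y x₁ y₁ h t ht => ⟨neg_eq_zero.1 (h t ht).1, (h t ht).2⟩

end

/-! ### Scalar equations satisfied when the components agree up to sign -/

lemma nl_self {q : ℝ} (hq : -1 < q) (β x : ℝ) :
    nl q β x x = (1 + β) * |x| ^ (2 * q + 2) * x := by
  rw [nl_eq hq, ← spow_sq hq]; ring

/-- A scalar radial equation. -/
structure ScalarSol (q m k : ℝ) (S : Set ℝ) (x x₁ : ℝ → ℝ) : Prop where
  deriv : ∀ t ∈ S, HasDerivAt x (x₁ t) t
  deriv₁ : ∀ t ∈ S, HasDerivAt x₁ (-(m / t * x₁ t) + k * |x t| ^ (2 * q + 2) * x t) t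

lemma Sol.scalar {q m β : ℝ} {S : Set ℝ} {x y x₁ y₁ : ℝ → ℝ} (hq : -1 < q)
    (h : Sol q (fun t => m / t) 0 0 β S x y x₁ y₁) (hxy : ∀ t ∈ S, x t = y t) :
    ScalarSol q m (-(1 + β)) S x x₁ where
  deriv := h.fst
  deriv₁ t ht := (h.fst₁ t ht).congr_deriv (by rw [← hxy t ht, nl_self hq]; ring)

lemma const_of_deriv_eq_zero {f f' : ℝ → ℝ} {S : Set ℝ} (hS : Convex ℝ S)
    (hf : ∀ t ∈ S, HasDerivAt f (f' t) t) (h0 : ∀ t ∈ S, f' t = 0) :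
    ∀ s ∈ S, ∀ t ∈ S, f s = f t := by
  have h1 := antitoneOn_of_hasDerivAt hS hf fun t ht => (h0 t ht).le
  have h2 := monotoneOn_of_hasDerivAt hS hf fun t ht => (h0 t ht).ge
  intro s hs t ht
  rcases le_total s t with h | h
  · exact le_antisymm (h2 hs ht h) (h1 hs ht h)
  · exact le_antisymm (h1 ht hs h) (h2 ht hs h)

/-- The flux `t^m x'`. -/
lemma hasDerivAt_pow_mul {m : ℕ} {w : ℝ → ℝ} {r t : ℝ} (ht : t ≠ 0)
    (h : HasDerivAt w (-(m / t * w t) + r) t) :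
    HasDerivAt (fun t => t ^ m * w t) (t ^ m * r) t := by
  refine ((hasDerivAt_pow m t).mul h).congr_deriv ?_
  rcases m with _ | m
  · simp
  · simp only [Nat.add_sub_cancel, pow_succ]; field_simp; ring

lemma tendsto_zero_of_abs_le {g : ℝ → ℝ} {C : ℝ} (h : ∀ t ∈ Ioc (0 : ℝ) 1, |g t| ≤ C * t) :
    Tendsto g (𝓝[>] 0) (𝓝 0) := by
  have h1 : Tendsto (fun t : ℝ => C * t) (𝓝[>] 0) (𝓝 0) := by
    have : Tendsto (fun t : ℝ => C * t) (𝓝 0) (𝓝 (C * 0)) := tendsto_id.const_mul C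
    rw [mul_zero] at this
    exact this.mono_left nhdsWithin_le_nhds
  refine squeeze_zero_norm' ?_ h1
  filter_upwards [Ioc_mem_nhdsGT one_pos] with t ht using h t ht

namespace ScalarSol
variable {q k M C : ℝ} {x x₁ : ℝ → ℝ}

/-- The flux `t ^ m * x₁` is constant, and its limit at the origin is 0. -/
lemma deriv_eq_zero_of_radial {m : ℕ} (h : ScalarSol q m 0 (Ioi 0) x x₁)
    (hC : ∀ t ∈ Ioc (0 : ℝ) 1, |x₁ t| ≤ C * t) : ∀ t ∈ Ioi (0 : ℝ), x₁ t = 0 := by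
  have hd : ∀ t ∈ Ioi (0 : ℝ), HasDerivAt (fun t => t ^ m * x₁ t) 0 t := fun t ht => by
    have := hasDerivAt_pow_mul (m := m) (ne_of_gt ht) (h.deriv₁ t ht)
    simpa using this
  have hc := const_of_deriv_eq_zero (convex_Ioi (0 : ℝ)) hd fun _ _ => rfl
  have hlim : Tendsto (fun t => t ^ m * x₁ t) (𝓝[>] 0) (𝓝 0) := by
    refine tendsto_zero_of_abs_le (C := C) fun t ht => ?_
    rw [abs_mul, abs_of_pos (pow_pos ht.1 m)]
    exact (mul_le_of_le_one_left (abs_nonneg _) (pow_le_one₀ ht.1.le ht.2)).trans (hC t ht)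
  intro t ht
  have h1 : Tendsto (fun t => t ^ m * x₁ t) (𝓝[>] 0) (𝓝 (t ^ m * x₁ t)) :=
    tendsto_const_nhds.congr' (by
      filter_upwards [self_mem_nhdsWithin] with s hs using hc t ht s hs)
  exact (mul_eq_zero.1 (tendsto_nhds_unique h1 hlim)).resolve_left (pow_pos ht m).ne'

/-- The flux of `x²` starts at 0 and is nondecreasing, so `x²` is nondecreasing. Once positive, it
has a source bounded below, and this contradicts boundedness. -/
lemma eq_zero_of_radial {m : ℕ} (hq : -1 < q) (hk : 0 < k) (h : ScalarSol q m k (Ioi 0) x x₁)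
    (hM : ∀ t ∈ Ioi (0 : ℝ), |x t| ≤ M)
    (hC : ∀ t ∈ Ioc (0 : ℝ) 1, |x₁ t| ≤ C * t) : ∀ t ∈ Ioi (0 : ℝ), x t = 0 := by
  have hsq : ∀ t ∈ Ioi (0 : ℝ), HasDerivAt (fun t => x t ^ 2) (2 * (x t * x₁ t)) t :=
    fun t ht => ((h.deriv t ht).pow 2).congr_deriv (by norm_num; ring)
  have hr : ∀ t ∈ Ioi (0 : ℝ), HasDerivAt (fun t => 2 * (x t * x₁ t))
      (-(m / t * (2 * (x t * x₁ t))) +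
        2 * (x₁ t ^ 2 + k * |x t| ^ (2 * q + 2) * x t ^ 2)) t := fun t ht =>
    (((h.deriv t ht).mul (h.deriv₁ t ht)).const_mul 2).congr_deriv (by ring)
  have hg := fun t (ht : t ∈ Ioi (0 : ℝ)) => hasDerivAt_pow_mul (m := m) (ne_of_gt ht) (hr t ht)
  have hgm := monotoneOn_of_hasDerivAt (convex_Ioi (0 : ℝ)) hg (fun t ht => by
    have := pow_pos (mem_Ioi.1 ht) m
    positivity)
  have hlim : Tendsto (fun t => t ^ m * (2 * (x t * x₁ t))) (𝓝[>] 0) (𝓝 0) := by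
    refine tendsto_zero_of_abs_le (C := 2 * (M * C)) fun t ht => ?_
    rw [abs_mul, abs_of_pos (pow_pos ht.1 m)]
    refine (mul_le_of_le_one_left (abs_nonneg _) (pow_le_one₀ ht.1.le ht.2)).trans ?_
    rw [abs_mul, abs_mul, abs_of_pos two_pos]
    have := mul_le_mul (hM t ht.1) (hC t ht) (abs_nonneg _) ((abs_nonneg _).trans (hM t ht.1))
    linarith
  have hnn : ∀ t ∈ Ioi (0 : ℝ), 0 ≤ 2 * (x t * x₁ t) := by
    intro t ht
    have : 0 ≤ t ^ m * (2 * (x t * x₁ t)) := by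
      refine le_of_tendsto hlim ?_
      filter_upwards [Ioc_mem_nhdsGT (mem_Ioi.1 ht)] with s hs using hgm hs.1 ht hs.2
    exact nonneg_of_mul_nonneg_right this (pow_pos ht m)
  have hmono := monotoneOn_of_hasDerivAt (convex_Ioi (0 : ℝ)) hsq hnn
  by_contra hne
  push Not at hne
  obtain ⟨t₀, ht₀, hx₀⟩ := hne
  have ht0 : 0 < t₀ := ht₀
  have hM0 : 0 ≤ M := (abs_nonneg _).trans (hM t₀ ht₀)
  have hxM : ∀ t ∈ Ioi (0 : ℝ), x t ^ 2 ≤ M ^ 2 := fun t ht => sq_le_sq' (by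
    have := neg_le_of_abs_le (hM t ht); linarith) ((le_abs_self _).trans (hM t ht))
  set K := 2 * (k * |x t₀| ^ (2 * q + 2) * x t₀ ^ 2) with hK
  have hK0 : 0 < K := by positivity
  have hrK : ∀ t ∈ Ici t₀, K ≤ 2 * (x₁ t ^ 2 + k * |x t| ^ (2 * q + 2) * x t ^ 2) := by
    intro t ht
    have h1 : x t₀ ^ 2 ≤ x t ^ 2 := hmono ht₀ (ht0.trans_le ht) ht
    have h2 : |x t₀| ^ (2 * q + 2) ≤ |x t| ^ (2 * q + 2) :=
      Real.rpow_le_rpow (abs_nonneg _) (sq_le_sq.1 h1) (by linarith)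
    have h3 : k * |x t₀| ^ (2 * q + 2) * x t₀ ^ 2 ≤ k * |x t| ^ (2 * q + 2) * x t ^ 2 :=
      mul_le_mul (mul_le_mul_of_nonneg_left h2 hk.le) h1 (sq_nonneg _) (by positivity)
    have := sq_nonneg (x₁ t)
    linarith
  -- Adding `m x² / t` removes the friction from the derivative of `2 x x₁`. The leftover `m x² /
  -- t²` is eventually below half of the source `K`.
  have hF : ∀ t ∈ Ioi (0 : ℝ), HasDerivAt (fun t => 2 * (x t * x₁ t) + m * (t⁻¹ * x t ^ 2))
      (2 * (x₁ t ^ 2 + k * |x t| ^ (2 * q + 2) * x t ^ 2) - m * x t ^ 2 / t ^ 2) t := by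
    intro t ht
    have ht' : t ≠ 0 := ne_of_gt ht
    refine ((hr t ht).add (((hasDerivAt_inv ht').mul (hsq t ht)).const_mul (m : ℝ))).congr_deriv ?_
    field_simp; ring
  have hlim2 : Tendsto (fun t : ℝ => m * M ^ 2 / t ^ 2) atTop (𝓝 0) :=
    tendsto_const_nhds.div_atTop (tendsto_pow_atTop two_ne_zero)
  obtain ⟨T, hT⟩ := eventually_atTop.1
    ((hlim2.eventually (gt_mem_nhds (half_pos hK0))).and (eventually_ge_atTop (max t₀ 1)))
  have hT1 := (hT T le_rfl).2
  have hpos : ∀ t ∈ Ici T, t ∈ Ioi (0 : ℝ) := fun t ht =>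
    ht0.trans_le ((le_max_left _ _).trans (hT1.trans ht))
  have hgrow : ∀ t ∈ Ici T, 2 * (x T * x₁ T) + m * (T⁻¹ * x T ^ 2) + K / 2 * (t - T) ≤
      2 * (x t * x₁ t) + m * (t⁻¹ * x t ^ 2) := fun t ht =>
    ge_of_le_deriv (convex_Ici T) (fun s hs => hF s (hpos s hs)) (fun s hs => by
      have h1 := hrK s ((le_max_left _ _).trans (hT1.trans hs))
      have h2 := (hT s hs).1
      have h3 : m * x s ^ 2 / s ^ 2 ≤ m * M ^ 2 / s ^ 2 :=
        div_le_div_of_nonneg_right (mul_le_mul_of_nonneg_left (hxM s (hpos s hs))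
          (Nat.cast_nonneg m)) (sq_nonneg _)
      linarith) self_mem_Ici ht ht
  set A := 2 * (x T * x₁ T) + m * (T⁻¹ * x T ^ 2)
  -- Past this point the linear growth of the modified slope has made the derivative of `x²` at
  -- least 1.
  set T' := max T (T + (m * M ^ 2 + 1 - A) / (K / 2))
  refine not_nonneg_of_deriv_le_neg (T := T') (k := 1) one_pos
    (f := fun t => M ^ 2 - x t ^ 2) (f' := fun t => -(2 * (x t * x₁ t)))
    (fun t ht => (hsq t (hpos t ((le_max_left T _).trans ht))).const_sub _) (fun t ht => ?_)
    (fun t ht => by linarith [hxM t (hpos t ((le_max_left T _).trans ht))])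
  have htT : t ∈ Ici T := (le_max_left T _).trans ht
  have ht2 : T + (m * M ^ 2 + 1 - A) / (K / 2) ≤ t := (le_max_right T _).trans ht
  have h1 := hgrow t htT
  have h2 : m * M ^ 2 + 1 - A ≤ K / 2 * (t - T) := by
    have := (div_le_iff₀ (half_pos hK0)).1 (show (m * M ^ 2 + 1 - A) / (K / 2) ≤ t - T by linarith)
    linarith
  have h3 : m * (t⁻¹ * x t ^ 2) ≤ m * (1 * M ^ 2) := by
    refine mul_le_mul_of_nonneg_left (mul_le_mul ?_ (hxM t (hpos t htT)) (sq_nonneg _) one_pos.le)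
      (Nat.cast_nonneg m)
    exact inv_le_one_of_one_le₀ ((le_max_right _ _).trans (hT1.trans htT))
  linarith

variable {S : Set ℝ}

/-- A convex function with a positive slope somewhere is unbounded above to the right. -/
lemma deriv_nonpos_of_convex {y y₁ y₂ : ℝ → ℝ} (hS : ∀ s ∈ S, Ici s ⊆ S)
    (hy : ∀ t ∈ S, HasDerivAt y (y₁ t) t) (hy₁ : ∀ t ∈ S, HasDerivAt y₁ (y₂ t) t)
    (h2 : ∀ t ∈ S, 0 ≤ y₂ t) (hM : ∀ t ∈ S, y t ≤ M) : ∀ t ∈ S, y₁ t ≤ 0 := by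
  intro t ht
  by_contra! hlt
  have hm := monotoneOn_of_hasDerivAt (convex_Ici t) (fun s hs => hy₁ s (hS t ht hs))
    (fun s hs => h2 s (hS t ht hs))
  exact not_nonneg_of_deriv_le_neg (T := t) hlt (fun s hs => (hy s (hS t ht hs)).const_sub M)
    (fun s hs => neg_le_neg (hm self_mem_Ici hs hs))
    (fun s hs => by linarith [hM s (hS t ht hs)])

/-- Bounded solutions on a line, or on a half-line with zero boundary value, vanish. -/
lemma eq_zero_of_line (hk : 0 < k) (h : ScalarSol q 0 k S x x₁)
    (hS : S = univ ∨ ∃ b, S = Ioi b ∧ Tendsto x (𝓝[>] b) (𝓝 0))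
    (hM : ∀ t ∈ S, |x t| ≤ M) : ∀ t ∈ S, x t = 0 := by
  have hxM : ∀ t ∈ S, x t ^ 2 ≤ M ^ 2 := fun t ht => sq_le_sq' (by
    have := neg_le_of_abs_le (hM t ht); linarith) ((le_abs_self _).trans (hM t ht))
  have hsq : ∀ t ∈ S, HasDerivAt (fun t => x t ^ 2) (2 * (x t * x₁ t)) t :=
    fun t ht => ((h.deriv t ht).pow 2).congr_deriv (by norm_num; ring)
  have hr : ∀ t ∈ S, HasDerivAt (fun t => 2 * (x t * x₁ t))
      (2 * (x₁ t ^ 2 + k * |x t| ^ (2 * q + 2) * x t ^ 2)) t := fun t ht =>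
    (((h.deriv t ht).mul (h.deriv₁ t ht)).const_mul 2).congr_deriv (by ring)
  have hr0 : ∀ t ∈ S, 0 ≤ 2 * (x₁ t ^ 2 + k * |x t| ^ (2 * q + 2) * x t ^ 2) :=
    fun t _ => by positivity
  have hSu : ∀ s ∈ S, Ici s ⊆ S := by
    rcases hS with rfl | ⟨b, rfl, -⟩
    · exact fun _ _ => subset_univ _
    · exact fun s hs => Ici_subset_Ioi.2 hs
  have hle := deriv_nonpos_of_convex hSu hsq hr hr0 hxM
  rcases hS with rfl | ⟨b, rfl, hb⟩
  -- On the whole line, reflection gives the opposite inequality, so `x²` has zero slope everywhere;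
  -- its second derivative then vanishes too, and with it `x`.
  · have hge := deriv_nonpos_of_convex (S := univ) (y := fun t => x (-t) ^ 2)
      (y₁ := fun t => -(2 * (x (-t) * x₁ (-t))))
      (y₂ := fun t => 2 * (x₁ (-t) ^ 2 + k * |x (-t)| ^ (2 * q + 2) * x (-t) ^ 2))
      (fun _ _ => subset_univ _) (fun t _ => hasDerivAt_comp_neg (hsq (-t) trivial))
      (fun t _ => (hasDerivAt_comp_neg (hr (-t) trivial)).neg.congr_deriv (neg_neg _))
      (fun t _ => hr0 (-t) trivial) (fun t _ => hxM (-t) trivial)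
    have h0 : ∀ t, 2 * (x t * x₁ t) = 0 := fun t => by
      have h1 := hge (-t) trivial
      simp only [neg_neg] at h1
      linarith [hle t trivial]
    intro t _
    have h1 : HasDerivAt (fun t => 2 * (x t * x₁ t)) 0 t := by
      rw [show (fun t => 2 * (x t * x₁ t)) = fun _ => (0 : ℝ) from funext h0]
      exact hasDerivAt_const _ _
    have h2 := (hr t trivial).unique h1
    by_contra hne
    have : 0 < k * |x t| ^ (2 * q + 2) * x t ^ 2 := by positivity
    nlinarith [sq_nonneg (x₁ t)]
  -- On a half-line, `x²` is nonincreasing and starts from the boundary limit 0.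
  · have hanti := antitoneOn_of_hasDerivAt (convex_Ioi b) hsq hle
    intro t ht
    have h1 : Tendsto (fun t => x t ^ 2) (𝓝[>] b) (𝓝 (0 ^ 2)) := hb.pow 2
    have h2 : x t ^ 2 ≤ 0 ^ 2 := by
      refine ge_of_tendsto h1 ?_
      filter_upwards [Ioc_mem_nhdsGT (mem_Ioi.1 ht)] with s hs using hanti hs.1 ht hs.2
    nlinarith

/-- For zero coefficient both `x` and `-x` are convex and bounded above. -/
lemma deriv_eq_zero_of_line (h : ScalarSol q 0 0 S x x₁) (hS : ∀ s ∈ S, Ici s ⊆ S)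
    (hM : ∀ t ∈ S, |x t| ≤ M) : ∀ t ∈ S, x₁ t = 0 := by
  intro t ht
  refine le_antisymm ?_ ?_
  · exact deriv_nonpos_of_convex hS h.deriv h.deriv₁ (fun t _ => by simp)
      (fun t ht => (le_abs_self _).trans (hM t ht)) t ht
  · have := deriv_nonpos_of_convex (y := fun t => -x t) (y₁ := fun t => -x₁ t) hS
      (fun t ht => (h.deriv t ht).neg) (fun t ht => (h.deriv₁ t ht).neg) (fun t _ => by simp)
      (fun t ht => (neg_le_abs _).trans (hM t ht)) t ht
    linarith

end ScalarSol

/-! ### Compactness along an ultrafilter -/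

section Limits

/-- A uniform derivative bound gives equicontinuity near `τ`. Convergence at `τ` alone therefore
upgrades to convergence along the product filter, which plays the role of locally uniform
convergence. -/
lemma tendsto_prod_of_deriv_bound {𝒰 : Filter ℕ} {f f' : ℕ → ℝ → ℝ} {τ c L : ℝ}
    (hd : ∀ᶠ z in 𝒰 ×ˢ 𝓝 τ, HasDerivAt (f z.1) (f' z.1 z.2) z.2 ∧ |f' z.1 z.2| ≤ L)
    (hl : Tendsto (fun k => f k τ) 𝒰 (𝓝 c)) :
    Tendsto (fun z : ℕ × ℝ => f z.1 z.2) (𝒰 ×ˢ 𝓝 τ) (𝓝 c) := by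
  obtain ⟨pa, ha, pb, hb, hab⟩ := eventually_prod_iff.1 hd
  obtain ⟨ε, hε, hball⟩ := Metric.eventually_nhds_iff_ball.1 hb
  have h1 : Tendsto (fun z : ℕ × ℝ => f z.1 z.2 - f z.1 τ) (𝒰 ×ˢ 𝓝 τ) (𝓝 0) := by
    have h2 : Tendsto (fun z : ℕ × ℝ => L * |z.2 - τ|) (𝒰 ×ˢ 𝓝 τ) (𝓝 (L * |τ - τ|)) :=
      (((tendsto_snd (f := 𝒰) (g := 𝓝 τ)).sub_const τ).abs).const_mul L
    rw [sub_self, abs_zero, mul_zero] at h2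
    refine squeeze_zero_norm' ?_ h2
    filter_upwards [ha.prod_mk (Metric.ball_mem_nhds τ hε)] with z hz
    exact (convex_ball τ ε).norm_image_sub_le_of_norm_hasDerivWithin_le
      (fun s hs => (hab hz.1 (hball s hs)).1.hasDerivWithinAt)
      (fun s hs => (hab hz.1 (hball s hs)).2) (Metric.mem_ball_self hε) hz.2
  have h3 : Tendsto (fun z : ℕ × ℝ => f z.1 τ) (𝒰 ×ˢ 𝓝 τ) (𝓝 c) := hl.comp tendsto_fst
  simpa using h1.add h3

lemma hasDerivAt_of_tendsto_prod {𝒰 : Filter ℕ} [𝒰.NeBot] {f f' : ℕ → ℝ → ℝ} {g : ℝ → ℝ}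
    {τ c : ℝ}
    (hd : ∀ᶠ z in 𝒰 ×ˢ 𝓝 τ, HasDerivAt (f z.1) (f' z.1 z.2) z.2)
    (hl : ∀ᶠ s in 𝓝 τ, Tendsto (fun k => f k s) 𝒰 (𝓝 (g s)))
    (hf' : Tendsto (fun z : ℕ × ℝ => f' z.1 z.2) (𝒰 ×ˢ 𝓝 τ) (𝓝 c)) : HasDerivAt g c τ := by
  refine hasDerivAt_of_tendstoUniformlyOnFilter (l := 𝒰) (f := f) (f' := f') (g' := fun _ => c)
    ?_ hd hl
  rw [tendstoUniformlyOnFilter_iff_tendsto]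
  rw [Metric.uniformity_eq_comap_nhds_zero, tendsto_comap_iff]
  have := (hf'.dist tendsto_const_nhds (b := c))
  simpa [Function.comp_def, dist_comm] using this

lemma exists_tendsto_of_bounded (𝒰 : Ultrafilter ℕ) {f : ℕ → ℝ} {L : ℝ}
    (h : ∀ᶠ k in 𝒰, |f k| ≤ L) : ∃ c, Tendsto f 𝒰 (𝓝 c) ∧ |c| ≤ L := by
  have h1 : (𝒰.map f : Filter ℝ) ≤ 𝓟 (Icc (-L) L) := by
    rw [le_principal_iff]
    exact h.mono fun k hk => abs_le.1 hk
  obtain ⟨c, hc, hc'⟩ := isCompact_Icc.ultrafilter_le_nhds (𝒰.map f) h1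
  exact ⟨c, hc', abs_le.2 hc⟩

lemma tendsto_nl {ι : Type*} {l : Filter ι} {q : ℝ} (hq : -1 < q) {b u v : ι → ℝ} {B U V : ℝ}
    (hb : Tendsto b l (𝓝 B)) (hu : Tendsto u l (𝓝 U)) (hv : Tendsto v l (𝓝 V)) :
    Tendsto (fun z => nl q (b z) (u z) (v z)) l (𝓝 (nl q B U V)) := by
  have h1 := ((continuous_nl hq).tendsto (B, U, V)).comp (hb.prodMk_nhds (hu.prodMk_nhds hv))
  simp only [Function.comp_def] at h1
  exact h1

/-- An Arzelà–Ascoli argument without subsequences: along an ultrafilter every bounded sequence of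
values converges. First derivatives are bounded by hypothesis and second derivatives by the
equation, so all the derivative relations pass to the limit. -/
theorem Sol.exists_limit (𝒰 : Ultrafilter ℕ) {q β₀ : ℝ} (hq : -1 < q) {e : ℕ → ℝ → ℝ}
    {e₀ : ℝ → ℝ}
    {lam γ β : ℕ → ℝ} {S : ℕ → Set ℝ} {I : Set ℝ} (hI : IsOpen I) {x y x₁ y₁ : ℕ → ℝ → ℝ}
    (h : ∀ k, Sol q (e k) (lam k) (γ k) (β k) (S k) (x k) (y k) (x₁ k) (y₁ k))
    (hlam : Tendsto lam 𝒰 (𝓝 0)) (hγ : Tendsto γ 𝒰 (𝓝 0)) (hβ : Tendsto β 𝒰 (𝓝 β₀))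
    (he : ∀ τ ∈ I, Tendsto (fun z : ℕ × ℝ => e z.1 z.2) (𝒰 ×ˢ 𝓝 τ) (𝓝 (e₀ τ)))
    (hb : ∀ τ ∈ I, ∃ L, ∀ᶠ z in (𝒰 : Filter ℕ) ×ˢ 𝓝 τ, z.2 ∈ S z.1 ∧ |x z.1 z.2| ≤ L ∧
      |y z.1 z.2| ≤ L ∧ |x₁ z.1 z.2| ≤ L ∧ |y₁ z.1 z.2| ≤ L) :
    ∃ X Y X₁ Y₁ : ℝ → ℝ, Sol q e₀ 0 0 β₀ I X Y X₁ Y₁ ∧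
      ∀ τ ∈ I, Tendsto (fun z : ℕ × ℝ => x z.1 z.2) (𝒰 ×ˢ 𝓝 τ) (𝓝 (X τ)) ∧
        Tendsto (fun z : ℕ × ℝ => y z.1 z.2) (𝒰 ×ˢ 𝓝 τ) (𝓝 (Y τ)) ∧
        Tendsto (fun z : ℕ × ℝ => x₁ z.1 z.2) (𝒰 ×ˢ 𝓝 τ) (𝓝 (X₁ τ)) ∧
        Tendsto (fun z : ℕ × ℝ => y₁ z.1 z.2) (𝒰 ×ˢ 𝓝 τ) (𝓝 (Y₁ τ)) := by
  have hIe : ∀ τ ∈ I, ∀ᶠ s in 𝓝 τ, s ∈ I := fun τ hτ => hI.mem_nhds hτ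
  have hpt : ∀ τ, ∃ X Y X₁ Y₁ : ℝ, τ ∈ I → Tendsto (fun k => x k τ) 𝒰 (𝓝 X) ∧
      Tendsto (fun k => y k τ) 𝒰 (𝓝 Y) ∧ Tendsto (fun k => x₁ k τ) 𝒰 (𝓝 X₁) ∧
      Tendsto (fun k => y₁ k τ) 𝒰 (𝓝 Y₁) := by
    intro τ
    by_cases hτ : τ ∈ I
    · obtain ⟨L, hL⟩ := hb τ hτ
      have hL' := (hL.curry).mono fun k hk => hk.self_of_nhds
      obtain ⟨X, hX, -⟩ := exists_tendsto_of_bounded 𝒰 (hL'.mono fun k hk => hk.2.1)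
      obtain ⟨Y, hY, -⟩ := exists_tendsto_of_bounded 𝒰 (hL'.mono fun k hk => hk.2.2.1)
      obtain ⟨X₁, hX₁, -⟩ := exists_tendsto_of_bounded 𝒰 (hL'.mono fun k hk => hk.2.2.2.1)
      obtain ⟨Y₁, hY₁, -⟩ := exists_tendsto_of_bounded 𝒰 (hL'.mono fun k hk => hk.2.2.2.2)
      exact ⟨X, Y, X₁, Y₁, fun _ => ⟨hX, hY, hX₁, hY₁⟩⟩
    · exact ⟨0, 0, 0, 0, fun h => absurd h hτ⟩
  choose X Y X₁ Y₁ hlim using hpt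
  have hlimx : ∀ τ ∈ I, Tendsto (fun z : ℕ × ℝ => x z.1 z.2) (𝒰 ×ˢ 𝓝 τ) (𝓝 (X τ)) := by
    intro τ hτ
    obtain ⟨L, hL⟩ := hb τ hτ
    exact tendsto_prod_of_deriv_bound
      (hL.mono fun z hz => ⟨(h z.1).fst z.2 hz.1, hz.2.2.2.1⟩) (hlim τ hτ).1
  have hlimy : ∀ τ ∈ I, Tendsto (fun z : ℕ × ℝ => y z.1 z.2) (𝒰 ×ˢ 𝓝 τ) (𝓝 (Y τ)) := by
    intro τ hτ
    obtain ⟨L, hL⟩ := hb τ hτ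
    exact tendsto_prod_of_deriv_bound
      (hL.mono fun z hz => ⟨(h z.1).snd z.2 hz.1, hz.2.2.2.2⟩) (hlim τ hτ).2.1
  have hbd : ∀ {u : ℕ × ℝ → ℝ} {τ U : ℝ}, Tendsto u (𝒰 ×ˢ 𝓝 τ) (𝓝 U) →
      ∀ᶠ z in (𝒰 : Filter ℕ) ×ˢ 𝓝 τ, |u z| ≤ |U| + 1 := fun hu =>
    (hu.abs.eventually (gt_mem_nhds (lt_add_one _))).mono fun z hz => le_of_lt hz
  have h2 : ∀ {u v u₁ : ℕ → ℝ → ℝ} {τ U V U₁ : ℝ} {g : ℝ → ℝ}, τ ∈ I →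
      Tendsto (fun z : ℕ × ℝ => u z.1 z.2) (𝒰 ×ˢ 𝓝 τ) (𝓝 U) →
      Tendsto (fun z : ℕ × ℝ => v z.1 z.2) (𝒰 ×ˢ 𝓝 τ) (𝓝 V) →
      (∃ L, ∀ᶠ z in (𝒰 : Filter ℕ) ×ˢ 𝓝 τ, |u₁ z.1 z.2| ≤ L) →
      (∀ᶠ z in (𝒰 : Filter ℕ) ×ˢ 𝓝 τ, HasDerivAt (u₁ z.1) (-(e z.1 z.2 * u₁ z.1 z.2) +
        lam z.1 * u z.1 z.2 + γ z.1 * v z.1 z.2 - nl q (β z.1) (u z.1 z.2) (v z.1 z.2)) z.2) →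
      Tendsto (fun k => u₁ k τ) 𝒰 (𝓝 U₁) →
      (∀ᶠ s in 𝓝 τ, Tendsto (fun k => u₁ k s) 𝒰 (𝓝 (g s))) →
      Tendsto (fun z : ℕ × ℝ => u₁ z.1 z.2) (𝒰 ×ˢ 𝓝 τ) (𝓝 U₁) ∧
      HasDerivAt g (-(e₀ τ * U₁) + 0 * U + 0 * V - nl q β₀ U V) τ := by
    rintro u v u₁ τ U V U₁ g hτ hu hv ⟨L, hL⟩ hd hu₁ hg
    have hlam' : Tendsto (fun z : ℕ × ℝ => lam z.1) (𝒰 ×ˢ 𝓝 τ) (𝓝 0) := hlam.comp tendsto_fst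
    have hγ' : Tendsto (fun z : ℕ × ℝ => γ z.1) (𝒰 ×ˢ 𝓝 τ) (𝓝 0) := hγ.comp tendsto_fst
    have hrest := ((hlam'.mul hu).add (hγ'.mul hv)).sub (tendsto_nl hq (hβ.comp tendsto_fst) hu hv)
    have hp : Tendsto (fun z : ℕ × ℝ => u₁ z.1 z.2) (𝒰 ×ˢ 𝓝 τ) (𝓝 U₁) := by
      refine tendsto_prod_of_deriv_bound
        (f' := fun k s => -(e k s * u₁ k s) + lam k * u k s + γ k * v k s -
          nl q (β k) (u k s) (v k s)) (L := (|e₀ τ| + 1) * L + (|0 * U + 0 * V - nl q β₀ U V| + 1))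
        ?_ hu₁
      filter_upwards [hd, hL, hbd (he τ hτ), hbd hrest] with z h1 h2 h3 h4
      refine ⟨h1, ?_⟩
      have h5 : -(e z.1 z.2 * u₁ z.1 z.2) + lam z.1 * u z.1 z.2 + γ z.1 * v z.1 z.2 -
          nl q (β z.1) (u z.1 z.2) (v z.1 z.2) = -(e z.1 z.2 * u₁ z.1 z.2) +
          (lam z.1 * u z.1 z.2 + γ z.1 * v z.1 z.2 -
          nl q (β z.1) (u z.1 z.2) (v z.1 z.2)) := by ring
      rw [h5]
      refine (abs_add_le _ _).trans (add_le_add ?_ h4)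
      rw [abs_neg, abs_mul]
      exact mul_le_mul h3 h2 (abs_nonneg _) ((abs_nonneg _).trans h3)
    refine ⟨hp, hasDerivAt_of_tendsto_prod
      (f' := fun k s => -(e k s * u₁ k s) + lam k * u k s + γ k * v k s -
          nl q (β k) (u k s) (v k s)) hd hg ?_⟩
    exact ((((he τ hτ).mul hp).neg.add (hlam'.mul hu)).add (hγ'.mul hv)).sub (tendsto_nl hq (hβ.comp tendsto_fst) hu hv)
  have hx₁ : ∀ τ ∈ I, _ := fun τ hτ => h2 (u := x) (v := y) (u₁ := x₁) (U₁ := X₁ τ) (g := X₁) hτ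
    (hlimx τ hτ) (hlimy τ hτ) ((hb τ hτ).imp fun L hL => hL.mono fun z hz => hz.2.2.2.1)
    ((hb τ hτ).choose_spec.mono fun z hz => (h z.1).fst₁ z.2 hz.1) (hlim τ hτ).2.2.1
    ((hIe τ hτ).mono fun s hs => (hlim s hs).2.2.1)
  have hy₁ : ∀ τ ∈ I, _ := fun τ hτ => h2 (u := y) (v := x) (u₁ := y₁) (U₁ := Y₁ τ) (g := Y₁) hτ
    (hlimy τ hτ) (hlimx τ hτ) ((hb τ hτ).imp fun L hL => hL.mono fun z hz => hz.2.2.2.2)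
    ((hb τ hτ).choose_spec.mono fun z hz => (h z.1).snd₁ z.2 hz.1) (hlim τ hτ).2.2.2
    ((hIe τ hτ).mono fun s hs => (hlim s hs).2.2.2)
  refine ⟨X, Y, X₁, Y₁, ⟨fun τ hτ => ?_, fun τ hτ => ?_, fun τ hτ => (hx₁ τ hτ).2,
    fun τ hτ => (hy₁ τ hτ).2⟩,
    fun τ hτ => ⟨hlimx τ hτ, hlimy τ hτ, (hx₁ τ hτ).1, (hy₁ τ hτ).1⟩⟩
  · exact hasDerivAt_of_tendsto_prod
      ((hb τ hτ).choose_spec.mono fun z hz => (h z.1).fst z.2 hz.1)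
      ((hIe τ hτ).mono fun s hs => (hlim s hs).1) (hx₁ τ hτ).1
  · exact hasDerivAt_of_tendsto_prod
      ((hb τ hτ).choose_spec.mono fun z hz => (h z.1).snd z.2 hz.1)
      ((hIe τ hτ).mono fun s hs => (hlim s hs).2.1) (hy₁ τ hτ).1

end Limits

/-! ### Counting sign changes and passing them to the limit -/

/-- `f` changes sign at least `N` times on `D`. -/
def HasAlternation (N : ℕ) (D : Set ℝ) (f : ℝ → ℝ) : Prop :=
  ∃ t : ℕ → ℝ, (∀ i < N, t i < t (i + 1)) ∧ (∀ i ≤ N, t i ∈ D) ∧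
    ∀ i < N, f (t i) * f (t (i + 1)) < 0

lemma not_hasAlternation {J : Set ℝ} {f : ℝ → ℝ} {C : ℝ≥0} {N : ℕ}
    (h : (zeroNumber J f : ℝ≥0∞) ≤ C) (hN : (C : ℝ) < N) : ¬ HasAlternation N J f := by
  rintro ⟨t, h1, h2, h3⟩
  have h4 : (N : ℕ∞) ≤ zeroNumber J f := by
    refine le_iSup₂_of_le (f := fun (j : ℕ) (_ : ∃ x : Fin (j + 1) → ℝ, StrictMono x ∧
      (∀ i, x i ∈ J) ∧ ∀ i : Fin j, f (x i.castSucc) * f (x i.succ) < 0) => (j : ℕ∞)) N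
      ⟨fun i => t i, ?_, fun i => h2 i (Nat.lt_succ_iff.1 i.2), fun i => ?_⟩ le_rfl
    · exact Fin.strictMono_iff_lt_succ.2 fun i => by simpa using h1 i i.2
    · simpa using h3 i i.2
  have h5 : ((N : ℕ∞) : ℝ≥0∞) ≤ C := (ENat.toENNReal_le.2 h4).trans h
  rw [ENat.toENNReal_coe] at h5
  have h6 : (N : ℝ≥0) ≤ C := by exact_mod_cast h5
  have h7 : ((N : ℝ≥0) : ℝ) ≤ C := NNReal.coe_le_coe.2 h6
  push_cast at h7
  linarith

lemma HasAlternation.of_affine {N : ℕ} {D : Set ℝ} {f : ℝ → ℝ} {ρ ℓ : ℝ} (hℓ : ℓ ≠ 0)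
    (h : HasAlternation N {τ | ρ + ℓ * τ ∈ D} fun τ => f (ρ + ℓ * τ)) :
    HasAlternation N D f := by
  obtain ⟨t, h1, h2, h3⟩ := h
  rcases lt_or_gt_of_ne hℓ with hℓ | hℓ
  -- A negative dilation reverses the order of the points, so they are listed backwards.
  · refine ⟨fun i => ρ + ℓ * t (N - i), fun i hi => ?_, fun i _ => h2 _ (Nat.sub_le _ _),
      fun i hi => ?_⟩
    · have := h1 (N - (i + 1)) (by omega)
      rw [show N - (i + 1) + 1 = N - i by omega] at this
      simp only
      nlinarith
    · have := h3 (N - (i + 1)) (by omega)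
      rw [show N - (i + 1) + 1 = N - i by omega] at this
      rw [mul_comm]; exact this
  · exact ⟨fun i => ρ + ℓ * t i, fun i hi => by have := h1 i hi; simp only; nlinarith,
      fun i hi => h2 i hi, fun i hi => h3 i hi⟩

lemma HasAlternation.of_neg {N : ℕ} {D : Set ℝ} {f : ℝ → ℝ}
    (h : HasAlternation N D fun t => -f t) : HasAlternation N D f := by
  obtain ⟨t, h1, h2, h3⟩ := h
  exact ⟨t, h1, h2, fun i hi => by simpa using h3 i hi⟩

lemma hasAlternation_of_sign {N : ℕ} {D : Set ℝ} {f : ℝ → ℝ} (t : ℕ → ℝ)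
    (h1 : ∀ i < N, t i < t (i + 1)) (h2 : ∀ i ≤ N, t i ∈ D)
    (h3 : ∀ i ≤ N, 0 < (-1) ^ i * f (t i)) : HasAlternation N D f := by
  refine ⟨t, h1, h2, fun i hi => ?_⟩
  have a := h3 i hi.le
  have b := h3 (i + 1) hi
  rw [pow_succ] at b
  rcases neg_one_pow_eq_or ℝ i with h | h <;> rw [h] at a b <;> nlinarith

lemma exists_alternation_of_not_signed {X : ℝ → ℝ} {I : Set ℝ} (hI : ∀ᶠ t in atTop, t ∈ I)
    (h : ¬ EventuallySigned X) (N : ℕ) : HasAlternation N I X := by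
  rw [EventuallySigned, not_or, not_eventually, not_eventually] at h
  have hf : ∀ (n : ℕ) (a : ℝ), ∃ b, a < b ∧ b ∈ I ∧ 0 < (-1) ^ n * X b := by
    intro n a
    rcases neg_one_pow_eq_or ℝ n with hn | hn
    · obtain ⟨b, hb, hb1, hb2⟩ := (h.2.and_eventually (hI.and (eventually_gt_atTop a))).exists
      exact ⟨b, hb2, hb1, by rw [hn]; linarith⟩
    · obtain ⟨b, hb, hb1, hb2⟩ := (h.1.and_eventually (hI.and (eventually_gt_atTop a))).exists
      exact ⟨b, hb2, hb1, by rw [hn]; linarith⟩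
  choose g hg1 hg2 hg3 using hf
  -- Each point is chosen beyond the previous one, with sign `(-1) ^ n`; the starting bound 0 is
  -- arbitrary.
  let t : ℕ → ℝ := fun n => Nat.rec (g 0 0) (fun n a => g (n + 1) a) n
  have ht : ∀ n, ∃ a, t n = g n a := fun n => by
    cases n with
    | zero => exact ⟨0, rfl⟩
    | succ n => exact ⟨t n, rfl⟩
  refine hasAlternation_of_sign t (fun i _ => hg1 (i + 1) (t i)) (fun i _ => ?_) (fun i _ => ?_)
  · obtain ⟨a, ha⟩ := ht i; rw [ha]; exact hg2 i a
  · obtain ⟨a, ha⟩ := ht i; rw [ha]; exact hg3 i a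

/-- An unsigned limit has `N` alternations, which are finitely many strict inequalities at finitely
many points. Such inequalities already hold for some `f k`. -/
lemma eventuallySigned_of_tendsto {𝒰 : Filter ℕ} [𝒰.NeBot] {X : ℝ → ℝ} {I : Set ℝ}
    {f : ℕ → ℝ → ℝ} {S : ℕ → Set ℝ} {N : ℕ} (hI : ∀ᶠ t in atTop, t ∈ I)
    (hS : ∀ τ ∈ I, ∀ᶠ k in 𝒰, τ ∈ S k) (hf : ∀ τ ∈ I, Tendsto (fun k => f k τ) 𝒰 (𝓝 (X τ)))
    (hN : ∀ k, ¬ HasAlternation N (S k) (f k)) : EventuallySigned X := by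
  by_contra h
  obtain ⟨t, h1, h2, h3⟩ := exists_alternation_of_not_signed hI h N
  have e1 : ∀ᶠ k in 𝒰, ∀ i ∈ Finset.range (N + 1), t i ∈ S k :=
    (Filter.eventually_all_finset _).2 fun i hi =>
      hS _ (h2 i (Nat.lt_succ_iff.1 (Finset.mem_range.1 hi)))
  have e2 : ∀ᶠ k in 𝒰, ∀ i ∈ Finset.range N, f k (t i) * f k (t (i + 1)) < 0 :=
    (Filter.eventually_all_finset _).2 fun i hi => by
      have hi' := Finset.mem_range.1 hi
      exact ((hf _ (h2 i hi'.le)).mul (hf _ (h2 (i + 1) hi'))).eventually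
        (gt_mem_nhds (h3 i hi'))
  obtain ⟨k, hk1, hk2⟩ := (e1.and e2).exists
  exact hN k ⟨t, h1, fun i hi => hk1 i (Finset.mem_range.2 (Nat.lt_succ_iff.2 hi)),
    fun i hi => hk2 i (Finset.mem_range.2 hi)⟩

/-! ### Oscillation around a constant limit, the case `β₀ = -1` -/

/-- A Sturm-type oscillation estimate via the Riccati equation. -/
lemma not_pos_of_oscillation {d d₁ d₂ e : ℝ → ℝ} {a b c E κ : ℝ} (hc : 0 < c) (hcκ : 2 * c ≤ κ)
    (hc1 : 2 * c ≤ 1) (hE : E ^ 2 ≤ κ) (hab : Real.pi / c ≤ b - a)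
    (hd : ∀ t ∈ Icc a b, HasDerivAt d (d₁ t) t) (hd₁ : ∀ t ∈ Icc a b, HasDerivAt d₁ (d₂ t) t)
    (he : ∀ t ∈ Icc a b, |e t| ≤ E) (h : ∀ t ∈ Icc a b, d₂ t ≤ -(e t * d₁ t) - κ * d t)
    (hpos : ∀ t ∈ Icc a b, 0 < d t) : False := by
  have hab' : a ≤ b := by have := div_pos Real.pi_pos hc; linarith
  -- The angle `arctan (d₁ / d)` decreases at rate at least `c`, yet its values lie in an open
  -- interval of length `π`.
  have hder : ∀ t ∈ Icc a b, HasDerivAt (fun t => Real.arctan (d₁ t / d t))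
      (1 / (1 + (d₁ t / d t) ^ 2) * ((d₂ t * d t - d₁ t * d₁ t) / d t ^ 2)) t :=
    fun t ht => ((hd₁ t ht).div (hd t ht) (hpos t ht).ne').arctan
  have hle := le_of_deriv_le (k := -c) (convex_Icc a b) hder (fun t ht => ?_)
    (left_mem_Icc.2 hab') (right_mem_Icc.2 hab') hab'
  · have h1 := Real.arctan_lt_pi_div_two (d₁ a / d a)
    have h2 := Real.neg_pi_div_two_lt_arctan (d₁ b / d b)
    rw [div_le_iff₀ hc] at hab
    linarith
  · have hdt := hpos t ht
    set r := d₁ t / d t with hr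
    have h1 : d₁ t = r * d t := by rw [hr]; field_simp
    have h2 : (d₂ t * d t - d₁ t * d₁ t) / d t ^ 2 ≤ -(e t * r) - κ - r ^ 2 := by
      rw [div_le_iff₀ (by positivity), h1]
      have := mul_le_mul_of_nonneg_right (h t ht) hdt.le
      rw [h1] at this
      nlinarith
    -- Young's inequality absorbs the friction into half of `κ + r²`; the other half dominates `c (1
    -- + r²)`.
    have h3 : -(e t * r) ≤ (κ + r ^ 2) / 2 := by
      have : e t ^ 2 ≤ E ^ 2 := sq_le_sq' (by have := neg_le_of_abs_le (he t ht); linarith)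
        ((le_abs_self _).trans (he t ht))
      nlinarith [sq_nonneg (e t + r)]
    rw [one_div, inv_mul_le_iff₀ (by positivity)]
    nlinarith [sq_nonneg r]

namespace Sol
variable {q lam γ β : ℝ} {e : ℝ → ℝ} {S : Set ℝ} {x y x₁ y₁ : ℝ → ℝ}

/-- If `x ≥ y` throughout, unique continuation makes `x - y` positive inside, where `nl_sub_ge`
supplies a potential of size `r ^ (2q+2)`. Half of it absorbs the linear term, and the rest
contradicts the Sturm estimate. -/
lemma exists_lt (hq : -1 < q) (hβ : β ≤ 0) (h : Sol q e lam γ β S x y x₁ y₁) [S.OrdConnected]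
    (he : ContinuousOn e S) (hne : ¬ ∀ t ∈ S, x t = y t) {a b r c E : ℝ} (hr : 0 < r)
    (hc : 0 < c) (hcκ : 4 * c ≤ r ^ (2 * q + 2)) (hc1 : 2 * c ≤ 1)
    (hE : 2 * E ^ 2 ≤ r ^ (2 * q + 2)) (hl : 2 * |lam - γ| ≤ r ^ (2 * q + 2))
    (hab : Real.pi / c + 2 ≤ b - a) (hS : Icc a b ⊆ S)
    (hx : ∀ t ∈ Icc a b, r ≤ x t) (hy : ∀ t ∈ Icc a b, r ≤ y t)
    (heE : ∀ t ∈ Icc a b, |e t| ≤ E) : ∃ t ∈ Icc a b, x t < y t := by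
  by_contra! hle
  -- Removing unit margins makes each zero an interior minimum; they account for the `+ 2` in the
  -- length condition.
  have hpos : ∀ t ∈ Icc (a + 1) (b - 1), 0 < x t - y t := by
    intro t ht
    have htab : t ∈ Icc a b := ⟨by linarith [ht.1], by linarith [ht.2]⟩
    refine lt_of_le_of_ne (by linarith [hle t htab]) fun h0 => hne ?_
    have hmin : IsLocalMin (fun t => x t - y t) t := by
      filter_upwards [Ioo_mem_nhds (show a < t by linarith [ht.1])
        (show t < b by linarith [ht.2])] with s hs
      rw [← h0]; linarith [hle s (Ioo_subset_Icc_self hs)]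
    have := hmin.hasDerivAt_eq_zero (h.sub₀ t (hS htab))
    exact h.eq_of_eq_at hq he (hS htab) (by linarith) (by linarith)
  have hsub : ∀ t ∈ Icc (a + 1) (b - 1), t ∈ Icc a b :=
    fun t ht => ⟨by linarith [ht.1], by linarith [ht.2]⟩
  refine not_pos_of_oscillation (e := e) (κ := r ^ (2 * q + 2) / 2) hc (by linarith) hc1
    (by linarith) (by linarith) (fun t ht => h.sub₀ t (hS (hsub t ht)))
    (fun t ht => h.sub₁ t (hS (hsub t ht))) (fun t ht => heE t (hsub t ht)) (fun t ht => ?_) hpos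
  have htab := hsub t ht
  have hd := hpos t ht
  have h1 := nl_sub_ge (x := x t) (y := y t) hq hβ (hr.le.trans (hy t htab)) (by linarith)
  have h2 : r ^ (2 * q + 2) ≤ |x t| ^ (2 * q + 2) :=
    Real.rpow_le_rpow hr.le ((hx t htab).trans (le_abs_self _)) (by linarith)
  have h3 := mul_le_mul_of_nonneg_right h2 hd.le
  have h4 : (lam - γ) * (x t - y t) ≤ r ^ (2 * q + 2) / 2 * (x t - y t) :=
    mul_le_mul_of_nonneg_right (by linarith [le_abs_self (lam - γ)]) hd.le
  linarith

/-- Apply `exists_lt` on `N + 1` consecutive windows, exchanging the roles of the components from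
one window to the next. Windows have length `π / c + 2` and period `π / c + 3`, which keeps them
disjoint. -/
lemma hasAlternation_sub (hq : -1 < q) (hβ : β ≤ 0) (h : Sol q e lam γ β S x y x₁ y₁)
    [S.OrdConnected] (he : ContinuousOn e S) (hne : ¬ ∀ t ∈ S, x t = y t) {a r c E : ℝ}
    (N : ℕ) (hr : 0 < r) (hc : 0 < c) (hcκ : 4 * c ≤ r ^ (2 * q + 2)) (hc1 : 2 * c ≤ 1)
    (hE : 2 * E ^ 2 ≤ r ^ (2 * q + 2)) (hl : 2 * |lam - γ| ≤ r ^ (2 * q + 2))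
    (hS : Icc a (a + (Real.pi / c + 3) * (N + 1)) ⊆ S)
    (hx : ∀ t ∈ Icc a (a + (Real.pi / c + 3) * (N + 1)), r ≤ x t)
    (hy : ∀ t ∈ Icc a (a + (Real.pi / c + 3) * (N + 1)), r ≤ y t)
    (heE : ∀ t ∈ Icc a (a + (Real.pi / c + 3) * (N + 1)), |e t| ≤ E) :
    HasAlternation N S fun t => x t - y t := by
  have hL0 : 0 < Real.pi / c := div_pos Real.pi_pos hc
  set L := Real.pi / c + 3 with hL
  have hsub : ∀ n ≤ N, ∀ t ∈ Icc (a + L * n) (a + L * n + (L - 1)),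
      t ∈ Icc a (a + L * (N + 1)) := by
    intro n hn t ht
    have h1 : (n : ℝ) ≤ N := Nat.cast_le.2 hn
    have h2 : 0 ≤ L * n := mul_nonneg (by linarith) (Nat.cast_nonneg n)
    have h3 : L * n ≤ L * N := mul_le_mul_of_nonneg_left h1 (by linarith)
    exact ⟨by linarith [ht.1], by linarith [ht.2]⟩
  have key : ∀ n : ℕ, ∃ t, n ≤ N → t ∈ Icc (a + L * n) (a + L * n + (L - 1)) ∧
      0 < (-1) ^ n * (x t - y t) := by
    intro n
    by_cases hn : n ≤ N
    · have hs := hsub n hn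
      rcases neg_one_pow_eq_or ℝ n with h1 | h1
      · obtain ⟨t, ht, hlt⟩ := h.swap.exists_lt hq hβ he
          (fun h' => hne fun t ht => (h' t ht).symm) (a := a + L * n)
          (b := a + L * n + (L - 1)) hr hc hcκ hc1 hE hl (by linarith)
          (fun t ht => hS (hs t ht)) (fun t ht => hy t (hs t ht)) (fun t ht => hx t (hs t ht))
          (fun t ht => heE t (hs t ht))
        exact ⟨t, fun _ => ⟨ht, by rw [h1]; linarith⟩⟩
      · obtain ⟨t, ht, hlt⟩ := h.exists_lt hq hβ he hne (a := a + L * n)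
          (b := a + L * n + (L - 1)) hr hc hcκ hc1 hE hl (by linarith)
          (fun t ht => hS (hs t ht)) (fun t ht => hx t (hs t ht)) (fun t ht => hy t (hs t ht))
          (fun t ht => heE t (hs t ht))
        exact ⟨t, fun _ => ⟨ht, by rw [h1]; linarith⟩⟩
    · exact ⟨0, fun h' => absurd h' hn⟩
  choose t ht using key
  refine hasAlternation_of_sign t (fun i hi => ?_) (fun i hi => hS (hsub i hi _ (ht i hi).1))
    (fun i hi => (ht i hi).2)
  have h1 := (ht i hi.le).1.2
  have h2 := (ht (i + 1) hi).1.1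
  push_cast at h2
  linarith

end Sol

lemma eventually_forall_Icc {𝒰 : Filter ℕ} {a b : ℝ} {p : ℕ → ℝ → Prop}
    (h : ∀ τ ∈ Icc a b, ∀ᶠ z in 𝒰 ×ˢ 𝓝 τ, p z.1 z.2) : ∀ᶠ k in 𝒰, ∀ τ ∈ Icc a b, p k τ := by
  have h1 : {z : ℕ × ℝ | p z.1 z.2} ∈ 𝒰 ×ˢ 𝓝ˢ (Icc a b) :=
    isCompact_Icc.mem_prod_nhdsSet_of_forall h
  have h2 : ∀ᶠ z in 𝒰 ×ˢ 𝓝ˢ (Icc a b), p z.1 z.2 := h1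
  exact h2.curry.mono fun k hk τ hτ => (Eventually.self_of_nhdsSet hk) τ hτ

/-- If the components converge to the same nonzero constant, then their difference oscillates. -/
lemma false_of_limit_const {𝒰 : Filter ℕ} [𝒰.NeBot] {q c T : ℝ} (hq : -1 < q) (hc : 0 < c)
    {N : ℕ} {e : ℕ → ℝ → ℝ} {e₀ : ℝ → ℝ}
    {lam γ β : ℕ → ℝ} {S : ℕ → Set ℝ} {x y x₁ y₁ : ℕ → ℝ → ℝ}
    (h : ∀ k, Sol q (e k) (lam k) (γ k) (β k) (S k) (x k) (y k) (x₁ k) (y₁ k))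
    (hSc : ∀ k, (S k).OrdConnected) (hec : ∀ k, ContinuousOn (e k) (S k))
    (hlam : Tendsto lam 𝒰 (𝓝 0)) (hγ : Tendsto γ 𝒰 (𝓝 0)) (hβ : Tendsto β 𝒰 (𝓝 (-1)))
    (he : ∀ τ ∈ Ici T, Tendsto (fun z : ℕ × ℝ => e z.1 z.2) (𝒰 ×ˢ 𝓝 τ) (𝓝 (e₀ τ)))
    (he₀ : Tendsto e₀ atTop (𝓝 0))
    (hS : ∀ τ ∈ Ici T, ∀ᶠ z in 𝒰 ×ˢ 𝓝 τ, z.2 ∈ S z.1)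
    (hx : ∀ τ ∈ Ici T, Tendsto (fun z : ℕ × ℝ => x z.1 z.2) (𝒰 ×ˢ 𝓝 τ) (𝓝 c))
    (hy : ∀ τ ∈ Ici T, Tendsto (fun z : ℕ × ℝ => y z.1 z.2) (𝒰 ×ˢ 𝓝 τ) (𝓝 c))
    (hne : ∀ᶠ k in 𝒰, ¬ ∀ t ∈ S k, x k t = y k t)
    (hN : ∀ k, ¬ HasAlternation N (S k) fun t => x k t - y k t) : False := by
  -- Half of the limit is a lower bound for both components on compact sets for suitable `k`. The
  -- choices of `d` and `E` below are the largest that the oscillation estimate allows for this `r`.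
  set r := c / 2 with hr
  have hr0 : 0 < r := half_pos hc
  set κ := r ^ (2 * q + 2) with hκ
  have hκ0 : 0 < κ := by positivity
  set d := min (κ / 4) (1 / 2) with hd
  have hd0 : 0 < d := lt_min (by positivity) (by norm_num)
  set E := Real.sqrt (κ / 2) with hE
  have hE0 : 0 < E := Real.sqrt_pos.2 (by positivity)
  have hE2 : E ^ 2 = κ / 2 := Real.sq_sqrt (by positivity)
  obtain ⟨T', hT'⟩ := eventually_atTop.1 (he₀.abs.eventually
    (gt_mem_nhds (show |(0 : ℝ)| < E by simpa using hE0)))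
  set a := max T T'
  set b := a + (Real.pi / d + 3) * (N + 1)
  have hsub : ∀ τ ∈ Icc a b, τ ∈ Ici T := fun τ hτ => (le_max_left T T').trans hτ.1
  have e1 := eventually_forall_Icc fun τ hτ => hS τ (hsub τ hτ)
  have e2 := eventually_forall_Icc (p := fun k τ => r ≤ x k τ) fun τ hτ =>
    ((hx τ (hsub τ hτ)).eventually (lt_mem_nhds (half_lt_self hc))).mono fun z hz => le_of_lt hz
  have e3 := eventually_forall_Icc (p := fun k τ => r ≤ y k τ) fun τ hτ =>
    ((hy τ (hsub τ hτ)).eventually (lt_mem_nhds (half_lt_self hc))).mono fun z hz => le_of_lt hz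
  have e4 := eventually_forall_Icc (a := a) (b := b) (p := fun k τ => |e k τ| ≤ E) fun τ hτ =>
    ((he τ (hsub τ hτ)).abs.eventually
      (gt_mem_nhds (hT' τ ((le_max_right T T').trans hτ.1)))).mono fun z hz => le_of_lt hz
  have e5 : ∀ᶠ k in 𝒰, |lam k - γ k| < κ / 2 := by
    have h1 := (hlam.sub hγ).abs
    rw [sub_zero, abs_zero] at h1
    exact h1.eventually (gt_mem_nhds (by positivity))
  have e6 : ∀ᶠ k in 𝒰, β k < 0 := hβ.eventually (gt_mem_nhds (by norm_num))
  obtain ⟨k, k1, k2, k3, k4, k5, k6, k7⟩ :=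
    (e1.and (e2.and (e3.and (e4.and (e5.and (e6.and hne)))))).exists
  have := hSc k
  exact hN k ((h k).hasAlternation_sub hq k6.le (hec k) k7 (E := E) N hr0 hd0
    (by linarith [min_le_left (κ / 4) (1 / 2)]) (by linarith [min_le_right (κ / 4) (1 / 2)])
    (by rw [hE2]; linarith) (by linarith) k1 k2 k3 k4)

lemma false_of_limit_const_ne {𝒰 : Filter ℕ} [𝒰.NeBot] {q c T : ℝ} (hq : -1 < q) (hc : c ≠ 0)
    {N : ℕ} {e : ℕ → ℝ → ℝ} {e₀ : ℝ → ℝ}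
    {lam γ β : ℕ → ℝ} {S : ℕ → Set ℝ} {x y x₁ y₁ : ℕ → ℝ → ℝ}
    (h : ∀ k, Sol q (e k) (lam k) (γ k) (β k) (S k) (x k) (y k) (x₁ k) (y₁ k))
    (hSc : ∀ k, (S k).OrdConnected) (hec : ∀ k, ContinuousOn (e k) (S k))
    (hlam : Tendsto lam 𝒰 (𝓝 0)) (hγ : Tendsto γ 𝒰 (𝓝 0)) (hβ : Tendsto β 𝒰 (𝓝 (-1)))
    (he : ∀ τ ∈ Ici T, Tendsto (fun z : ℕ × ℝ => e z.1 z.2) (𝒰 ×ˢ 𝓝 τ) (𝓝 (e₀ τ)))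
    (he₀ : Tendsto e₀ atTop (𝓝 0))
    (hS : ∀ τ ∈ Ici T, ∀ᶠ z in 𝒰 ×ˢ 𝓝 τ, z.2 ∈ S z.1)
    (hx : ∀ τ ∈ Ici T, Tendsto (fun z : ℕ × ℝ => x z.1 z.2) (𝒰 ×ˢ 𝓝 τ) (𝓝 c))
    (hy : ∀ τ ∈ Ici T, Tendsto (fun z : ℕ × ℝ => y z.1 z.2) (𝒰 ×ˢ 𝓝 τ) (𝓝 c))
    (hne : ∀ᶠ k in 𝒰, ¬ ∀ t ∈ S k, x k t = y k t)
    (hN : ∀ k, ¬ HasAlternation N (S k) fun t => x k t - y k t) : False := by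
  rcases lt_or_gt_of_ne hc with hc | hc
  · refine false_of_limit_const (N := N) (T := T) (x := fun k t => -x k t)
      (y := fun k t => -y k t) hq (neg_pos.2 hc)
      (fun k => (h k).neg_left.neg_right) hSc hec hlam (by simpa using hγ) hβ he he₀ hS
      (fun τ hτ => (hx τ hτ).neg) (fun τ hτ => (hy τ hτ).neg)
      (hne.mono fun k hk h' => hk fun t ht => neg_injective (h' t ht))
      (fun k hk => hN k (HasAlternation.of_neg ?_))
    convert hk using 2
    ring
  · exact false_of_limit_const hq hc h hSc hec hlam hγ hβ he he₀ hS hx hy hne hN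

/-! ### Contradiction in the limit -/

/-- The blow-up sequences cannot exist. -/
theorem false_of_blowup (𝒰 : Ultrafilter ℕ) {q m β₀ : ℝ} (hq : -1 < q) {N : ℕ}
    {e : ℕ → ℝ → ℝ} {lam γ β : ℕ → ℝ} {S : ℕ → Set ℝ} {I : Set ℝ} (hI : IsOpen I)
    (hIc : Convex ℝ I) (hIt : ∀ᶠ t in atTop, t ∈ I) (hIe : ContinuousOn (fun t => m / t) I)
    {x y x₁ y₁ : ℕ → ℝ → ℝ}
    (h : ∀ k, Sol q (e k) (lam k) (γ k) (β k) (S k) (x k) (y k) (x₁ k) (y₁ k))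
    (hSc : ∀ k, (S k).OrdConnected) (hec : ∀ k, ContinuousOn (e k) (S k))
    (hlam : Tendsto lam 𝒰 (𝓝 0)) (hγ : Tendsto γ 𝒰 (𝓝 0)) (hβ : Tendsto β 𝒰 (𝓝 β₀))
    (he : ∀ τ ∈ I, Tendsto (fun z : ℕ × ℝ => e z.1 z.2) (𝒰 ×ˢ 𝓝 τ) (𝓝 (m / τ)))
    (hb : ∀ τ ∈ I, ∃ L, ∀ᶠ z in (𝒰 : Filter ℕ) ×ˢ 𝓝 τ, z.2 ∈ S z.1 ∧ |x z.1 z.2| ≤ L ∧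
      |y z.1 z.2| ≤ L ∧ |x₁ z.1 z.2| ≤ L ∧ |y₁ z.1 z.2| ≤ L)
    (hN₁ : ∀ k, ¬ HasAlternation N (S k) (x k)) (hN₂ : ∀ k, ¬ HasAlternation N (S k) (y k))
    (hN₃ : ∀ k, ¬ HasAlternation N (S k) fun t => x k t - y k t)
    (hN₄ : ∀ k, ¬ HasAlternation N (S k) fun t => x k t + y k t)
    (hstar : β₀ = -1 → ∀ᶠ k in 𝒰, (¬ ∀ t ∈ S k, x k t = y k t) ∧ ¬ ∀ t ∈ S k, x k t = -y k t)
    (hlim : ∀ X Y X₁ Y₁ : ℝ → ℝ,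
      (∀ τ ∈ I, Tendsto (fun k => x k τ) 𝒰 (𝓝 (X τ)) ∧ Tendsto (fun k => y k τ) 𝒰 (𝓝 (Y τ)) ∧
        Tendsto (fun k => x₁ k τ) 𝒰 (𝓝 (X₁ τ)) ∧ Tendsto (fun k => y₁ k τ) 𝒰 (𝓝 (Y₁ τ))) →
      Admissible m q I X Y X₁ Y₁ ∧ (∃ τ ∈ I, X τ ≠ 0 ∨ Y τ ≠ 0) ∧
      (∀ k, 0 < k → ScalarSol q m k I X X₁ → ∀ τ ∈ I, X τ = 0) ∧
      (ScalarSol q m 0 I X X₁ → ∀ τ ∈ I, X₁ τ = 0)) : False := by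
  obtain ⟨X, Y, X₁, Y₁, hsol, hconv⟩ :=
    Sol.exists_limit 𝒰 hq hI h hlam hγ hβ he hb
  have hpt : ∀ {f : ℕ → ℝ → ℝ} {τ c : ℝ}, Tendsto (fun z : ℕ × ℝ => f z.1 z.2) (𝒰 ×ˢ 𝓝 τ) (𝓝 c) →
      Tendsto (fun k => f k τ) 𝒰 (𝓝 c) := fun hf =>
    hf.comp (tendsto_id.prodMk (tendsto_const_nhds))
  have hconv' : ∀ τ ∈ I, Tendsto (fun k => x k τ) 𝒰 (𝓝 (X τ)) ∧
      Tendsto (fun k => y k τ) 𝒰 (𝓝 (Y τ)) ∧ Tendsto (fun k => x₁ k τ) 𝒰 (𝓝 (X₁ τ)) ∧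
      Tendsto (fun k => y₁ k τ) 𝒰 (𝓝 (Y₁ τ)) := fun τ hτ =>
    ⟨hpt (hconv τ hτ).1, hpt (hconv τ hτ).2.1, hpt (hconv τ hτ).2.2.1, hpt (hconv τ hτ).2.2.2⟩
  obtain ⟨hadm, ⟨τ₀, hτ₀, hnz⟩, hsc, hsc0⟩ := hlim X Y X₁ Y₁ hconv'
  have hSpt : ∀ τ ∈ I, ∀ᶠ k in (𝒰 : Filter ℕ), τ ∈ S k := fun τ hτ =>
    ((hb τ hτ).choose_spec.curry).mono fun k hk => hk.self_of_nhds.1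
  have hSprod : ∀ τ ∈ I, ∀ᶠ z in (𝒰 : Filter ℕ) ×ˢ 𝓝 τ, z.2 ∈ S z.1 := fun τ hτ =>
    (hb τ hτ).choose_spec.mono fun z hz => hz.1
  have s1 := eventuallySigned_of_tendsto hIt hSpt (fun τ hτ => (hconv' τ hτ).1) hN₁
  have s2 := eventuallySigned_of_tendsto hIt hSpt (fun τ hτ => (hconv' τ hτ).2.1) hN₂
  have s3 := eventuallySigned_of_tendsto (X := fun τ => X τ - Y τ) hIt hSpt
    (fun τ hτ => (hconv' τ hτ).1.sub (hconv' τ hτ).2.1) hN₃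
  have s4 := eventuallySigned_of_tendsto (X := fun τ => X τ + Y τ) hIt hSpt
    (fun τ hτ => (hconv' τ hτ).1.add (hconv' τ hτ).2.1) hN₄
  have := hIc.ordConnected
  -- Above `-1` the Liouville theorem contradicts nontriviality directly; otherwise `X = ±Y` and the
  -- scalar equation decides.
  rcases lt_or_ge (-1) β₀ with hβ₀ | hβ₀
  · have hz := eq_zero_of_signed hq hβ₀ hsol hIe hadm hIt s1 s2 s3 s4 τ₀ hτ₀
    exact hnz.elim (fun h => h hz.1) (fun h => h hz.2)
  have hneg : Sol q (fun t => m / t) 0 0 β₀ I X (fun t => -Y t) X₁ (fun t => -Y₁ t) := by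
    simpa only [neg_zero] using hsol.neg_right
  have hor := eq_or_eq_neg_of_signed hq (by linarith) hsol hIe hadm hIt s1 s2 s3 s4
  have hscalar : ScalarSol q m (-(1 + β₀)) I X X₁ :=
    hor.elim (fun h => hsol.scalar hq h) (fun h => hneg.scalar hq h)
  have hX₀ : X τ₀ ≠ 0 := by
    rcases hor with h | h <;> have h1 := h τ₀ hτ₀ <;> rcases hnz with h2 | h2
    · exact h2
    · rwa [h1]
    · exact h2
    · rw [h1]; exact neg_ne_zero.2 h2
  rcases lt_or_eq_of_le hβ₀ with hβ₁ | hβ₁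
  · exact hX₀ (hsc _ (by linarith) hscalar τ₀ hτ₀)
  subst hβ₁
  -- At `β₀ = -1` the scalar equation has no nonlinear term, so the limit is a nonzero constant, and
  -- the count of alternations before the limit must be used again.
  have hX₁ := hsc0 (by simpa using hscalar)
  have hconst : ∀ τ ∈ I, X τ = X τ₀ := fun τ hτ =>
    const_of_deriv_eq_zero hIc hscalar.deriv hX₁ τ hτ τ₀ hτ₀
  obtain ⟨T, hT⟩ := eventually_atTop.1 hIt
  have he₀ : Tendsto (fun t : ℝ => m / t) atTop (𝓝 0) := tendsto_const_nhds.div_atTop tendsto_id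
  rcases hor with hor | hor
  · refine false_of_limit_const_ne (N := N) (T := T) hq hX₀ h hSc hec hlam hγ hβ
      (fun τ hτ => he τ (hT τ hτ)) he₀ (fun τ hτ => hSprod τ (hT τ hτ)) (fun τ hτ => ?_)
      (fun τ hτ => ?_) ((hstar rfl).mono fun k hk => hk.1) hN₃
    · rw [← hconst τ (hT τ hτ)]; exact (hconv τ (hT τ hτ)).1
    · rw [← hconst τ (hT τ hτ), hor τ (hT τ hτ)]; exact (hconv τ (hT τ hτ)).2.1
  · refine false_of_limit_const_ne (N := N) (T := T) (y := fun k t => -y k t) hq hX₀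
      (fun k => (h k).neg_right) hSc hec hlam (by simpa using hγ.neg) hβ
      (fun τ hτ => he τ (hT τ hτ)) he₀ (fun τ hτ => hSprod τ (hT τ hτ)) (fun τ hτ => ?_)
      (fun τ hτ => ?_) ((hstar rfl).mono fun k hk => hk.2) (fun k => by simpa using hN₄ k)
    · rw [← hconst τ (hT τ hτ)]; exact (hconv τ (hT τ hτ)).1
    · rw [← hconst τ (hT τ hτ), hor τ (hT τ hτ)]; exact (hconv τ (hT τ hτ)).2.1.neg

/-! ### Radial profiles, rescaling and the choice of scales -/

/-- The set of radii of `ℝⁿ` or of a ball. -/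
def IsRadii (D : Set ℝ) : Prop := D = Ici 0 ∨ ∃ R : ℝ, 0 < R ∧ D = Ico 0 R

namespace IsRadii
variable {D : Set ℝ}

lemma zero_mem (h : IsRadii D) : (0 : ℝ) ∈ D := by
  rcases h with rfl | ⟨R, hR, rfl⟩
  · exact self_mem_Ici
  · exact ⟨le_rfl, hR⟩

lemma nonneg (h : IsRadii D) {r : ℝ} (hr : r ∈ D) : 0 ≤ r := by
  rcases h with rfl | ⟨R, hR, rfl⟩
  · exact hr
  · exact hr.1

lemma nonneg_of_closure (h : IsRadii D) {r : ℝ} (hr : r ∈ closure D) : 0 ≤ r :=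
  closure_minimal (fun _ hs => h.nonneg hs) isClosed_Ici hr

lemma down (h : IsRadii D) {r s : ℝ} (hr : r ∈ D) (hs : 0 ≤ s) (hsr : s ≤ r) : s ∈ D := by
  rcases h with rfl | ⟨R, hR, rfl⟩
  · exact hs
  · exact ⟨hs, hsr.trans_lt hr.2⟩

lemma ordConnected (h : IsRadii D) : (D ∩ Ioi 0).OrdConnected :=
  ⟨fun _ ha _ hb _ hc => ⟨h.down hb.1 (ha.2.le.trans hc.1) hc.2, ha.2.trans_le hc.1⟩⟩

lemma exists_pos (h : IsRadii D) : ∃ δ, 0 < δ ∧ δ ∈ D := by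
  rcases h with rfl | ⟨R, hR, rfl⟩
  · exact ⟨1, one_pos, mem_Ici.2 zero_le_one⟩
  · exact ⟨R / 2, by positivity, by positivity, by linarith⟩

end IsRadii

/-- Radial profiles of a classical solution, with their derivatives. -/
structure Profile (m : ℕ) (q lam γ β : ℝ) (D : Set ℝ) (U V U₁ V₁ : ℝ → ℝ) : Prop where
  sol : Sol q (fun r => m / r) lam γ β (D ∩ Ioi 0) U V U₁ V₁
  cont_fst : ContinuousOn U (closure D)
  cont_snd : ContinuousOn V (closure D)
  deriv_fst : Tendsto U₁ (𝓝[>] 0) (𝓝 0)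
  deriv_snd : Tendsto V₁ (𝓝[>] 0) (𝓝 0)
  boundary : ∀ r ∈ closure D, r ∉ D → U r = 0 ∧ V r = 0

/-- Only `s ^ 2` is prescribed, so `s` may be negative; away from the origin this lets the rescaled
variable point inwards. -/
lemma Sol.scale {q lam γ β : ℝ} {e : ℝ → ℝ} {S : Set ℝ} {x y x₁ y₁ : ℝ → ℝ} (hq : -1 < q)
    (h : Sol q e lam γ β S x y x₁ y₁) {μ s : ℝ} (ρ : ℝ) (hμ : 0 < μ)
    (hs : s ^ 2 * μ ^ (2 * q + 2) = 1) :
    Sol q (fun τ => s * e (ρ + s * τ)) (s ^ 2 * lam) (s ^ 2 * γ) β {τ | ρ + s * τ ∈ S}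
      (fun τ => x (ρ + s * τ) / μ) (fun τ => y (ρ + s * τ) / μ)
      (fun τ => s * x₁ (ρ + s * τ) / μ) (fun τ => s * y₁ (ρ + s * τ) / μ) := by
  have haff : ∀ τ, HasDerivAt (fun τ => ρ + s * τ) s τ := fun τ => by
    simpa using ((hasDerivAt_id τ).const_mul s).const_add ρ
  have hnl : ∀ u v : ℝ, s ^ 2 / μ * nl q β u v = nl q β (u / μ) (v / μ) := by
    intro u v
    have h1 := nl_mul hq hμ β (u / μ) (v / μ)
    rw [mul_div_cancel₀ _ hμ.ne', mul_div_cancel₀ _ hμ.ne'] at h1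
    have h2 : μ ^ (2 * q + 3) = μ ^ (2 * q + 2) * μ := by
      rw [← Real.rpow_add_one hμ.ne']; ring_nf
    rw [h1, h2]
    generalize μ ^ (2 * q + 2) = P at hs
    field_simp
    linear_combination nl q β (u / μ) (v / μ) * hs
  refine ⟨fun τ hτ => ?_, fun τ hτ => ?_, fun τ hτ => ?_, fun τ hτ => ?_⟩
  · exact (((h.fst _ hτ).comp τ (haff τ)).div_const μ).congr_deriv (by ring)
  · exact (((h.snd _ hτ).comp τ (haff τ)).div_const μ).congr_deriv (by ring)
  · refine ((((h.fst₁ _ hτ).comp τ (haff τ)).const_mul s).div_const μ).congr_deriv ?_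
    rw [← hnl]; ring
  · refine ((((h.snd₁ _ hτ).comp τ (haff τ)).const_mul s).div_const μ).congr_deriv ?_
    rw [← hnl]; ring

/-- Selection of a point at which a function nearly dominates its neighbours. -/
lemma exists_dominating {T : Set ℝ} (hT : IsClosed T) {f : ℝ → ℝ} (hf : ContinuousOn f T)
    {y : ℝ} (hy : y ∈ T) (hpos : 0 < f y) :
    ∃ x ∈ T, f y ≤ f x ∧ ∀ z ∈ T, |z - x| ≤ f y / (2 * f x) → f z ≤ 2 * f x := by
  have hK : IsCompact (T ∩ Metric.closedBall y 1) :=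
    (isCompact_closedBall y 1).inter_left hT
  -- The maximiser of `f x * (1 - |x - y|)` works: within half of its remaining weight the weight
  -- drops by at most a factor 2, and `f y ≤ f x * (1 - |x - y|)` shows that the stated radius is no
  -- larger.
  obtain ⟨x, ⟨hxT, hxb⟩, hmax⟩ := hK.exists_isMaxOn ⟨y, hy, Metric.mem_closedBall_self one_pos.le⟩
    ((hf.mono inter_subset_left).mul
      (g := fun x => 1 - |x - y|) (by fun_prop : Continuous fun x => 1 - |x - y|).continuousOn)
  have hmax' : ∀ z ∈ T, |z - y| ≤ 1 → f z * (1 - |z - y|) ≤ f x * (1 - |x - y|) :=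
    fun z hz hzb => hmax ⟨hz, by rwa [Metric.mem_closedBall, Real.dist_eq]⟩
  have hd : |x - y| ≤ 1 := by rwa [Metric.mem_closedBall, Real.dist_eq] at hxb
  have h0 := hmax' y hy (by simp)
  simp only [sub_self, abs_zero, sub_zero, mul_one] at h0
  have hd0 := abs_nonneg (x - y)
  have hfx : 0 < f x := by
    by_contra! hle
    have := mul_nonpos_of_nonpos_of_nonneg hle (sub_nonneg.2 hd)
    linarith
  have hd1 : 0 < 1 - |x - y| := by
    by_contra! hle
    have := mul_nonpos_of_nonneg_of_nonpos hfx.le hle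
    linarith
  refine ⟨x, hxT, by nlinarith, fun z hz hzx => ?_⟩
  rw [le_div_iff₀ (by positivity)] at hzx
  have h1 : |z - x| ≤ (1 - |x - y|) / 2 := by
    have : |z - x| * (2 * f x) ≤ (1 - |x - y|) / 2 * (2 * f x) := by linarith
    exact le_of_mul_le_mul_right this (by positivity)
  have h2 : |z - y| ≤ |z - x| + |x - y| := abs_sub_le z x y
  have h3 := hmax' z hz (by linarith)
  by_contra! hlt
  have h4 : (1 - |x - y|) / 2 ≤ 1 - |z - y| := by linarith
  have h5 : 2 * f x * ((1 - |x - y|) / 2) < f z * (1 - |z - y|) :=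
    mul_lt_mul hlt h4 (by linarith) (by linarith)
  linarith

/-- The selection is applied to the power `q + 1` of the norm because its reciprocal is the length
scale `ℓ`. The radius `f y / (2 f r)` is then `K ℓ` with `K = f y / 2`, and the factor 2 becomes `2
^ (q+1)⁻¹` for the components. -/
lemma Profile.exists_scale {m : ℕ} {q lam γ β : ℝ} {D : Set ℝ} {U V U₁ V₁ : ℝ → ℝ} (hq : -1 < q)
    (h : Profile m q lam γ β D U V U₁ V₁) {A y : ℝ} (hA : 0 < A) (hy : y ∈ D)
    (hAy : A ≤ max |U y| |V y|) :
    ∃ r μ ℓ K : ℝ, r ∈ D ∧ 0 < μ ∧ 0 < ℓ ∧ ℓ ^ 2 * μ ^ (2 * q + 2) = 1 ∧ A ^ (q + 1) / 2 ≤ K ∧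
      K * ℓ ≤ 1 / 2 ∧ max |U r| |V r| = μ ∧ ∀ z ∈ closure D, |z - r| ≤ K * ℓ →
        |U z| ≤ 2 ^ (q + 1)⁻¹ * μ ∧ |V z| ≤ 2 ^ (q + 1)⁻¹ * μ := by
  have hq1 : 0 < q + 1 := by linarith
  set g := fun z => max |U z| |V z| with hg
  have hg0 : ∀ z, 0 ≤ g z := fun z => (abs_nonneg _).trans (le_max_left _ _)
  set f := fun z => g z ^ (q + 1) with hf
  have hfc : ContinuousOn f (closure D) :=
    (h.cont_fst.abs.sup h.cont_snd.abs).rpow_const fun _ _ => Or.inr hq1.le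
  have hgy : 0 < g y := hA.trans_le hAy
  have hfy : 0 < f y := Real.rpow_pos_of_pos hgy _
  obtain ⟨r, hr, hyr, hdom⟩ := exists_dominating isClosed_closure hfc (subset_closure hy) hfy
  have hfr : 0 < f r := hfy.trans_le hyr
  have hgr : 0 < g r := by
    by_contra! hle
    have h0 : g r = 0 := le_antisymm hle (hg0 r)
    simp only [hf, h0, Real.zero_rpow hq1.ne'] at hfr
    exact lt_irrefl _ hfr
  have hrD : r ∈ D := by
    -- The selected point lies a priori only in the closure, but the components vanish on the added
    -- boundary.
    by_contra hrD
    obtain ⟨h1, h2⟩ := h.boundary r hr hrD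
    simp [hg, h1, h2] at hgr
  refine ⟨r, g r, (f r)⁻¹, f y / 2, hrD, hgr, by positivity, ?_, ?_, ?_, rfl, fun z hz hzr => ?_⟩
  · have : g r ^ (2 * q + 2) = f r ^ 2 := by
      simp only [hf]
      rw [← Real.rpow_natCast, ← Real.rpow_mul (hg0 r)]
      push_cast; ring_nf
    rw [this]; field_simp
  · have := Real.rpow_le_rpow hA.le hAy hq1.le
    simp only [hf, hg]; linarith
  · rw [← div_eq_mul_inv, div_le_iff₀ hfr]; linarith
  · have h1 := hdom z hz (hzr.trans (le_of_eq (by field_simp)))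
    have h2 : g z ≤ 2 ^ (q + 1)⁻¹ * g r := by
      have h3 := Real.rpow_le_rpow (by positivity) h1 (inv_nonneg.2 hq1.le)
      simp only [hf] at h3
      rw [Real.mul_rpow two_pos.le (by positivity), ← Real.rpow_mul (hg0 z),
        ← Real.rpow_mul (hg0 r), mul_inv_cancel₀ hq1.ne', Real.rpow_one, Real.rpow_one] at h3
      exact h3
    exact ⟨(le_max_left _ _).trans h2, (le_max_right _ _).trans h2⟩

lemma not_hasAlternation_scale {N : ℕ} {D S : Set ℝ} {f g : ℝ → ℝ} {ρ s μ : ℝ} (hs : s ≠ 0)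
    (hμ : 0 < μ) (h : ¬ HasAlternation N D f) (hS : ∀ τ ∈ S, ρ + s * τ ∈ D)
    (hg : ∀ τ, g τ = f (ρ + s * τ) / μ) : ¬ HasAlternation N S g := by
  rintro ⟨t, h1, h2, h3⟩
  refine h (HasAlternation.of_affine (ρ := ρ) hs ⟨t, h1, fun i hi => hS _ (h2 i hi),
    fun i hi => ?_⟩)
  have := h3 i hi
  rw [hg, hg, div_mul_div_comm] at this
  have h4 := mul_neg_of_neg_of_pos this (mul_pos hμ hμ)
  rwa [div_mul_cancel₀ _ (mul_pos hμ hμ).ne'] at h4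

lemma abs_rhs_le {q b Θ lam γ β x y : ℝ} (hq : -1 < q) (hlam : |lam| ≤ 1) (hγ : |γ| ≤ 1)
    (hβ : |β| ≤ b) (hx : |x| ≤ Θ) (hy : |y| ≤ Θ) :
    |lam * x + γ * y - nl q β x y| ≤ 2 * Θ + (1 + b) * Θ ^ (2 * q + 3) := by
  have hΘ : 0 ≤ Θ := (abs_nonneg _).trans hx
  have h1 := abs_nl_le hq hΘ hβ hx hy
  have h2 : |lam * x| ≤ 1 * Θ := by
    rw [abs_mul]; exact mul_le_mul hlam hx (abs_nonneg _) one_pos.le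
  have h3 : |γ * y| ≤ 1 * Θ := by
    rw [abs_mul]; exact mul_le_mul hγ hy (abs_nonneg _) one_pos.le
  refine (abs_sub _ _).trans ?_
  have := abs_add_le (lam * x) (γ * y)
  linarith

/-- Integrate the flux `t ^ m * w` from the origin, where it vanishes in the limit, and divide by `T
^ m`. -/
lemma abs_deriv_le_of_radial {m : ℕ} {w r : ℝ → ℝ} {T C : ℝ} (hT : 0 < T) (hC : 0 ≤ C)
    (h : ∀ t ∈ Ioc 0 T, HasDerivAt w (-(m / t * w t) + r t) t) (hr : ∀ t ∈ Ioc 0 T, |r t| ≤ C)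
    (h0 : Tendsto w (𝓝[>] 0) (𝓝 0)) : |w T| ≤ C * T := by
  have hG : ∀ t ∈ Ioc 0 T, HasDerivAt (fun t => t ^ m * w t) (t ^ m * r t) t := fun t ht =>
    hasDerivAt_pow_mul ht.1.ne' (h t ht)
  have h1 : ∀ s ∈ Ioc 0 T, |T ^ m * w T - s ^ m * w s| ≤ T ^ m * C * T := by
    intro s hs
    have := (convex_Icc s T).norm_image_sub_le_of_norm_hasDerivWithin_le
      (f := fun t => t ^ m * w t) (f' := fun t => t ^ m * r t) (C := T ^ m * C)
      (fun t ht => (hG t ⟨hs.1.trans_le ht.1, ht.2⟩).hasDerivWithinAt) (fun t ht => by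
        have ht' : t ∈ Ioc 0 T := ⟨hs.1.trans_le ht.1, ht.2⟩
        rw [Real.norm_eq_abs, abs_mul, abs_of_pos (pow_pos ht'.1 m)]
        exact mul_le_mul (pow_le_pow_left₀ ht'.1.le ht.2 m) (hr t ht') (abs_nonneg _)
          (by positivity)) (left_mem_Icc.2 hs.2) (right_mem_Icc.2 hs.2)
    refine this.trans ?_
    refine mul_le_mul_of_nonneg_left ?_ (by positivity)
    rw [Real.norm_eq_abs, abs_of_nonneg (sub_nonneg.2 hs.2)]
    linarith [hs.1]
  have h2 : Tendsto (fun s : ℝ => s ^ m * w s) (𝓝[>] 0) (𝓝 0) := by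
    have h3 : Tendsto (fun s : ℝ => s ^ m) (𝓝[>] 0) (𝓝 (0 ^ m)) :=
      ((continuous_pow m).tendsto 0).mono_left nhdsWithin_le_nhds
    simpa using h3.mul h0
  have h3 : |T ^ m * w T - 0| ≤ T ^ m * C * T := by
    refine le_of_tendsto (h2.const_sub (T ^ m * w T)).abs ?_
    filter_upwards [Ioc_mem_nhdsGT hT] with s hs using h1 s hs
  rw [sub_zero, abs_mul, abs_of_pos (pow_pos hT m), mul_assoc] at h3
  exact le_of_mul_le_mul_left h3 (pow_pos hT m)

lemma abs_sub_le_of_deriv_bound {f f' : ℝ → ℝ} {a b L : ℝ} (hab : a ≤ b)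
    (hf : ContinuousOn f (Icc a b)) (hd : ∀ t ∈ Ioo a b, HasDerivAt f (f' t) t)
    (hL : ∀ t ∈ Ioo a b, |f' t| ≤ L) : |f b - f a| ≤ L * (b - a) := by
  rcases hab.eq_or_lt with rfl | hlt
  · simp
  obtain ⟨c, hc, he⟩ := exists_hasDerivAt_eq_slope f f' hlt hf hd
  have h1 := hL c hc
  rw [he, abs_div, abs_of_pos (sub_pos.2 hlt), div_le_iff₀ (sub_pos.2 hlt)] at h1
  exact h1

/-! ### Blow-up sequences -/

/-- A sequence of solutions with a sequence of points around which they are rescaled. -/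
structure BlowupSeq (𝒰 : Ultrafilter ℕ) (m : ℕ) (q lam γ β₀ : ℝ) (N : ℕ) (D : Set ℝ) (β : ℕ → ℝ)
    (U V U₁ V₁ : ℕ → ℝ → ℝ) (r μ ℓ K : ℕ → ℝ) : Prop where
  profile : ∀ k, Profile m q lam γ (β k) D (U k) (V k) (U₁ k) (V₁ k)
  mem : ∀ k, r k ∈ D
  pos : ∀ k, 0 < μ k
  len_pos : ∀ k, 0 < ℓ k
  scale : ∀ k, ℓ k ^ 2 * μ k ^ (2 * q + 2) = 1
  max_eq : ∀ k, max |U k (r k)| |V k (r k)| = μ k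
  bound : ∀ k, ∀ z ∈ closure D, |z - r k| ≤ K k * ℓ k →
    |U k z| ≤ 2 ^ (q + 1)⁻¹ * μ k ∧ |V k z| ≤ 2 ^ (q + 1)⁻¹ * μ k
  lim_K : Tendsto K 𝒰 atTop
  lim_len : Tendsto ℓ 𝒰 (𝓝 0)
  lim_β : Tendsto β 𝒰 (𝓝 β₀)
  alt_fst : ∀ k, ¬ HasAlternation N D (U k)
  alt_snd : ∀ k, ¬ HasAlternation N D (V k)
  alt_sub : ∀ k, ¬ HasAlternation N D fun t => U k t - V k t
  alt_add : ∀ k, ¬ HasAlternation N D fun t => U k t + V k t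
  star : β₀ = -1 → ∀ᶠ k in 𝒰,
    (¬ ∀ t ∈ D ∩ Ioi 0, U k t = V k t) ∧ ¬ ∀ t ∈ D ∩ Ioi 0, U k t = -V k t

namespace BlowupSeq
variable {𝒰 : Ultrafilter ℕ} {m : ℕ} {q lam γ β₀ : ℝ} {N : ℕ} {D : Set ℝ} {β : ℕ → ℝ}
  {U V U₁ V₁ : ℕ → ℝ → ℝ} {r μ ℓ K : ℕ → ℝ}

lemma swap (h : BlowupSeq 𝒰 m q lam γ β₀ N D β U V U₁ V₁ r μ ℓ K) :
    BlowupSeq 𝒰 m q lam γ β₀ N D β V U V₁ U₁ r μ ℓ K where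
  profile k := ⟨(h.profile k).sol.swap, (h.profile k).cont_snd, (h.profile k).cont_fst,
    (h.profile k).deriv_snd, (h.profile k).deriv_fst,
    fun t h1 h2 => ((h.profile k).boundary t h1 h2).symm⟩
  mem := h.mem
  pos := h.pos
  len_pos := h.len_pos
  scale := h.scale
  max_eq k := by rw [max_comm]; exact h.max_eq k
  bound k z h1 h2 := (h.bound k z h1 h2).symm
  lim_K := h.lim_K
  lim_len := h.lim_len
  lim_β := h.lim_β
  alt_fst := h.alt_snd
  alt_snd := h.alt_fst
  alt_sub k h' := h.alt_sub k (HasAlternation.of_neg (by simpa using h'))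
  alt_add k h' := h.alt_add k (by simpa only [add_comm] using h')
  star hβ := (h.star hβ).mono fun k hk => ⟨fun h' => hk.1 fun t ht => (h' t ht).symm,
    fun h' => hk.2 fun t ht => by linarith [h' t ht]⟩

lemma eventually_small (h : BlowupSeq 𝒰 m q lam γ β₀ N D β U V U₁ V₁ r μ ℓ K) :
    Tendsto (fun k => ℓ k ^ 2 * lam) 𝒰 (𝓝 0) ∧ Tendsto (fun k => ℓ k ^ 2 * γ) 𝒰 (𝓝 0) ∧
    ∀ᶠ k in 𝒰, |ℓ k ^ 2 * lam| ≤ 1 ∧ |ℓ k ^ 2 * γ| ≤ 1 ∧ |β k| ≤ |β₀| + 1 := by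
  have h1 : ∀ c : ℝ, Tendsto (fun k => ℓ k ^ 2 * c) 𝒰 (𝓝 0) := fun c => by
    simpa using (h.lim_len.pow 2).mul_const c
  have h2 : ∀ c : ℝ, ∀ᶠ k in 𝒰, |ℓ k ^ 2 * c| ≤ 1 := fun c => by
    have := (h1 c).abs
    rw [abs_zero] at this
    exact (this.eventually (gt_mem_nhds one_pos)).mono fun k hk => le_of_lt hk
  exact ⟨h1 lam, h1 γ, (h2 lam).and ((h2 γ).and ((h.lim_β.abs.eventually
    (gt_mem_nhds (lt_add_one _))).mono fun k hk => le_of_lt hk))⟩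

lemma star_scale (h : BlowupSeq 𝒰 m q lam γ β₀ N D β U V U₁ V₁ r μ ℓ K) {ρ s : ℕ → ℝ}
    (hs : ∀ k, s k ≠ 0) (hβ : β₀ = -1) : ∀ᶠ k in 𝒰,
    (¬ ∀ t ∈ {τ | ρ k + s k * τ ∈ D ∩ Ioi 0},
      U k (ρ k + s k * t) / μ k = V k (ρ k + s k * t) / μ k) ∧
    ¬ ∀ t ∈ {τ | ρ k + s k * τ ∈ D ∩ Ioi 0},
      U k (ρ k + s k * t) / μ k = -(V k (ρ k + s k * t) / μ k) := by
  filter_upwards [h.star hβ] with k hk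
  have hμ := (h.pos k).ne'
  have key : ∀ t, ρ k + s k * ((t - ρ k) / s k) = t := fun t => by
    have := hs k; field_simp; ring
  refine ⟨fun h' => hk.1 fun t ht => ?_, fun h' => hk.2 fun t ht => ?_⟩
  · have := h' ((t - ρ k) / s k) (by simpa only [mem_ofPred_eq, key] using ht)
    rw [key] at this
    field_simp at this
    exact this
  · have := h' ((t - ρ k) / s k) (by simpa only [mem_ofPred_eq, key] using ht)
    rw [key] at this
    field_simp at this
    exact this

end BlowupSeq

lemma Profile.swap {m : ℕ} {q lam γ β : ℝ} {D : Set ℝ} {U V U₁ V₁ : ℝ → ℝ}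
    (h : Profile m q lam γ β D U V U₁ V₁) : Profile m q lam γ β D V U V₁ U₁ :=
  ⟨h.sol.swap, h.cont_snd, h.cont_fst, h.deriv_snd, h.deriv_fst,
    fun t h1 h2 => (h.boundary t h1 h2).symm⟩

lemma ordConnected_affine_preimage {S : Set ℝ} (hS : S.OrdConnected) (ρ s : ℝ) :
    {τ | ρ + s * τ ∈ S}.OrdConnected := by
  rcases le_total 0 s with hs | hs
  · exact hS.preimage_mono (f := fun τ => ρ + s * τ) fun a b hab => by
      simpa using mul_le_mul_of_nonneg_left hab hs
  · exact hS.preimage_anti (f := fun τ => ρ + s * τ) fun a b hab => by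
      simpa using mul_le_mul_of_nonpos_left hab hs

lemma continuousOn_friction {D : Set ℝ} (m ρ s : ℝ) :
    ContinuousOn (fun τ => s * (m / (ρ + s * τ))) {τ | ρ + s * τ ∈ D ∩ Ioi 0} :=
  continuousOn_const.mul (continuousOn_const.div (by fun_prop) fun _ hτ => ne_of_gt hτ.2)

/-- Friction `m / t` is invariant under dilations about the origin, so the flux estimate applies to
the rescaled profile with a constant that does not depend on the scale. -/
lemma Profile.abs_deriv_scale_le {m : ℕ} {q lam γ β b Θ : ℝ} {D : Set ℝ} {U V U₁ V₁ : ℝ → ℝ}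
    (hq : -1 < q) (h : Profile m q lam γ β D U V U₁ V₁) {μ ℓ T : ℝ} (hμ : 0 < μ) (hℓ : 0 < ℓ)
    (hs : ℓ ^ 2 * μ ^ (2 * q + 2) = 1) (hlam : |ℓ ^ 2 * lam| ≤ 1) (hγ : |ℓ ^ 2 * γ| ≤ 1)
    (hβ : |β| ≤ b) (hD : ∀ τ ∈ Ioc 0 T, 0 + ℓ * τ ∈ D ∩ Ioi 0)
    (hΘ : ∀ τ ∈ Ioc 0 T, |U (0 + ℓ * τ) / μ| ≤ Θ ∧ |V (0 + ℓ * τ) / μ| ≤ Θ) :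
    ∀ τ ∈ Ioc 0 T, |ℓ * U₁ (0 + ℓ * τ) / μ| ≤ (2 * Θ + (1 + b) * Θ ^ (2 * q + 3)) * τ := by
  intro τ hτ
  have hsol := h.sol.scale hq 0 hμ hs
  have hsub : ∀ t ∈ Ioc 0 τ, t ∈ Ioc 0 T := fun t ht => ⟨ht.1, ht.2.trans hτ.2⟩
  have hΘ0 : 0 ≤ Θ := (abs_nonneg _).trans (hΘ τ hτ).1
  have hb0 : 0 ≤ b := (abs_nonneg _).trans hβ
  refine abs_deriv_le_of_radial (m := m) (w := fun τ => ℓ * U₁ (0 + ℓ * τ) / μ)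
    (r := fun t => ℓ ^ 2 * lam * (U (0 + ℓ * t) / μ) + ℓ ^ 2 * γ * (V (0 + ℓ * t) / μ)
      - nl q β (U (0 + ℓ * t) / μ) (V (0 + ℓ * t) / μ)) hτ.1 (by positivity) ?_ ?_ ?_
  · intro t ht
    refine (hsol.fst₁ t (hD t (hsub t ht))).congr_deriv ?_
    have : ℓ * (m / (0 + ℓ * t)) = m / t := by
      rw [zero_add, ← mul_div_assoc, mul_div_mul_left _ _ hℓ.ne']
    rw [this]; ring
  · intro t ht
    exact abs_rhs_le hq hlam hγ hβ (hΘ t (hsub t ht)).1 (hΘ t (hsub t ht)).2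
  · have h1 : Tendsto (fun τ => 0 + ℓ * τ) (𝓝[>] 0) (𝓝[>] 0) := by
      refine tendsto_nhdsWithin_iff.2 ⟨?_, ?_⟩
      · have : Tendsto (fun τ => 0 + ℓ * τ) (𝓝 0) (𝓝 (0 + ℓ * 0)) := by
          apply Continuous.tendsto; fun_prop
        simp only [mul_zero, add_zero] at this
        exact this.mono_left nhdsWithin_le_nhds
      · filter_upwards [self_mem_nhdsWithin] with t ht
        simpa using mul_pos hℓ ht
    simpa using ((h.deriv_fst.comp h1).const_mul ℓ).div_const μ

lemma ne_zero_or_of_tendsto {𝒰 : Ultrafilter ℕ} {x y : ℕ → ℝ} {X Y : ℝ}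
    (hx : Tendsto x 𝒰 (𝓝 X)) (hy : Tendsto y 𝒰 (𝓝 Y))
    (h : ∀ᶠ k in 𝒰, 1 / 2 ≤ max |x k| |y k|) : X ≠ 0 ∨ Y ≠ 0 := by
  by_contra! h0
  have h1 := ge_of_tendsto (hx.abs.max hy.abs) h
  rw [h0.1, h0.2] at h1
  norm_num at h1

namespace BlowupSeq
variable {𝒰 : Ultrafilter ℕ} {m : ℕ} {q lam γ β₀ : ℝ} {N : ℕ} {D : Set ℝ} {β : ℕ → ℝ}
  {U V U₁ V₁ : ℕ → ℝ → ℝ} {r μ ℓ K : ℕ → ℝ}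

lemma bound_div (h : BlowupSeq 𝒰 m q lam γ β₀ N D β U V U₁ V₁ r μ ℓ K) (k : ℕ) {z : ℝ}
    (hz : z ∈ closure D) (hzr : |z - r k| ≤ K k * ℓ k) :
    |U k z / μ k| ≤ 2 ^ (q + 1)⁻¹ ∧ |V k z / μ k| ≤ 2 ^ (q + 1)⁻¹ := by
  have := h.bound k z hz hzr
  rw [abs_div, abs_div, abs_of_pos (h.pos k), div_le_iff₀ (h.pos k), div_le_iff₀ (h.pos k)]
  exact this

lemma max_div (h : BlowupSeq 𝒰 m q lam γ β₀ N D β U V U₁ V₁ r μ ℓ K) (k : ℕ) :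
    max |U k (r k) / μ k| |V k (r k) / μ k| = 1 := by
  rw [abs_div, abs_div, abs_of_pos (h.pos k), max_div_div_right (h.pos k).le, h.max_eq,
    div_self (h.pos k).ne']

/-! ### Concentration at the origin -/

/-- The constant bounding the right-hand sides of the rescaled equations. -/
noncomputable def rhsBound (q β₀ : ℝ) : ℝ :=
  2 * 2 ^ (q + 1)⁻¹ + (1 + (|β₀| + 1)) * (2 ^ (q + 1)⁻¹) ^ (2 * q + 3)

lemma rhsBound_pos (q β₀ : ℝ) : 0 < rhsBound q β₀ := by
  unfold rhsBound; positivity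

lemma eventually_bound_origin (hq : -1 < q) (hD : IsRadii D)
    (h : BlowupSeq 𝒰 m q lam γ β₀ N D β U V U₁ V₁ r μ ℓ K) {A : ℝ}
    (hA : ∀ᶠ k in 𝒰, r k ≤ A * ℓ k) (T : ℝ) :
    ∀ᶠ k in 𝒰, ∀ τ ∈ Ioc 0 T, 0 + ℓ k * τ ∈ D ∩ Ioi 0 ∧
      |U k (0 + ℓ k * τ) / μ k| ≤ 2 ^ (q + 1)⁻¹ ∧ |V k (0 + ℓ k * τ) / μ k| ≤ 2 ^ (q + 1)⁻¹ ∧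
      |ℓ k * U₁ k (0 + ℓ k * τ) / μ k| ≤ rhsBound q β₀ * τ ∧
      |ℓ k * V₁ k (0 + ℓ k * τ) / μ k| ≤ rhsBound q β₀ * τ := by
  obtain ⟨δ, hδ, hδD⟩ := hD.exists_pos
  have h1 : ∀ᶠ k in 𝒰, ℓ k * T < δ := by
    have := h.lim_len.mul_const T
    rw [zero_mul] at this
    exact this.eventually (gt_mem_nhds hδ)
  -- Both `ℓ k * τ` and the centre `r k` lie in `[0, max T A * ℓ k]`, so their distance is within
  -- the range where the bound holds.
  filter_upwards [hA, h1, h.lim_K.eventually_ge_atTop (max T A), h.eventually_small.2.2]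
    with k hk1 hk2 hk3 hk4
  have hℓ := h.len_pos k
  have hmem : ∀ τ ∈ Ioc 0 T, 0 + ℓ k * τ ∈ D ∩ Ioi 0 := fun τ hτ => by
    have h2 : 0 < ℓ k * τ := mul_pos hℓ hτ.1
    have h3 : ℓ k * τ ≤ ℓ k * T := mul_le_mul_of_nonneg_left hτ.2 hℓ.le
    rw [zero_add]
    exact ⟨hD.down hδD h2.le (by linarith), h2⟩
  have hb : ∀ τ ∈ Ioc 0 T, |U k (0 + ℓ k * τ) / μ k| ≤ 2 ^ (q + 1)⁻¹ ∧
      |V k (0 + ℓ k * τ) / μ k| ≤ 2 ^ (q + 1)⁻¹ := fun τ hτ => by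
    refine h.bound_div k (subset_closure (hmem τ hτ).1) ?_
    have h2 : 0 < ℓ k * τ := mul_pos hℓ hτ.1
    have h3 : ℓ k * τ ≤ ℓ k * T := mul_le_mul_of_nonneg_left hτ.2 hℓ.le
    have h4 : max T A * ℓ k ≤ K k * ℓ k := mul_le_mul_of_nonneg_right hk3 hℓ.le
    have h5 : T * ℓ k ≤ max T A * ℓ k := mul_le_mul_of_nonneg_right (le_max_left _ _) hℓ.le
    have h6 : A * ℓ k ≤ max T A * ℓ k := mul_le_mul_of_nonneg_right (le_max_right _ _) hℓ.le
    have h7 := hD.nonneg (h.mem k)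
    rw [abs_le]; constructor <;> linarith
  intro τ hτ
  exact ⟨hmem τ hτ, (hb τ hτ).1, (hb τ hτ).2,
    (h.profile k).abs_deriv_scale_le hq (h.pos k) hℓ (h.scale k) hk4.1 hk4.2.1 hk4.2.2 hmem hb τ hτ,
    (h.profile k).swap.abs_deriv_scale_le hq (h.pos k) hℓ (h.scale k) hk4.1 hk4.2.1 hk4.2.2 hmem
      (fun τ hτ => (hb τ hτ).symm) τ hτ⟩

/-- The rescaled centre `r k / ℓ k` may converge to 0, which lies outside the domain of the limit.
The slope bound transports half of the norm to a fixed positive point. -/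
lemma eventually_half_le (hq : -1 < q) (hD : IsRadii D)
    (h : BlowupSeq 𝒰 m q lam γ β₀ N D β U V U₁ V₁ r μ ℓ K) {A : ℝ}
    (hA : ∀ᶠ k in 𝒰, r k ≤ A * ℓ k) :
    ∃ τ, 0 < τ ∧ ∀ᶠ k in 𝒰, 1 / 2 ≤ max |U k (0 + ℓ k * τ) / μ k| |V k (0 + ℓ k * τ) / μ k| := by
  have hr0 : ∀ k, 0 ≤ r k / ℓ k := fun k => div_nonneg (hD.nonneg (h.mem k)) (h.len_pos k).le
  obtain ⟨a, ha, -⟩ := exists_tendsto_of_bounded 𝒰 (f := fun k => r k / ℓ k) (L := A)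
    (hA.mono fun k hk => by
      rw [abs_of_nonneg (hr0 k), div_le_iff₀ (h.len_pos k)]; exact hk)
  have ha0 : 0 ≤ a := ge_of_tendsto' ha hr0
  set L := rhsBound q β₀ * (a + 1) with hL
  have hL0 : 0 < L := mul_pos (rhsBound_pos q β₀) (by linarith)
  -- The rescaled centre is eventually within `2δ` of `a + δ`. Up to that point slopes are at most
  -- `L`, so each component loses at most `1 / 2`.
  set δ := min 1 (1 / (4 * L)) with hδ
  have hδ0 : 0 < δ := lt_min one_pos (by positivity)
  have hδL : L * (2 * δ) ≤ 1 / 2 := by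
    have : δ ≤ 1 / (4 * L) := min_le_right _ _
    rw [le_div_iff₀ (by positivity)] at this
    linarith
  refine ⟨a + δ, by linarith, ?_⟩
  filter_upwards [h.eventually_bound_origin hq hD hA (a + δ),
    ha.eventually (Ioo_mem_nhds (sub_lt_self a hδ0) (lt_add_of_pos_right a hδ0))] with k hk1 hk2
  have hℓ := h.len_pos k
  have hτD := (hk1 (a + δ) ⟨by linarith, le_rfl⟩).1.1
  have hcl : MapsTo (fun t => 0 + ℓ k * t) (Icc (r k / ℓ k) (a + δ)) (closure D) :=
    fun t ht => subset_closure (hD.down hτD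
      (by have := mul_nonneg hℓ.le ((hr0 k).trans ht.1); simpa using this)
      (by have := mul_le_mul_of_nonneg_left ht.2 hℓ.le; simpa using this))
  have hr : 0 + ℓ k * (r k / ℓ k) = r k := by field_simp; simp
  have key : ∀ {f g : ℝ → ℝ}, ContinuousOn f (closure D) →
      (∀ t ∈ Ioc 0 (a + δ), HasDerivAt (fun t => f (0 + ℓ k * t) / μ k)
        (ℓ k * g (0 + ℓ k * t) / μ k) t) →
      (∀ t ∈ Ioc 0 (a + δ), |ℓ k * g (0 + ℓ k * t) / μ k| ≤ rhsBound q β₀ * t) →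
      |f (r k) / μ k| ≤ |f (0 + ℓ k * (a + δ)) / μ k| + 1 / 2 := by
    intro f g hf hd hb
    have h1 := abs_sub_le_of_deriv_bound (f := fun t => f (0 + ℓ k * t) / μ k) (L := L) hk2.2.le
      ((hf.comp (by fun_prop) hcl).div_const _)
      (fun t ht => hd t ⟨(hr0 k).trans_lt ht.1, ht.2.le⟩) (fun t ht => by
        refine (hb t ⟨(hr0 k).trans_lt ht.1, ht.2.le⟩).trans ?_
        refine mul_le_mul_of_nonneg_left ?_ (rhsBound_pos q β₀).le
        have : δ ≤ 1 := min_le_left _ _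
        linarith [ht.2])
    simp only [hr] at h1
    have h2 : L * (a + δ - r k / ℓ k) ≤ L * (2 * δ) :=
      mul_le_mul_of_nonneg_left (by linarith [hk2.1]) hL0.le
    have h3 := abs_sub_abs_le_abs_sub (f (r k) / μ k) (f (0 + ℓ k * (a + δ)) / μ k)
    rw [abs_sub_comm] at h3
    linarith
  have hsol := (h.profile k).sol.scale hq 0 (h.pos k) (h.scale k)
  have hU := key (h.profile k).cont_fst (fun t ht => hsol.fst t (hk1 t ht).1)
    fun t ht => (hk1 t ht).2.2.2.1
  have hV := key (h.profile k).cont_snd (fun t ht => hsol.snd t (hk1 t ht).1)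
    fun t ht => (hk1 t ht).2.2.2.2
  have h1 := h.max_div k
  rcases le_total |V k (r k) / μ k| |U k (r k) / μ k| with h2 | h2
  · rw [max_eq_left h2] at h1
    exact le_max_of_le_left (by linarith)
  · rw [max_eq_right h2] at h1
    exact le_max_of_le_right (by linarith)

/-- Rescaling about the origin keeps the friction `m / τ`. The bound `|X₁ τ| ≤ C τ` inherited by the
limit is the regularity at 0 that the Liouville and flux arguments require. -/
lemma false_of_origin (hq : -1 < q) (hm : m ≤ 2) (hmq : m = 2 → q < 1) (hD : IsRadii D)
    (h : BlowupSeq 𝒰 m q lam γ β₀ N D β U V U₁ V₁ r μ ℓ K) {A : ℝ}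
    (hA : ∀ᶠ k in 𝒰, r k ≤ A * ℓ k) : False := by
  obtain ⟨τ₀, hτ₀, hhalf⟩ := h.eventually_half_le hq hD hA
  have hbd := fun T => h.eventually_bound_origin hq hD hA T
  have hs : ∀ k, ℓ k ≠ 0 := fun k => (h.len_pos k).ne'
  have he : ∀ k τ, ℓ k * (m / (0 + ℓ k * τ)) = m / τ := fun k τ => by
    rw [zero_add, ← mul_div_assoc, mul_div_mul_left _ _ (hs k)]
  refine false_of_blowup 𝒰 (m := m) (β₀ := β₀) (N := N) (I := Ioi 0) hq isOpen_Ioi (convex_Ioi 0)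
    (eventually_gt_atTop 0)
    (continuousOn_const.div continuousOn_id fun t ht => ne_of_gt ht)
    (fun k => (h.profile k).sol.scale hq 0 (h.pos k) (h.scale k))
    (fun k => ordConnected_affine_preimage hD.ordConnected _ _)
    (fun k => continuousOn_friction _ _ _) h.eventually_small.1 h.eventually_small.2.1 h.lim_β
    ?_ ?_ ?_ ?_ ?_ ?_ (h.star_scale hs) ?_
  · intro τ hτ
    simp only [he]
    exact (tendsto_const_nhds.div tendsto_id (ne_of_gt hτ)).comp tendsto_snd
  · intro τ hτ
    refine ⟨max (2 ^ (q + 1)⁻¹) (rhsBound q β₀ * (τ + 1)), ?_⟩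
    refine ((hbd (τ + 1)).prod_mk (Ioo_mem_nhds hτ (lt_add_one τ))).mono fun z hz => ?_
    have hz2 : z.2 ∈ Ioc 0 (τ + 1) := ⟨hz.2.1, hz.2.2.le⟩
    obtain ⟨h1, h2, h3, h4, h5⟩ := hz.1 z.2 hz2
    have h6 : rhsBound q β₀ * z.2 ≤ rhsBound q β₀ * (τ + 1) :=
      mul_le_mul_of_nonneg_left hz2.2 (rhsBound_pos q β₀).le
    exact ⟨h1, h2.trans (le_max_left _ _), h3.trans (le_max_left _ _),
      (h4.trans h6).trans (le_max_right _ _), (h5.trans h6).trans (le_max_right _ _)⟩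
  · exact fun k => not_hasAlternation_scale (hs k) (h.pos k) (h.alt_fst k) (fun _ hτ => hτ.1)
      fun _ => rfl
  · exact fun k => not_hasAlternation_scale (hs k) (h.pos k) (h.alt_snd k) (fun _ hτ => hτ.1)
      fun _ => rfl
  · exact fun k => not_hasAlternation_scale (hs k) (h.pos k) (h.alt_sub k) (fun _ hτ => hτ.1)
      fun _ => (sub_div _ _ _).symm
  · exact fun k => not_hasAlternation_scale (hs k) (h.pos k) (h.alt_add k) (fun _ hτ => hτ.1)
      fun _ => (add_div _ _ _).symm
  · intro X Y X₁ Y₁ hlim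
    have hB : ∀ τ ∈ Ioi (0 : ℝ), |X τ| ≤ 2 ^ (q + 1)⁻¹ ∧ |Y τ| ≤ 2 ^ (q + 1)⁻¹ ∧
        |X₁ τ| ≤ rhsBound q β₀ * τ ∧ |Y₁ τ| ≤ rhsBound q β₀ * τ := by
      intro τ hτ
      have hτ' : τ ∈ Ioc 0 τ := ⟨hτ, le_rfl⟩
      obtain ⟨h1, h2, h3, h4⟩ := hlim τ hτ
      exact ⟨le_of_tendsto h1.abs ((hbd τ).mono fun k hk => (hk τ hτ').2.1),
        le_of_tendsto h2.abs ((hbd τ).mono fun k hk => (hk τ hτ').2.2.1),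
        le_of_tendsto h3.abs ((hbd τ).mono fun k hk => (hk τ hτ').2.2.2.1),
        le_of_tendsto h4.abs ((hbd τ).mono fun k hk => (hk τ hτ').2.2.2.2)⟩
    refine ⟨?_, ⟨τ₀, hτ₀, ?_⟩, ?_, ?_⟩
    · interval_cases m
      · exact Or.inl (by norm_num)
      · exact Or.inr (Or.inl (by norm_num))
      · refine Or.inr (Or.inr ⟨by norm_num, hmq rfl, rfl,
          max (2 ^ (q + 1)⁻¹) (rhsBound q β₀), fun t ht => ?_⟩)
        obtain ⟨h1, h2, h3, h4⟩ := hB t ht.1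
        have h6 : rhsBound q β₀ * t ≤ rhsBound q β₀ :=
          mul_le_of_le_one_right (rhsBound_pos q β₀).le ht.2
        exact ⟨h1.trans (le_max_left _ _), h2.trans (le_max_left _ _),
          (h3.trans h6).trans (le_max_right _ _), (h4.trans h6).trans (le_max_right _ _)⟩
    · exact ne_zero_or_of_tendsto (hlim τ₀ hτ₀).1 (hlim τ₀ hτ₀).2.1 hhalf
    · exact fun k hk hX => hX.eq_zero_of_radial hq hk (fun t ht => (hB t ht).1)
        fun t ht => (hB t ht.1).2.2.1
    · exact fun hX => hX.deriv_eq_zero_of_radial fun t ht => (hB t ht.1).2.2.1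

/-! ### Concentration away from the origin -/

lemma abs_friction_lt {m : ℕ} {ε ℓ w : ℝ} (hε : 0 < ε) (hℓ : 0 < ℓ) (hw : (m / ε + 1) * ℓ ≤ w) :
    |-ℓ * (m / w)| < ε := by
  have hm : (0 : ℝ) ≤ m / ε := by positivity
  have hw0 : 0 < w := lt_of_lt_of_le (by positivity) hw
  rw [abs_mul, abs_neg, abs_of_pos hℓ, abs_of_nonneg (by positivity), ← mul_div_assoc,
    div_lt_iff₀ hw0]
  calc ℓ * m = ε * (m / ε * ℓ) := by field_simp
    _ < ε * w := by
      refine mul_lt_mul_of_pos_left ?_ hε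
      linarith

/-- The bound for the derivatives of the rescaled solutions away from the origin. -/
noncomputable def derivBound (q β₀ : ℝ) : ℝ :=
  gronwallBound (2 * 2 ^ (q + 1)⁻¹) 1 (rhsBound q β₀) 1

/-- No flux argument is available here. Since the friction is at most 1 in rescaled variables, the
derivative is controlled by interpolation on the unit interval pointing towards the origin, which
cannot leave the domain. -/
lemma eventually_bound_interior (hq : -1 < q) (hD : IsRadii D)
    (h : BlowupSeq 𝒰 m q lam γ β₀ N D β U V U₁ V₁ r μ ℓ K) (hr : ∀ A, ∀ᶠ k in 𝒰, A * ℓ k < r k)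
    (T : ℝ) : ∀ᶠ k in 𝒰, ∀ τ ∈ Icc (-T) T, 0 < r k + -ℓ k * τ ∧ (r k + -ℓ k * τ ∈ D →
      |U k (r k + -ℓ k * τ) / μ k| ≤ 2 ^ (q + 1)⁻¹ ∧ |V k (r k + -ℓ k * τ) / μ k| ≤ 2 ^ (q + 1)⁻¹ ∧
      |-ℓ k * U₁ k (r k + -ℓ k * τ) / μ k| ≤ derivBound q β₀) := by
  -- The `+ 1` after `T` makes room for the unit interval; `m / 1 + 1` keeps the friction below 1.
  filter_upwards [hr (T + 1 + (m / 1 + 1)), h.lim_K.eventually_ge_atTop (T + 1),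
    h.eventually_small.2.2] with k hk1 hk2 hk3 τ hτ
  have hℓ := h.len_pos k
  have hpos : ∀ σ, σ ≤ T + 1 → (m / 1 + 1) * ℓ k ≤ r k + -ℓ k * σ := fun σ hσ => by
    have := mul_le_mul_of_nonneg_right hσ hℓ.le
    linarith
  have hpos' : ∀ σ, σ ≤ T + 1 → 0 < r k + -ℓ k * σ := fun σ hσ =>
    lt_of_lt_of_le (by positivity) (hpos σ hσ)
  refine ⟨hpos' τ (by linarith [hτ.2]), fun hτD => ?_⟩
  have hmem : ∀ σ ∈ Icc τ (τ + 1), r k + -ℓ k * σ ∈ D ∩ Ioi 0 := fun σ hσ => by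
    have h1 := hpos' σ (by linarith [hσ.2, hτ.2])
    have := mul_le_mul_of_nonneg_left hσ.1 hℓ.le
    exact ⟨hD.down hτD h1.le (by linarith), h1⟩
  have hb : ∀ σ ∈ Icc τ (τ + 1), |U k (r k + -ℓ k * σ) / μ k| ≤ 2 ^ (q + 1)⁻¹ ∧
      |V k (r k + -ℓ k * σ) / μ k| ≤ 2 ^ (q + 1)⁻¹ := fun σ hσ => by
    refine h.bound_div k (subset_closure (hmem σ hσ).1) ?_
    have h2 : |σ| ≤ K k := abs_le.2 ⟨by linarith [hσ.1, hτ.1], by linarith [hσ.2, hτ.2]⟩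
    rw [add_sub_cancel_left, neg_mul, abs_neg, abs_mul, abs_of_pos hℓ, mul_comm]
    exact mul_le_mul_of_nonneg_right h2 hℓ.le
  have hs : (-ℓ k) ^ 2 * μ k ^ (2 * q + 2) = 1 := by rw [neg_sq]; exact h.scale k
  have hsol := (h.profile k).sol.scale hq (r k) (h.pos k) hs
  have hτ' : τ ∈ Icc τ (τ + 1) := ⟨le_rfl, by linarith⟩
  refine ⟨(hb τ hτ').1, (hb τ hτ').2, ?_⟩
  refine abs_deriv_le_of_interval (y₁ := fun τ => -ℓ k * U₁ k (r k + -ℓ k * τ) / μ k)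
    zero_le_one (rhsBound_pos q β₀).le (fun σ hσ => hsol.fst σ (hmem σ hσ))
    (fun σ hσ => hsol.fst₁ σ (hmem σ hσ)) (fun σ hσ => (hb σ hσ).1) fun σ hσ => ?_
  have h1 := abs_friction_lt (m := m) one_pos hℓ (hpos σ (by linarith [hσ.2, hτ.2]))
  have h2 := abs_rhs_le hq hk3.1 hk3.2.1 hk3.2.2 (hb σ hσ).1 (hb σ hσ).2
  have h3 : |(-ℓ k * (m / (r k + -ℓ k * σ))) * (-ℓ k * U₁ k (r k + -ℓ k * σ) / μ k)| ≤
      1 * |-ℓ k * U₁ k (r k + -ℓ k * σ) / μ k| := by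
    rw [abs_mul]
    exact mul_le_mul_of_nonneg_right h1.le (abs_nonneg _)
  simp only [neg_sq]
  rw [add_assoc, add_sub_assoc]
  refine (abs_add_le _ _).trans ?_
  rw [abs_neg]
  exact add_le_add h3 h2

lemma tendsto_friction (h : BlowupSeq 𝒰 m q lam γ β₀ N D β U V U₁ V₁ r μ ℓ K)
    (hr : ∀ A, ∀ᶠ k in 𝒰, A * ℓ k < r k) (τ : ℝ) :
    Tendsto (fun z : ℕ × ℝ => -ℓ z.1 * (m / (r z.1 + -ℓ z.1 * z.2))) (𝒰 ×ˢ 𝓝 τ) (𝓝 0) := by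
  rw [Metric.tendsto_nhds]
  intro ε hε
  refine ((hr (τ + 1 + (m / ε + 1))).prod_mk (gt_mem_nhds (lt_add_one τ))).mono fun z hz => ?_
  rw [Real.dist_eq, sub_zero]
  refine abs_friction_lt hε (h.len_pos _) ?_
  have := mul_lt_mul_of_pos_right hz.2 (h.len_pos z.1)
  linarith [hz.1]

/-- Treats both possible limit domains at once. With the scale `-ℓ k` the variable increases towards
the origin, so the domain is closed upwards, and the friction tends to 0. -/
lemma false_of_reach (hq : -1 < q) (hD : IsRadii D)
    (h : BlowupSeq 𝒰 m q lam γ β₀ N D β U V U₁ V₁ r μ ℓ K) (hr : ∀ A, ∀ᶠ k in 𝒰, A * ℓ k < r k)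
    {I : Set ℝ} (hI : IsOpen I) (hup : ∀ s ∈ I, Ici s ⊆ I) (h0 : (0 : ℝ) ∈ I)
    (hreach : ∀ τ ∈ I, ∀ᶠ k in 𝒰, r k + -ℓ k * τ ∈ D)
    (hlim : ∀ X : ℝ → ℝ, (∀ τ ∈ I, Tendsto (fun k => U k (r k + -ℓ k * τ) / μ k) 𝒰 (𝓝 (X τ))) →
      I = univ ∨ ∃ b, I = Ioi b ∧ Tendsto X (𝓝[>] b) (𝓝 0)) : False := by
  have hs : ∀ k, -ℓ k ≠ 0 := fun k => neg_ne_zero.2 (h.len_pos k).ne'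
  have hs2 : ∀ k, (-ℓ k) ^ 2 * μ k ^ (2 * q + 2) = 1 := fun k => by
    rw [neg_sq]; exact h.scale k
  have hoc : I.OrdConnected := ⟨fun a ha b _ c hc => hup a ha hc.1⟩
  have hpt : ∀ τ ∈ I, ∀ᶠ k in 𝒰, |U k (r k + -ℓ k * τ) / μ k| ≤ 2 ^ (q + 1)⁻¹ := fun τ hτ => by
    filter_upwards [h.eventually_bound_interior hq hD hr |τ|, hreach τ hτ] with k hk1 hk2
    exact ((hk1 τ ⟨neg_abs_le τ, le_abs_self τ⟩).2 hk2).1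
  refine false_of_blowup 𝒰 (m := 0) (β₀ := β₀) (N := N) hq hI hoc.convex
    ((eventually_ge_atTop 0).mono fun t ht => hup 0 h0 ht) (by simpa using continuousOn_const)
    (fun k => (h.profile k).sol.scale hq (r k) (h.pos k) (hs2 k))
    (fun k => ordConnected_affine_preimage hD.ordConnected _ _)
    (fun k => continuousOn_friction _ _ _) (by simpa using h.eventually_small.1)
    (by simpa using h.eventually_small.2.1) h.lim_β
    (fun τ _ => by simpa using h.tendsto_friction hr τ) ?_
    (fun k => not_hasAlternation_scale (hs k) (h.pos k) (h.alt_fst k) (fun _ hτ => hτ.1)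
      fun _ => rfl)
    (fun k => not_hasAlternation_scale (hs k) (h.pos k) (h.alt_snd k) (fun _ hτ => hτ.1)
      fun _ => rfl)
    (fun k => not_hasAlternation_scale (hs k) (h.pos k) (h.alt_sub k) (fun _ hτ => hτ.1)
      fun _ => (sub_div _ _ _).symm)
    (fun k => not_hasAlternation_scale (hs k) (h.pos k) (h.alt_add k) (fun _ hτ => hτ.1)
      fun _ => (add_div _ _ _).symm)
    (h.star_scale hs) ?_
  · intro τ hτ
    -- A smaller `τ'` is a larger radius: once it lies in the domain, so do all the points near `τ`,
    -- uniformly in `k`.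
    obtain ⟨τ', hτ'I, hτ'⟩ : ∃ τ' ∈ I, τ' < τ := by
      obtain ⟨δ, hδ, hball⟩ := Metric.isOpen_iff.1 hI τ hτ
      refine ⟨τ - δ / 2, hball ?_, by linarith⟩
      rw [Metric.mem_ball, Real.dist_eq, abs_lt]
      constructor <;> linarith
    refine ⟨max (2 ^ (q + 1)⁻¹) (derivBound q β₀), ?_⟩
    have hev := ((h.eventually_bound_interior hq hD hr (|τ| + 1)).and
      (h.swap.eventually_bound_interior hq hD hr (|τ| + 1))).and (hreach τ' hτ'I)
    have hnb : Ioo (max τ' (τ - 1)) (τ + 1) ∈ 𝓝 τ :=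
      Ioo_mem_nhds (max_lt hτ' (by linarith)) (by linarith)
    refine (hev.prod_mk hnb).mono fun z hz => ?_
    obtain ⟨⟨⟨hz1, hz2⟩, hz3⟩, hz4, hz5⟩ := hz
    have h1 := (le_max_left _ _).trans_lt hz4
    have h2 := (le_max_right _ _).trans_lt hz4
    have hzT : z.2 ∈ Icc (-(|τ| + 1)) (|τ| + 1) :=
      ⟨by linarith [neg_abs_le τ], by linarith [le_abs_self τ]⟩
    have hz0 := (hz1 z.2 hzT).1
    have hzD : r z.1 + -ℓ z.1 * z.2 ∈ D := by
      refine hD.down hz3 hz0.le ?_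
      have := mul_lt_mul_of_pos_left h1 (h.len_pos z.1)
      linarith
    obtain ⟨b1, b2, b3⟩ := (hz1 z.2 hzT).2 hzD
    obtain ⟨-, -, b4⟩ := (hz2 z.2 hzT).2 hzD
    exact ⟨⟨hzD, hz0⟩, b1.trans (le_max_left _ _), b2.trans (le_max_left _ _),
      b3.trans (le_max_right _ _), b4.trans (le_max_right _ _)⟩
  · intro X Y X₁ Y₁ hXY
    have hM : ∀ t ∈ I, |X t| ≤ 2 ^ (q + 1)⁻¹ := fun t ht =>
      le_of_tendsto (hXY t ht).1.abs (hpt t ht)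
    refine ⟨Or.inl rfl, ⟨0, h0, ne_zero_or_of_tendsto (hXY 0 h0).1 (hXY 0 h0).2.1
      (Eventually.of_forall fun k => ?_)⟩, fun k hk hX => ?_, fun hX => ?_⟩
    · simp only [mul_zero, add_zero, h.max_div k]
      norm_num
    · exact hX.eq_zero_of_line hk (hlim X fun τ hτ => (hXY τ hτ).1) hM
    · exact hX.deriv_eq_zero_of_line hup hM

/-- The profile vanishes at `R`, which is the rescaled point `(r k - R) / ℓ k`, and the derivative
bound holds up to that point. -/
lemma eventually_boundary_layer (hq : -1 < q) {R : ℝ} (hR : 0 < R)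
    (h : BlowupSeq 𝒰 m q lam γ β₀ N (Ico 0 R) β U V U₁ V₁ r μ ℓ K)
    (hr : ∀ A, ∀ᶠ k in 𝒰, A * ℓ k < r k) (T : ℝ) :
    ∀ᶠ k in 𝒰, -T ≤ (r k - R) / ℓ k → ∀ τ ∈ Ioc ((r k - R) / ℓ k) T,
      |U k (r k + -ℓ k * τ) / μ k| ≤ derivBound q β₀ * (τ - (r k - R) / ℓ k) := by
  filter_upwards [h.eventually_bound_interior hq (Or.inr ⟨R, hR, rfl⟩) hr T] with k hk hkT τ hτ
  have hℓ := h.len_pos k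
  have hb : r k + -ℓ k * ((r k - R) / ℓ k) = R := by field_simp; ring
  have hmem : ∀ σ ∈ Ioc ((r k - R) / ℓ k) τ, r k + -ℓ k * σ ∈ Ico 0 R ∧ 0 < r k + -ℓ k * σ := by
    intro σ hσ
    have h1 := (hk σ ⟨hkT.trans hσ.1.le, hσ.2.trans hτ.2⟩).1
    have := mul_lt_mul_of_pos_left hσ.1 hℓ
    exact ⟨⟨h1.le, by linarith⟩, h1⟩
  have hsol := (h.profile k).sol.scale hq (r k) (h.pos k)
    (s := -ℓ k) (by rw [neg_sq]; exact h.scale k)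
  have hcl : R ∈ closure (Ico 0 R) := by
    rw [closure_Ico hR.ne]; exact right_mem_Icc.2 hR.le
  have hmaps : MapsTo (fun τ => r k + -ℓ k * τ) (Icc ((r k - R) / ℓ k) τ) (closure (Ico 0 R)) := by
    intro σ hσ
    rcases hσ.1.eq_or_lt with rfl | h1
    · simp only [hb]; exact hcl
    · exact subset_closure (hmem σ ⟨h1, hσ.2⟩).1
  have h1 := abs_sub_le_of_deriv_bound (f := fun τ => U k (r k + -ℓ k * τ) / μ k) hτ.1.le
    (((h.profile k).cont_fst.comp (by fun_prop) hmaps).div_const _)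
    (fun t ht => hsol.fst t (hmem t ⟨ht.1, ht.2.le⟩))
    (fun t ht => ((hk t ⟨hkT.trans ht.1.le, ht.2.le.trans hτ.2⟩).2
      (hmem t ⟨ht.1, ht.2.le⟩).1).2.2)
  have h2 := ((h.profile k).boundary R hcl (fun h' => lt_irrefl _ h'.2)).1
  simp only [hb, h2, zero_div, sub_zero] at h1
  exact h1

/-- Either every rescaled point eventually lies in the domain, giving the whole line, or the domain
is a ball and the rescaled boundary position converges to some `b`. In the latter case the limit
lives on `(b, ∞)` with boundary value 0. -/
lemma false_of_interior (hq : -1 < q) (hD : IsRadii D)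
    (h : BlowupSeq 𝒰 m q lam γ β₀ N D β U V U₁ V₁ r μ ℓ K)
    (hr : ∀ A, ∀ᶠ k in 𝒰, A * ℓ k < r k) : False := by
  have hpos : ∀ τ, ∀ᶠ k in 𝒰, 0 ≤ r k + -ℓ k * τ := fun τ =>
    (hr τ).mono fun k hk => by linarith
  by_cases hall : ∀ τ, ∀ᶠ k in 𝒰, r k + -ℓ k * τ ∈ D
  · exact h.false_of_reach hq hD hr isOpen_univ (fun _ _ => subset_univ _) (mem_univ _)
      (fun τ _ => hall τ) fun _ _ => Or.inl rfl
  push Not at hall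
  obtain ⟨τ₀, hτ₀⟩ := hall
  rcases hD with rfl | ⟨R, hR, rfl⟩
  · obtain ⟨k, hk1, hk2⟩ := (hτ₀.and (hpos τ₀)).exists
    exact hk1 hk2
  have hb0 : ∀ k, (r k - R) / ℓ k < 0 := fun k =>
    div_neg_of_neg_of_pos (by linarith [(h.mem k).2]) (h.len_pos k)
  have hbτ : ∀ᶠ k in 𝒰, τ₀ ≤ (r k - R) / ℓ k := by
    filter_upwards [hτ₀, hpos τ₀] with k hk1 hk2
    rw [le_div_iff₀ (h.len_pos k)]
    by_contra! hlt
    exact hk1 ⟨hk2, by linarith⟩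
  obtain ⟨b, hb, -⟩ := exists_tendsto_of_bounded 𝒰 (f := fun k => (r k - R) / ℓ k) (L := |τ₀|)
    (hbτ.mono fun k hk => abs_le.2 ⟨by linarith [neg_abs_le τ₀],
      (hb0 k).le.trans (abs_nonneg _)⟩)
  have hlayer : ∀ τ, b < τ → ∀ᶠ k in 𝒰,
      |U k (r k + -ℓ k * τ) / μ k| ≤ derivBound q β₀ * (τ - (r k - R) / ℓ k) ∧
      |V k (r k + -ℓ k * τ) / μ k| ≤ derivBound q β₀ * (τ - (r k - R) / ℓ k) := fun τ hτ => by
    filter_upwards [h.eventually_boundary_layer hq hR hr (max |τ₀| τ),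
      h.swap.eventually_boundary_layer hq hR hr (max |τ₀| τ), hbτ,
      hb.eventually (gt_mem_nhds hτ)] with k h1 h2 h3 h4
    have h5 : -max |τ₀| τ ≤ (r k - R) / ℓ k := by
      linarith [neg_abs_le τ₀, le_max_left |τ₀| τ]
    exact ⟨h1 h5 τ ⟨h4, le_max_right _ _⟩, h2 h5 τ ⟨h4, le_max_right _ _⟩⟩
  -- The norm is 1 at the centre and 0 on the boundary with bounded slope, so the rescaled distance
  -- between them stays away from 0.
  have hbneg : b < 0 := by
    refine lt_of_le_of_ne (le_of_tendsto' hb fun k => (hb0 k).le) ?_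
    rintro rfl
    have h1 : ∀ᶠ k in 𝒰, derivBound q β₀ * (0 - (r k - R) / ℓ k) < 1 := by
      have := (hb.const_sub 0).const_mul (derivBound q β₀)
      rw [sub_zero, mul_zero] at this
      exact this.eventually (gt_mem_nhds one_pos)
    have h2 : ∀ᶠ k in 𝒰, 1 ≤ derivBound q β₀ * (0 - (r k - R) / ℓ k) := by
      filter_upwards [h.eventually_boundary_layer hq hR hr |τ₀|,
        h.swap.eventually_boundary_layer hq hR hr |τ₀|, hbτ] with k h1 h2 h3
      have h5 : -|τ₀| ≤ (r k - R) / ℓ k := by linarith [neg_abs_le τ₀]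
      have h6 := h1 h5 0 ⟨hb0 k, abs_nonneg _⟩
      have h7 := h2 h5 0 ⟨hb0 k, abs_nonneg _⟩
      rw [mul_zero, add_zero] at h6 h7
      rw [← h.max_div k]
      exact max_le h6 h7
    obtain ⟨k, hk1, hk2⟩ := (h1.and h2).exists
    linarith
  refine h.false_of_reach hq (Or.inr ⟨R, hR, rfl⟩) hr isOpen_Ioi
    (fun s hs => Ici_subset_Ioi.2 hs) (mem_Ioi.2 hbneg) (fun τ hτ => ?_)
    fun X hX => Or.inr ⟨b, rfl, ?_⟩
  · filter_upwards [hpos τ, hb.eventually (gt_mem_nhds hτ)] with k hk1 hk2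
    rw [div_lt_iff₀ (h.len_pos k)] at hk2
    exact ⟨hk1, by linarith⟩
  · have h1 : ∀ τ ∈ Ioi b, |X τ| ≤ derivBound q β₀ * (τ - b) := fun τ hτ =>
      le_of_tendsto_of_tendsto (hX τ hτ).abs ((hb.const_sub τ).const_mul (derivBound q β₀))
        ((hlayer τ hτ).mono fun k hk => hk.1)
    have h2 : Tendsto (fun τ => derivBound q β₀ * (τ - b)) (𝓝[>] b) (𝓝 0) := by
      have : Tendsto (fun τ => derivBound q β₀ * (τ - b)) (𝓝 b) (𝓝 (derivBound q β₀ * (b - b))) :=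
        Continuous.tendsto (by fun_prop) b
      rw [sub_self, mul_zero] at this
      exact this.mono_left nhdsWithin_le_nhds
    refine squeeze_zero_norm' ?_ h2
    filter_upwards [self_mem_nhdsWithin] with τ hτ using h1 τ hτ

lemma not_blowupSeq (hq : -1 < q) (hm : m ≤ 2) (hmq : m = 2 → q < 1) (hD : IsRadii D) :
    ¬ BlowupSeq 𝒰 m q lam γ β₀ N D β U V U₁ V₁ r μ ℓ K := by
  intro h
  by_cases hA : ∃ A, ∀ᶠ k in 𝒰, r k ≤ A * ℓ k
  · obtain ⟨A, hA⟩ := hA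
    exact h.false_of_origin hq hm hmq hD hA
  · push Not at hA
    refine h.false_of_interior hq hD fun A => ?_
    simpa only [not_le] using hA A

end BlowupSeq

/-! ### A priori bound for profiles -/

lemma Profile.forall_of_forall_pos {m : ℕ} {q lam γ β : ℝ} {D : Set ℝ} {U V U₁ V₁ : ℝ → ℝ}
    (hD : IsRadii D) (h : Profile m q lam γ β D U V U₁ V₁)
    (hUV : ∀ t ∈ D ∩ Ioi 0, U t = V t) : ∀ t ∈ D, U t = V t := by
  intro t ht
  rcases (hD.nonneg ht).eq_or_lt with rfl | h0
  · have hcl : (0 : ℝ) ∈ closure (D ∩ Ioi 0) := by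
      obtain ⟨δ, hδ, hδD⟩ := hD.exists_pos
      refine closure_mono (fun s hs => ⟨hD.down hδD hs.1.le hs.2.le, hs.1⟩ :
        Ioo 0 δ ⊆ D ∩ Ioi 0) ?_
      rw [closure_Ioo hδ.ne]; exact left_mem_Icc.2 hδ.le
    have hne : (𝓝[D ∩ Ioi 0] (0 : ℝ)).NeBot := mem_closure_iff_nhdsWithin_neBot.1 hcl
    have hsub : D ∩ Ioi 0 ⊆ closure D := inter_subset_left.trans subset_closure
    refine tendsto_nhds_unique ((h.cont_fst 0 (subset_closure ht)).mono hsub)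
      (((h.cont_snd 0 (subset_closure ht)).mono hsub).congr' ?_)
    filter_upwards [self_mem_nhdsWithin] with s hs using (hUV s hs).symm
  · exact hUV t ⟨ht, h0⟩

lemma Profile.neg_right {m : ℕ} {q lam γ β : ℝ} {D : Set ℝ} {U V U₁ V₁ : ℝ → ℝ}
    (h : Profile m q lam γ β D U V U₁ V₁) :
    Profile m q lam (-γ) β D U (fun t => -V t) U₁ fun t => -V₁ t :=
  ⟨h.sol.neg_right, h.cont_fst, h.cont_snd.neg, h.deriv_fst, by simpa using h.deriv_snd.neg,
    fun t h1 h2 => ⟨(h.boundary t h1 h2).1, by simp [(h.boundary t h1 h2).2]⟩⟩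

/-- A priori bound for radial profiles with few alternations. -/
theorem exists_bound_of_profile {m : ℕ} {q lam γ : ℝ} {D : Set ℝ} {N : ℕ} (hq : -1 < q)
    (hm : m ≤ 2) (hmq : m = 2 → q < 1) (hD : IsRadii D) {B Bs : Set ℝ} (hB : IsCompact B)
    (hB' : B ⊆ {-1}ᶜ) (hBs : IsCompact Bs) :
    ∃ C : ℝ, ∀ (β : ℝ) (U V U₁ V₁ : ℝ → ℝ), Profile m q lam γ β D U V U₁ V₁ →
      ¬ HasAlternation N D U → ¬ HasAlternation N D V →
      (¬ HasAlternation N D fun t => U t - V t) → (¬ HasAlternation N D fun t => U t + V t) →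
      (β ∈ B ∨ (β ∈ Bs ∧ (¬ ∀ t ∈ D, U t = V t) ∧ ¬ ∀ t ∈ D, U t = -V t)) →
      ∀ t ∈ D, max |U t| |V t| ≤ C := by
  by_contra! hneg
  choose β U V U₁ V₁ hP h1 h2 h3 h4 hβ y hy hCy using fun k : ℕ => hneg (k + 1)
  choose r μ ℓ K hr hμ hℓ hs hAK hKℓ hmax hb using fun k : ℕ =>
    (hP k).exists_scale hq (by positivity : (0 : ℝ) < k + 1) (hy k) (hCy k).le
  set 𝒰 : Ultrafilter ℕ := hyperfilter ℕ with h𝒰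
  have h𝒰top : (𝒰 : Filter ℕ) ≤ atTop := Nat.hyperfilter_le_atTop
  have hβmem : ∀ k, β k ∈ B ∪ Bs := fun k => (hβ k).imp id fun h => h.1
  obtain ⟨β₀, -, hβ₀⟩ := (hB.union hBs).ultrafilter_le_nhds (𝒰.map β)
    (le_principal_iff.2 (Ultrafilter.mem_map.2 (Eventually.of_forall hβmem)))
  have hA : Tendsto (fun k : ℕ => ((k : ℝ) + 1) ^ (q + 1) / 2) atTop atTop :=
    ((tendsto_rpow_atTop (by linarith)).comp
      (tendsto_atTop_add_const_right _ 1 tendsto_natCast_atTop_atTop)).atTop_div_const two_pos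
  have hK : Tendsto K atTop atTop := tendsto_atTop_mono hAK hA
  have hℓ0 : Tendsto ℓ atTop (𝓝 0) := by
    refine squeeze_zero (fun k => (hℓ k).le) (fun k => ?_) (hK.const_div_atTop (1 / 2))
    have : 0 < K k := lt_of_lt_of_le (by positivity) (hAK k)
    rw [le_div_iff₀ this, mul_comm]
    exact hKℓ k
  refine BlowupSeq.not_blowupSeq (𝒰 := 𝒰) (lam := lam) (γ := γ) (β₀ := β₀) (N := N) (D := D)
    (β := β) (U := U) (V := V) (U₁ := U₁) (V₁ := V₁) (r := r) (μ := μ) (ℓ := ℓ) (K := K) hq hm hmq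
    hD ⟨hP, hr, hμ, hℓ, hs, hmax, hb, hK.mono_left h𝒰top, hℓ0.mono_left h𝒰top, hβ₀, h1, h2, h3,
      h4, ?_⟩
  rintro rfl
  -- Since `B` is closed and omits `-1`, parameters tending to `-1` eventually leave it, and only
  -- the alternative with `u ≢ ±v` remains.
  have hnB : ∀ᶠ k in 𝒰, β k ∉ B :=
    hβ₀ (hB.isClosed.isOpen_compl.mem_nhds fun hmem => hB' hmem rfl)
  filter_upwards [hnB] with k hk
  obtain ⟨-, hne1, hne2⟩ := (hβ k).resolve_left hk
  obtain ⟨t₁, ht₁, hne1⟩ := hne1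
  obtain ⟨t₂, ht₂, hne2⟩ := hne2
  exact ⟨fun h => hne1 ((hP k).forall_of_forall_pos hD h t₁ ht₁),
    fun h => hne2 ((hP k).neg_right.forall_of_forall_pos hD h t₂ ht₂)⟩

/-! ### From the partial differential equation to profiles on a ray -/

section
variable {m : ℕ}

/-- The point at signed distance `t` from the origin on the first coordinate axis. -/
noncomputable def axis (m : ℕ) : EuclideanSpace ℝ (Fin (m + 1)) := EuclideanSpace.single 0 1

@[simp] lemma norm_smul_axis (t : ℝ) : ‖t • axis m‖ = |t| := by
  simp [axis, norm_smul]

lemma isOpen_of_domain {Ω : Set (EuclideanSpace ℝ (Fin (m + 1)))}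
    (hΩ : Ω = univ ∨ ∃ R : ℝ, 0 < R ∧ Ω = Metric.ball 0 R) : IsOpen Ω := by
  rcases hΩ with rfl | ⟨R, -, rfl⟩
  · exact isOpen_univ
  · exact Metric.isOpen_ball

lemma mem_of_norm_mem {Ω : Set (EuclideanSpace ℝ (Fin (m + 1)))}
    (hΩ : Ω = univ ∨ ∃ R : ℝ, 0 < R ∧ Ω = Metric.ball 0 R) {x : EuclideanSpace ℝ (Fin (m + 1))}
    (hx : ‖x‖ ∈ norm '' Ω) : x ∈ Ω := by
  rcases hΩ with rfl | ⟨R, -, rfl⟩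
  · exact mem_univ _
  · obtain ⟨y, hy, hyx⟩ := hx
    rw [mem_ball_zero_iff] at hy ⊢
    rwa [← hyx]

lemma isRadii_image_norm {Ω : Set (EuclideanSpace ℝ (Fin (m + 1)))}
    (hΩ : Ω = univ ∨ ∃ R : ℝ, 0 < R ∧ Ω = Metric.ball 0 R) : IsRadii (norm '' Ω) := by
  have key : ∀ t : ℝ, 0 ≤ t → t • axis m ∈ Ω → t ∈ norm '' Ω := fun t ht h =>
    ⟨_, h, by rw [norm_smul_axis, abs_of_nonneg ht]⟩
  rcases hΩ with rfl | ⟨R, hR, rfl⟩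
  · refine Or.inl (subset_antisymm ?_ fun t ht => key t ht (mem_univ _))
    rintro _ ⟨x, -, rfl⟩
    exact norm_nonneg x
  · refine Or.inr ⟨R, hR, subset_antisymm ?_ fun t ht => key t ht.1 ?_⟩
    · rintro _ ⟨x, hx, rfl⟩
      exact ⟨norm_nonneg x, mem_ball_zero_iff.1 hx⟩
    · rw [mem_ball_zero_iff, norm_smul_axis, abs_of_nonneg ht.1]
      exact ht.2

section
variable {E : Type*} [NormedAddCommGroup E] [NormedSpace ℝ E] {u : E → ℝ} {a b : E} {s : ℝ}

lemma hasDerivAt_line (h : DifferentiableAt ℝ u (a + s • b)) :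
    HasDerivAt (fun s : ℝ => u (a + s • b)) (fderiv ℝ u (a + s • b) b) s := by
  have h1 : HasDerivAt (fun s : ℝ => a + s • b) b s := by
    simpa using ((hasDerivAt_id s).smul_const b).const_add a
  exact h.hasFDerivAt.comp_hasDerivAt s h1

lemma hasDerivAt_fderiv_line (h : ContDiffAt ℝ 2 u (a + s • b)) :
    HasDerivAt (fun s : ℝ => fderiv ℝ u (a + s • b) b)
      (iteratedFDeriv ℝ 2 u (a + s • b) ![b, b]) s := by
  have h1 : HasDerivAt (fun s : ℝ => a + s • b) b s := by
    simpa using ((hasDerivAt_id s).smul_const b).const_add a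
  have h2 : DifferentiableAt ℝ (fderiv ℝ u) (a + s • b) :=
    (h.fderiv_right (m := 1) (by norm_num)).differentiableAt one_ne_zero
  have h3 : HasDerivAt (fun s : ℝ => fderiv ℝ u (a + s • b))
      (fderiv ℝ (fderiv ℝ u) (a + s • b) b) s := h2.hasFDerivAt.comp_hasDerivAt s h1
  have h4 := (ContinuousLinearMap.apply ℝ ℝ b).hasFDerivAt.comp_hasDerivAt s h3
  rw [iteratedFDeriv_two_apply]
  exact h4

end

lemma hasDerivAt_sqrt_add_sq {t : ℝ} (ht : t ≠ 0) (s : ℝ) :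
    HasDerivAt (fun s => √(t ^ 2 + s ^ 2)) (s * (√(t ^ 2 + s ^ 2))⁻¹) s := by
  have h1 : HasDerivAt (fun s : ℝ => t ^ 2 + s ^ 2) (2 * s) s := by
    simpa using ((hasDerivAt_id s).pow 2).const_add (t ^ 2)
  refine (h1.sqrt (by positivity)).congr_deriv ?_
  have : 0 < √(t ^ 2 + s ^ 2) := Real.sqrt_pos.2 (by positivity)
  field_simp

variable {Ω : Set (EuclideanSpace ℝ (Fin (m + 1)))} {u : EuclideanSpace ℝ (Fin (m + 1)) → ℝ}
  {W : ℝ → ℝ}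

lemma hasDerivAt_axis (hΩ : IsOpen Ω) (hu : ContDiffOn ℝ 2 u Ω) {t : ℝ} (ht : t • axis m ∈ Ω) :
    HasDerivAt (fun t : ℝ => u (t • axis m)) (fderiv ℝ u (t • axis m) (axis m)) t ∧
    HasDerivAt (fun t : ℝ => fderiv ℝ u (t • axis m) (axis m))
      (iteratedFDeriv ℝ 2 u (t • axis m) ![axis m, axis m]) t := by
  have h := hu.contDiffAt (hΩ.mem_nhds ht)
  constructor
  · simpa using hasDerivAt_line (a := 0) (b := axis m) (s := t)
      (by simpa using h.differentiableAt two_ne_zero)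
  · simpa using hasDerivAt_fderiv_line (a := 0) (b := axis m) (s := t) (by simpa using h)

/-- Along a line orthogonal to the axis at distance `t` from the origin, a radial function is the
axial profile at `√(t² + s²)`. Its second derivative at `s = 0` is the profile's derivative divided
by `t`; summing over these directions produces the friction term. -/
lemma iteratedFDeriv_transverse (hΩ : Ω = univ ∨ ∃ R : ℝ, 0 < R ∧ Ω = Metric.ball 0 R)
    (hu : ContDiffOn ℝ 2 u Ω) (hW : ∀ x ∈ Ω, u x = W ‖x‖) {t : ℝ} (ht0 : 0 < t)
    (ht : t • axis m ∈ Ω) (i : Fin m) :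
    iteratedFDeriv ℝ 2 u (t • axis m)
      ![EuclideanSpace.single i.succ 1, EuclideanSpace.single i.succ 1] =
      fderiv ℝ u (t • axis m) (axis m) / t := by
  set b : EuclideanSpace ℝ (Fin (m + 1)) := EuclideanSpace.single i.succ 1 with hb
  have hopen := isOpen_of_domain hΩ
  have hnorm : ∀ s : ℝ, ‖t • axis m + s • b‖ = √(t ^ 2 + s ^ 2) := by
    intro s
    rw [← Real.sqrt_sq (norm_nonneg _), norm_add_sq_real, norm_smul_axis]
    have h1 : inner ℝ (t • axis m) (s • b) = 0 := by
      simp [inner_smul_left, inner_smul_right, axis, hb, EuclideanSpace.inner_single_left]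
    have h2 : ‖s • b‖ = |s| := by simp [hb, norm_smul]
    rw [h1, h2, sq_abs, sq_abs]; ring_nf
  have hnear : ∀ᶠ s : ℝ in 𝓝 0, t • axis m + s • b ∈ Ω := by
    have hc : Continuous fun s : ℝ => t • axis m + s • b := by fun_prop
    exact hc.continuousAt.preimage_mem_nhds (hopen.mem_nhds (by simpa using ht))
  set U₁ := fun t : ℝ => fderiv ℝ u (t • axis m) (axis m) with hU₁
  have hmem : ∀ s, t • axis m + s • b ∈ Ω → √(t ^ 2 + s ^ 2) • axis m ∈ Ω := fun s hs =>
    mem_of_norm_mem hΩ (by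
      rw [norm_smul_axis, abs_of_nonneg (Real.sqrt_nonneg _), ← hnorm]
      exact mem_image_of_mem _ hs)
  have heq : (fun s : ℝ => u (t • axis m + s • b)) =ᶠ[𝓝 0]
      fun s => u (√(t ^ 2 + s ^ 2) • axis m) := by
    filter_upwards [hnear] with s hs
    rw [hW _ hs, hW _ (hmem s hs), hnorm, norm_smul_axis, abs_of_nonneg (Real.sqrt_nonneg _)]
  have hderiv : (fun s : ℝ => fderiv ℝ u (t • axis m + s • b) b) =ᶠ[𝓝 0]
      fun s => U₁ (√(t ^ 2 + s ^ 2)) * (s * (√(t ^ 2 + s ^ 2))⁻¹) := by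
    filter_upwards [hnear, heq.eventuallyEq_nhds] with s hs hs'
    have h1 := hasDerivAt_line (u := u) (a := t • axis m) (b := b) (s := s)
      ((hu.contDiffAt (hopen.mem_nhds hs)).differentiableAt two_ne_zero)
    have h2 := (hasDerivAt_axis hopen hu (hmem s hs)).1.comp s (hasDerivAt_sqrt_add_sq ht0.ne' s)
    exact h1.unique (h2.congr_of_eventuallyEq hs')
  have hsqrt : √(t ^ 2 + 0 ^ 2) = t := by simp [Real.sqrt_sq ht0.le]
  have h1 := hasDerivAt_fderiv_line (u := u) (a := t • axis m) (b := b) (s := 0)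
    (hu.contDiffAt (hopen.mem_nhds (by simpa using ht)))
  have hρ := hasDerivAt_sqrt_add_sq ht0.ne' 0
  have h2 : HasDerivAt (fun s => U₁ (√(t ^ 2 + s ^ 2))) _ 0 :=
    (HasDerivAt.comp (h₂ := U₁) 0 (by rw [hsqrt]; exact (hasDerivAt_axis hopen hu ht).2) hρ)
  have h3 := h2.mul ((hasDerivAt_id (0 : ℝ)).mul (hρ.inv (by rw [hsqrt]; exact ht0.ne')))
  have h4 := h1.unique (h3.congr_of_eventuallyEq hderiv)
  simp only [zero_smul, add_zero] at h4
  rw [h4]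
  simp [Real.sqrt_sq ht0.le, hU₁, div_eq_mul_inv]

lemma laplacian_axis (hΩ : Ω = univ ∨ ∃ R : ℝ, 0 < R ∧ Ω = Metric.ball 0 R)
    (hu : ContDiffOn ℝ 2 u Ω) (hW : ∀ x ∈ Ω, u x = W ‖x‖) {t : ℝ} (ht0 : 0 < t)
    (ht : t • axis m ∈ Ω) :
    Laplacian.laplacian u (t • axis m) =
      iteratedFDeriv ℝ 2 u (t • axis m) ![axis m, axis m] +
        m / t * fderiv ℝ u (t • axis m) (axis m) := by
  rw [InnerProductSpace.laplacian_eq_iteratedFDeriv_orthonormalBasis u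
    (EuclideanSpace.basisFun (Fin (m + 1)) ℝ)]
  simp only [EuclideanSpace.basisFun_apply, Fin.sum_univ_succ,
    iteratedFDeriv_transverse hΩ hu hW ht0 ht, Finset.sum_const, Finset.card_univ,
    Fintype.card_fin, nsmul_eq_mul]
  rw [← axis]
  ring

/-- The restriction of a radial function to the axis is even. -/
lemma fderiv_axis_zero (hΩ : IsOpen Ω) (h0 : (0 : EuclideanSpace ℝ (Fin (m + 1))) ∈ Ω)
    (hu : ContDiffOn ℝ 2 u Ω) (hW : ∀ x ∈ Ω, u x = W ‖x‖) :
    fderiv ℝ u ((0 : ℝ) • axis m) (axis m) = 0 := by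
  have h1 := (hasDerivAt_axis hΩ hu (t := 0) (by simpa using h0)).1
  have h2 : HasDerivAt (fun t : ℝ => u ((-t) • axis m))
      (-fderiv ℝ u ((0 : ℝ) • axis m) (axis m)) 0 :=
    hasDerivAt_comp_neg (w := fun t : ℝ => u (t • axis m)) (by rwa [neg_zero])
  have hnear : ∀ ε : ℝ, ∀ᶠ t : ℝ in 𝓝 0, (ε * t) • axis m ∈ Ω := fun ε => by
    have hc : Continuous fun t : ℝ => (ε * t) • axis m := by fun_prop
    exact hc.continuousAt.preimage_mem_nhds (hΩ.mem_nhds (by simpa using h0))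
  have h3 : (fun t : ℝ => u ((-t) • axis m)) =ᶠ[𝓝 0] fun t => u (t • axis m) := by
    filter_upwards [hnear 1, hnear (-1)] with t h4 h5
    rw [one_mul] at h4
    rw [neg_one_mul] at h5
    rw [hW _ h4, hW _ h5, norm_smul_axis, norm_smul_axis, abs_neg]
  have := h1.unique (h2.congr_of_eventuallyEq h3.symm)
  linarith

/-- The restriction of `u` to the axis serves as profile instead of the given `W`, because it
inherits regularity at 0 and continuity up to the boundary radius. -/
lemma profile_of_isClassicalSolution {q lam γ β : ℝ} {v : EuclideanSpace ℝ (Fin (m + 1)) → ℝ}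
    {W' : ℝ → ℝ} (hΩ : Ω = univ ∨ ∃ R : ℝ, 0 < R ∧ Ω = Metric.ball 0 R)
    (h : IsClassicalSolution Ω q lam γ β u v) (hW : ∀ x ∈ Ω, u x = W ‖x‖)
    (hW' : ∀ x ∈ Ω, v x = W' ‖x‖) :
    Profile m q lam γ β (norm '' Ω) (fun t => u (t • axis m)) (fun t => v (t • axis m))
      (fun t => fderiv ℝ u (t • axis m) (axis m)) fun t => fderiv ℝ v (t • axis m) (axis m) := by
  have hD := isRadii_image_norm hΩ
  have hopen := isOpen_of_domain hΩ
  have hmem : ∀ t ∈ norm '' Ω, t • axis m ∈ Ω := fun t ht =>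
    mem_of_norm_mem hΩ (by rwa [norm_smul_axis, abs_of_nonneg (hD.nonneg ht)])
  have hmem₀ : (0 : EuclideanSpace ℝ (Fin (m + 1))) ∈ Ω := by
    simpa using hmem 0 hD.zero_mem
  have hcl : MapsTo (fun t : ℝ => t • axis m) (closure (norm '' Ω)) (closure Ω) :=
    MapsTo.closure (fun t ht => hmem t ht) (by fun_prop)
  have hlim : ∀ {w : EuclideanSpace ℝ (Fin (m + 1)) → ℝ} {Z : ℝ → ℝ}, ContDiffOn ℝ 2 w Ω →
      (∀ x ∈ Ω, w x = Z ‖x‖) →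
      Tendsto (fun t : ℝ => fderiv ℝ w (t • axis m) (axis m)) (𝓝[>] 0) (𝓝 0) := by
    intro w Z hw hZ
    have := (hasDerivAt_axis hopen hw (t := 0) (by simpa using hmem₀)).2.continuousAt.tendsto
    rw [fderiv_axis_zero hopen hmem₀ hw hZ] at this
    exact this.mono_left nhdsWithin_le_nhds
  refine ⟨⟨fun t ht => (hasDerivAt_axis hopen h.contDiffOn_fst (hmem t ht.1)).1,
    fun t ht => (hasDerivAt_axis hopen h.contDiffOn_snd (hmem t ht.1)).1, fun t ht => ?_,
    fun t ht => ?_⟩, h.continuousOn_fst.comp (by fun_prop) hcl,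
    h.continuousOn_snd.comp (by fun_prop) hcl, hlim h.contDiffOn_fst hW, hlim h.contDiffOn_snd hW',
    fun t ht htD => ?_⟩
  · refine (hasDerivAt_axis hopen h.contDiffOn_fst (hmem t ht.1)).2.congr_deriv ?_
    have h1 := h.eqn_fst _ (hmem t ht.1)
    have h2 := laplacian_axis hΩ h.contDiffOn_fst hW ht.2 (hmem t ht.1)
    unfold nl
    linarith
  · refine (hasDerivAt_axis hopen h.contDiffOn_snd (hmem t ht.1)).2.congr_deriv ?_
    have h1 := h.eqn_snd _ (hmem t ht.1)
    have h2 := laplacian_axis hΩ h.contDiffOn_snd hW' ht.2 (hmem t ht.1)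
    unfold nl
    linarith
  · have hfr : t • axis m ∈ frontier Ω := by
      rw [hopen.frontier_eq]
      refine ⟨hcl ht, fun h' => htD ⟨_, h', ?_⟩⟩
      rw [norm_smul_axis, abs_of_nonneg (hD.nonneg_of_closure ht)]
    exact ⟨h.boundary_fst _ hfr, h.boundary_snd _ hfr⟩

end

lemma HasAlternation.congr {N : ℕ} {D : Set ℝ} {f g : ℝ → ℝ} (h : HasAlternation N D f)
    (hfg : ∀ t ∈ D, f t = g t) : HasAlternation N D g := by
  obtain ⟨t, h1, h2, h3⟩ := h
  refine ⟨t, h1, h2, fun i hi => ?_⟩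
  rw [← hfg _ (h2 _ (by lia)), ← hfg _ (h2 _ (by lia))]
  exact h3 i hi

end RadialSystem

open RadialSystem in
theorem mainTheorem2 (n : ℕ) (hn₁ : 1 ≤ n) (hn₃ : n ≤ 3)
    (Ω : Set (EuclideanSpace ℝ (Fin n)))
    (hΩ : Ω = Set.univ ∨ ∃ R : ℝ, 0 < R ∧ Ω = Metric.ball 0 R)
    (lam γ p q : ℝ) (hpq : p = 2 * q + 3) (hp₁ : 1 < p) (hpS : (p : EReal) < sobolevExponent n)
    (C₁ C₂ C₃ C₄ : ℝ≥0)
    (B : Set ℝ) (hB : IsCompact B) (hB' : B ⊆ {-1}ᶜ)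
    (Bstar : Set ℝ) (hBstar : IsCompact Bstar) :
    ∃ C : ℝ, ∀ (β : ℝ) (u v : EuclideanSpace ℝ (Fin n) → ℝ),
      IsClassicalSolution Ω q lam γ β u v →
      ((β ∈ B ∧ (u, v) ∈ classK Ω C₁ C₂ C₃ C₄) ∨
        (β ∈ Bstar ∧ (u, v) ∈ classKStar Ω C₁ C₂ C₃ C₄)) →
      ∀ x ∈ Ω, ‖(u x, v x)‖ ≤ C := by
  obtain ⟨m, rfl⟩ : ∃ m, n = m + 1 := ⟨n - 1, by lia⟩
  have hq : -1 < q := by linarith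
  have hmq : m = 2 → q < 1 := by
    rintro rfl
    -- In dimension three the critical exponent is 5, so subcriticality means `2 q + 3 < 5`.
    have h3 : sobolevExponent (2 + 1) = ((5 : ℝ) : EReal) := by
      norm_num [sobolevExponent]
    rw [h3, EReal.coe_lt_coe_iff] at hpS
    linarith
  have hD := isRadii_image_norm hΩ
  -- One integer above all four zero number bounds excludes `N` alternations for every function
  -- involved.
  obtain ⟨N, hN⟩ := exists_nat_gt (max (max (C₁ : ℝ) C₂) (max C₃ C₄))
  simp only [max_lt_iff] at hN
  obtain ⟨C, hC⟩ := exists_bound_of_profile (lam := lam) (γ := γ) (N := N) hq (by lia) hmq hD hB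
    hB' hBstar
  refine ⟨C, fun β u v h hβ x hx => ?_⟩
  have hmem : ∀ t ∈ norm '' Ω, t • axis m ∈ Ω := fun t ht =>
    mem_of_norm_mem hΩ (by rwa [norm_smul_axis, abs_of_nonneg (hD.nonneg ht)])
  obtain ⟨W, W', ⟨-, hW⟩, ⟨-, hW'⟩, hz₁, hz₂, hz₃, hz₄⟩ : (u, v) ∈ classK Ω C₁ C₂ C₃ C₄ :=
    hβ.elim (fun h => h.2) fun h => h.2.1
  change ∀ x ∈ Ω, u x = W ‖x‖ at hW
  change ∀ x ∈ Ω, v x = W' ‖x‖ at hW'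
  have hU : ∀ t ∈ norm '' Ω, u (t • axis m) = W t := fun t ht => by
    have := hW _ (hmem t ht)
    rwa [norm_smul_axis, abs_of_nonneg (hD.nonneg ht)] at this
  have hV : ∀ t ∈ norm '' Ω, v (t • axis m) = W' t := fun t ht => by
    have := hW' _ (hmem t ht)
    rwa [norm_smul_axis, abs_of_nonneg (hD.nonneg ht)] at this
  have hxD : ‖x‖ ∈ norm '' Ω := Set.mem_image_of_mem _ hx
  have hux : u x = u (‖x‖ • axis m) := (hW x hx).trans (hU _ hxD).symm
  have hvx : v x = v (‖x‖ • axis m) := (hW' x hx).trans (hV _ hxD).symm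
  rw [Prod.norm_def, Real.norm_eq_abs, Real.norm_eq_abs, hux, hvx]
  refine hC β _ _ _ _ (profile_of_isClassicalSolution hΩ h hW hW')
    (fun h' => not_hasAlternation hz₁ hN.1.1 (h'.congr hU))
    (fun h' => not_hasAlternation hz₂ hN.1.2 (h'.congr hV))
    (fun h' => not_hasAlternation hz₃ hN.2.1 (h'.congr fun t ht => by rw [hU t ht, hV t ht]))
    (fun h' => not_hasAlternation hz₄ hN.2.2 (h'.congr fun t ht => by rw [hU t ht, hV t ht]))
    (hβ.imp (fun h => h.1) fun h => ⟨h.1, fun h' => h.2.2.1 fun y hy => ?_,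
      fun h' => h.2.2.2 fun y hy => ?_⟩) ‖x‖ hxD
  · have hyD : ‖y‖ ∈ norm '' Ω := Set.mem_image_of_mem _ hy
    change u y = v y
    rw [hW y hy, hW' y hy, ← hU _ hyD, ← hV _ hyD]
    exact h' _ hyD
  · have hyD : ‖y‖ ∈ norm '' Ω := Set.mem_image_of_mem _ hy
    change u y = -v y
    rw [hW y hy, hW' y hy, ← hU _ hyD, ← hV _ hyD]
    exact h' _ hyD
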